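/- Let $U\subset\mathbb C$ be a simply connected domain and let $\phi$ be a meromorphic function on $U$ with only finitely many poles in $U$; let $P$ be the set of these poles. Suppose that near each pole $c\in P$ $$\phi(z)=\frac{1-d^2}{2(z-c)^2}+\frac{a_1}{z-c}+a_2+a_3(z-c)+\cdots\qquad (z\to c)$$ for some integer $d=d(c)\ge 2$ and coefficients $a_i=a_i(c)\in\mathbb C$. A Schwarzian primitive of $\phi$ on an open set $V\subset U$ is a holomorphic map $f:V\to\widehat{\mathbb C}$, not constant on any component of $V$, whose Schwarzian derivative $S_f=\frac{f'''}{f'}-\frac32\left(\frac{f''}{f'}\right)^2$ equals $\phi$ as a meromorphic function on $V$. For $b\in U\setminus P$ and a Schwarzian primitive $f_0$ of $\phi$ near $b$ (one always exists), the holonomy group of $\phi$ is the set of all Möbius transformations $\gamma$ of $\widehat{\mathbb C}$ such that, for some loop $p$ in $U\setminus P$ based at $b$, analytic continuation of $f_0$ along $p$ leads to $\gamma\circ f_0$; it depends on $b$ and $f_0$ only up to conjugation by a Möbius transformation. Then, for every choice of $b$ and $f_0$: 1. The holonomy group of $\phi$ is a group generated by a finite (possibly empty) set of parabolic Möbius transformations.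 2. The following are equivalent: (i) there is a Schwarzian primitive $f:U\to\widehat{\mathbb C}$ of $\phi$ on $U$; (ii) at every pole $c\in P$, with $d=d(c)$, $a_i=a_i(c)$ and $k_j=2j(j-d)$, $$\det\begin{pmatrix}a_1&k_1&0&\cdots&0\\ a_2&a_1&k_2&\cdots&0\\ \vdots&\vdots&\vdots&&\vdots\\ a_{d-1}&a_{d-2}&a_{d-3}&\cdots&k_{d-1}\\ a_d&a_{d-1}&a_{d-2}&\cdots&a_1\end{pmatrix}=0;$$ (iii) the holonomy group of $\phi$ consists of the identity only. 3. If $f$ is a Schwarzian primitive of $\phi$ on $U$, then the Schwarzian primitives of $\phi$ on $U$ are exactly the maps $\gamma\circ f$ with $\gamma$ a Möbius transformation. -/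

import Mathlib

open Filter Topology OnePoint

noncomputable section

namespace SchwarzianPrimitive

/-- The coordinate `w` on the finite part of the Riemann sphere `OnePoint ℂ`
(with the irrelevant value `0` at `∞`). -/
def finiteCoord (w : OnePoint ℂ) : ℂ := w.elim 0 (fun x => x)

/-- The coordinate `1 / w` near `∞` on the Riemann sphere `OnePoint ℂ`, with value `0` at `∞`
(and the irrelevant value `0` at `w = 0`). -/
def inftyCoord (w : OnePoint ℂ) : ℂ := w.elim 0 (fun x => x⁻¹)

/-- `f` is holomorphic near `z` as a map into the Riemann sphere `OnePoint ℂ`: it is continuous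
at `z`, and it is analytic at `z` when read in the coordinate `w` if `f z` is finite, and in the
coordinate `1 / w` if `f z = ∞`. -/
def IsHolomorphicAt (f : ℂ → OnePoint ℂ) (z : ℂ) : Prop :=
  ContinuousAt f z ∧
    (f z ≠ ∞ → AnalyticAt ℂ (fun w => finiteCoord (f w)) z) ∧
    (f z = ∞ → AnalyticAt ℂ (fun w => inftyCoord (f w)) z)

/-- The expression `g''' / g' - (3 / 2) (g'' / g') ^ 2`. -/
def schwarzianExpr (g : ℂ → ℂ) (z : ℂ) : ℂ :=
  iteratedDeriv 3 g z / deriv g z - 3 / 2 * (iteratedDeriv 2 g z / deriv g z) ^ 2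

open Classical in
/-- The Schwarzian derivative of a map into the Riemann sphere: the usual expression where `f` is
finite, and the limit of that expression where `f` takes the value `∞`. -/
def schwarzian (f : ℂ → OnePoint ℂ) (z : ℂ) : ℂ :=
  if f z = ∞ then limUnder (𝓝[≠] z) (schwarzianExpr (fun w => finiteCoord (f w)))
  else schwarzianExpr (fun w => finiteCoord (f w)) z

/-- Near `z`, the map `f` is a holomorphic, non-constant map to the Riemann sphere whose
Schwarzian derivative is `φ`. The equality is one of meromorphic functions near `z`, that is, it
holds on a punctured neighbourhood of `z` (if `z` is a critical point of `f`, then both sides have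
a pole there). -/
def IsSchwarzianPrimitiveAt (φ : ℂ → ℂ) (f : ℂ → OnePoint ℂ) (z : ℂ) : Prop :=
  IsHolomorphicAt f z ∧ (¬ ∀ᶠ w in 𝓝 z, f w = f z) ∧ ∀ᶠ w in 𝓝[≠] z, schwarzian f w = φ w

/-- `f : U → OnePoint ℂ` is a Schwarzian primitive of `φ` on the open set `U`. -/
def IsSchwarzianPrimitiveOn (φ : ℂ → ℂ) (f : ℂ → OnePoint ℂ) (U : Set ℂ) : Prop :=
  ∀ z ∈ U, IsSchwarzianPrimitiveAt φ f z

/-- The poles of `φ` in `U`. -/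
def poles (φ : ℂ → ℂ) (U : Set ℂ) : Set ℂ := {z ∈ U | meromorphicOrderAt φ z < 0}

/-- The Laurent expansion
`φ(z) = (1 - d²) / (2 (z - c)²) + a 1 / (z - c) + a 2 + a 3 (z - c) + ⋯` as `z → c`.
The entry `a 0` plays no role. -/
def HasLocalForm (φ : ℂ → ℂ) (c : ℂ) (d : ℕ) (a : ℕ → ℂ) : Prop :=
  ∀ᶠ z in 𝓝[≠] c,
    HasSum (fun n : ℕ => a (n + 1) * (z - c) ^ ((n : ℤ) - 1))
      (φ z - (1 - (d : ℂ) ^ 2) / (2 * (z - c) ^ 2))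

/-- The `d × d` matrix with the coefficients `a (i - j + 1)` on and below the diagonal, the numbers
`k_j = 2 j (j - d)`, `j = 1, …, d - 1`, just above the diagonal, and zeros elsewhere.
Rows and columns are numbered from `0`, so that `k_j` is the entry in row `j - 1`, column `j`. -/
def coeffMatrix (d : ℕ) (a : ℕ → ℂ) : Matrix (Fin d) (Fin d) ℂ :=
  Matrix.of fun i j =>
    if (j : ℕ) ≤ (i : ℕ) then a ((i : ℕ) - (j : ℕ) + 1)
    else if (j : ℕ) = (i : ℕ) + 1 then 2 * ((j : ℕ) : ℂ) * (((j : ℕ) : ℂ) - (d : ℂ))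
    else 0

/-- The group of Möbius transformations of the Riemann sphere. -/
def moebiusGroup : Subgroup (Equiv.Perm (OnePoint ℂ)) :=
  (MulAction.toPermHom (Matrix.GeneralLinearGroup (Fin 2) ℂ) (OnePoint ℂ)).range

/-- Parabolic Möbius transformations: those induced by a parabolic matrix, that is, a non-scalar
matrix with a double eigenvalue. -/
def IsParabolicMoebius (γ : Equiv.Perm (OnePoint ℂ)) : Prop :=
  ∃ g : Matrix.GeneralLinearGroup (Fin 2) ℂ,
    g.IsParabolic ∧ MulAction.toPermHom (Matrix.GeneralLinearGroup (Fin 2) ℂ) (OnePoint ℂ) g = γ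

/-- `F` is an analytic continuation along the path `p`: a family of holomorphic function elements
`F t` near `p t`, such that for `s` close to `t` the elements `F s` and `F t` agree near `p s`. -/
structure IsAnalyticContinuation {b c : ℂ} (p : Path b c) (F : unitInterval → ℂ → OnePoint ℂ) :
    Prop where
  holomorphic : ∀ t, IsHolomorphicAt (F t) (p t)
  compatible : ∀ t, ∀ᶠ s in 𝓝 t, F s =ᶠ[𝓝 (p s)] F t

/-- The holonomy group of `φ` on the complement of its poles in `U`, computed from a solution `f₀`
of `S_f = φ` near the base point `b`: it consists of the Möbius transformations `γ_p` such that
analytic continuation of `f₀` along a loop `p` in `U` minus the poles leads to `γ_p ∘ f₀`. -/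
def holonomyGroup (φ : ℂ → ℂ) (U : Set ℂ) (b : ℂ) (f₀ : ℂ → OnePoint ℂ) :
    Set (Equiv.Perm (OnePoint ℂ)) :=
  {γ | γ ∈ moebiusGroup ∧ ∃ p : Path b b, (∀ t, p t ∈ U \ poles φ U) ∧
    ∃ F : unitInterval → ℂ → OnePoint ℂ, IsAnalyticContinuation p F ∧
      F 0 =ᶠ[𝓝 b] f₀ ∧ F 1 =ᶠ[𝓝 b] fun z => γ (f₀ z)}

end SchwarzianPrimitive

end

/-! Near a pole put x = z - c and φ = (1 - d²)/(2x²) + q/x. The substitution f' = x^(σ-1)/w² with σ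
= ±d turns S_f = φ into the linear equation x w'' + (1 - σ) w' + (q/2) w = 0
(`schwarzianExpr_of_frobeniusOp`), which is solved by power series.

For σ = -d the recursion has no resonance, so there is a solution u with u(c) ≠ 0, and e =
x^(-d-1)/u² is single-valued on a punctured disc. Its antiderivatives are Schwarzian primitives, and
a loop around c changes them by an additive constant. Hence local monodromy is the identity or
parabolic (`exists_density`, `hol_of_density`), and it is trivial only if the residue r of e
vanishes (`residue_eq_zero`).

For σ = d the recursion is resonant at index d. The equations up to the resonance say that the
coefficient matrix kills (b_0, …, b_{d-1}). As k_1, …, k_{d-1} are nonzero, a nonzero kernel vector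
has b_0 ≠ 0, so the determinant vanishes exactly when there is a solution w with w(c) ≠ 0. Such a w
makes x^(d-1)/w² holomorphic, and integration gives a primitive across c
(`exists_primitive_of_det_eq_zero`). Conversely, r = 0 produces such a w by reduction of order
(`frobeniusOp_mul_eq_zero`).

Two primitives near a point differ by a Möbius transformation, which is unique because a nonconstant
germ has infinitely many values. Choices of local primitives therefore form a covering space with
fibre the Möbius group, and primitives continue over any simply connected space on which they exist
locally (`exists_continuation`). Applied to U this gives (ii) ⇒ (i). A global primitive is its own
continuation along every loop, so (i) ⇒ (iii), and trivial holonomy forces r = 0 at each pole, so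
(iii) ⇒ (ii).

For finite generation, the Riemann mapping theorem replaces U by a convex domain D. Overlapping
half-planes cut D into convex pieces with fewer punctures, a van Kampen argument
(`hol_subset_closure_iUnion`) reduces to one puncture, and there the holonomy is cyclic, generated
by a loop that may be taken arbitrarily close to the puncture (`exists_hol_eq_zpowers`). -/

noncomputable section

namespace SchwarzianPrimitive

/-! ### Homogeneous coordinates and sphere-valued holomorphic germs -/

/-- The point of the Riemann sphere with homogeneous coordinates `(p : q)`. -/
def homog (p q : ℂ) : OnePoint ℂ := if q = 0 then ∞ else ((p / q : ℂ) : OnePoint ℂ)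

lemma homog_of_eq_zero {p q : ℂ} (h : q = 0) : homog p q = ∞ := if_pos h

lemma homog_of_ne_zero {p q : ℂ} (h : q ≠ 0) : homog p q = ((p / q : ℂ) : OnePoint ℂ) := if_neg h

lemma homog_eq_infty_iff {p q : ℂ} : homog p q = ∞ ↔ q = 0 := by
  unfold homog; split_ifs with h <;> simp [h]

lemma homog_eq_homog_iff {p q p' q' : ℂ} (h : p ≠ 0 ∨ q ≠ 0) (h' : p' ≠ 0 ∨ q' ≠ 0) :
    homog p q = homog p' q' ↔ p * q' - p' * q = 0 := by
  unfold homog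
  split_ifs with h1 h2 h2
  · simp [h1, h2]
  · simp_all
  · simp_all
  · rw [OnePoint.coe_eq_coe, div_eq_div_iff h1 h2, sub_eq_zero]

lemma smul_homog (g : Matrix.GeneralLinearGroup (Fin 2) ℂ) {p q : ℂ} (h : p ≠ 0 ∨ q ≠ 0) :
    g • homog p q = homog (g 0 0 * p + g 0 1 * q) (g 1 0 * p + g 1 1 * q) := by
  unfold homog
  by_cases hq : q = 0
  · have hp : p ≠ 0 := by simpa [hq] using h
    simp only [hq, if_true, smul_infty_eq_ite, mul_zero, add_zero, mul_eq_zero, hp, or_false]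
    split_ifs with h1
    · rfl
    · rw [mul_div_mul_right _ _ hp]
  · simp only [hq, if_false, smul_some_eq_ite]
    have e : g 1 0 * (p / q) + g 1 1 = (g 1 0 * p + g 1 1 * q) / q := by field_simp
    have e' : g 0 0 * (p / q) + g 0 1 = (g 0 0 * p + g 0 1 * q) / q := by field_simp
    rw [e, e', div_div_div_cancel_right₀ hq]
    simp [hq]

lemma smul_homog_ne_zero (g : Matrix.GeneralLinearGroup (Fin 2) ℂ) {p q : ℂ}
    (h : p ≠ 0 ∨ q ≠ 0) :
    g 0 0 * p + g 0 1 * q ≠ 0 ∨ g 1 0 * p + g 1 1 * q ≠ 0 := by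
  by_contra! hc
  have hdet : g 0 0 * g 1 1 - g 0 1 * g 1 0 ≠ 0 := by
    have := g.det_ne_zero
    rwa [Matrix.det_fin_two] at this
  have h1 : (g 0 0 * g 1 1 - g 0 1 * g 1 0) * p = 0 := by linear_combination g 1 1 * hc.1 - g 0 1 * hc.2
  have h2 : (g 0 0 * g 1 1 - g 0 1 * g 1 0) * q = 0 := by linear_combination g 0 0 * hc.2 - g 1 0 * hc.1
  simp [hdet] at h1 h2
  simp [h1, h2] at h

lemma continuousAt_homog {p q : ℂ → ℂ} {z : ℂ} (hp : ContinuousAt p z) (hq : ContinuousAt q z)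
    (h : p z ≠ 0 ∨ q z ≠ 0) : ContinuousAt (fun w => homog (p w) (q w)) z := by
  by_cases hqz : q z = 0
  · have hpz : p z ≠ 0 := by simpa [hqz] using h
    rw [ContinuousAt, homog_of_eq_zero hqz, OnePoint.nhds_infty_eq,
      coclosedCompact_eq_cocompact, ← Metric.cobounded_eq_cocompact]
    rintro s ⟨hs, hs'⟩
    obtain ⟨R, -, hR⟩ := Filter.hasBasis_cobounded_norm.mem_iff.1 (mem_map.1 hs)
    have hlt : ∀ᶠ w in 𝓝 z, R * ‖q w‖ < ‖p w‖ := by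
      refine (hq.norm.const_mul R).eventually_lt hp.norm ?_
      simpa [hqz] using hpz
    rw [Filter.mem_map]
    filter_upwards [hlt] with w hw
    by_cases hqw : q w = 0
    · rw [Set.mem_preimage, homog_of_eq_zero hqw]
      exact mem_pure.1 hs'
    · rw [Set.mem_preimage, homog_of_ne_zero hqw]
      refine hR (Set.mem_ofPred.2 ?_)
      rw [norm_div, le_div_iff₀ (norm_pos_iff.2 hqw)]
      exact hw.le
  · have : (fun w => homog (p w) (q w)) =ᶠ[𝓝 z] fun w => ((p w / q w : ℂ) : OnePoint ℂ) := by
      filter_upwards [hq.eventually_ne hqz] with w hw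
      exact homog_of_ne_zero hw
    refine ContinuousAt.congr ?_ this.symm
    exact OnePoint.continuous_coe.continuousAt.comp (hp.div hq hqz)

@[simp] lemma finiteCoord_coe (x : ℂ) : finiteCoord (x : OnePoint ℂ) = x := rfl
@[simp] lemma inftyCoord_coe (x : ℂ) : inftyCoord (x : OnePoint ℂ) = x⁻¹ := rfl
@[simp] lemma inftyCoord_infty : inftyCoord ∞ = 0 := rfl

lemma IsHolomorphicAt.congr {f g : ℂ → OnePoint ℂ} {z : ℂ} (hf : IsHolomorphicAt f z)
    (h : f =ᶠ[𝓝 z] g) : IsHolomorphicAt g z := by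
  have hz := h.eq_of_nhds
  refine ⟨hf.1.congr h, fun hg => (hf.2.1 (hz ▸ hg)).congr ?_, fun hg => (hf.2.2 (hz ▸ hg)).congr ?_⟩
  · filter_upwards [h] with w hw
    rw [hw]
  · filter_upwards [h] with w hw
    rw [hw]

lemma isHolomorphicAt_homog {p q : ℂ → ℂ} {z : ℂ} (hp : AnalyticAt ℂ p z) (hq : AnalyticAt ℂ q z)
    (h : p z ≠ 0 ∨ q z ≠ 0) : IsHolomorphicAt (fun w => homog (p w) (q w)) z := by
  refine ⟨continuousAt_homog hp.continuousAt hq.continuousAt h, fun hf => ?_, fun hf => ?_⟩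
  · have hqz : q z ≠ 0 := fun h => hf (homog_eq_infty_iff.2 h)
    refine (hp.div hq hqz).congr ?_
    filter_upwards [hq.continuousAt.eventually_ne hqz] with w hw
    rw [homog_of_ne_zero hw]; simp
  · have hqz : q z = 0 := homog_eq_infty_iff.1 hf
    have hpz : p z ≠ 0 := by simpa [hqz] using h
    refine (hq.div hp hpz).congr ?_
    filter_upwards with w
    unfold homog
    split_ifs with hw <;> simp [hw]

/-- Lifting to ℂ² treats both charts at once: equality of two sphere-valued maps becomes the
vanishing of the analytic function p q' - p' q. -/
lemma IsHolomorphicAt.exists_homog {f : ℂ → OnePoint ℂ} {z : ℂ} (hf : IsHolomorphicAt f z) :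
    ∃ p q : ℂ → ℂ, AnalyticAt ℂ p z ∧ AnalyticAt ℂ q z ∧ (∀ w, p w ≠ 0 ∨ q w ≠ 0) ∧
      ∀ᶠ w in 𝓝 z, f w = homog (p w) (q w) := by
  by_cases hz : f z = ∞
  · refine ⟨fun _ => 1, _, analyticAt_const, hf.2.2 hz, fun w => Or.inl one_ne_zero, ?_⟩
    -- `inftyCoord` takes the value 0 both at ∞ and at 0, so the value 0 has to be kept away.
    have h0 : ((0 : ℂ) : OnePoint ℂ) ≠ f z := by simp [hz]
    filter_upwards [hf.1.eventually_ne h0.symm] with w hw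
    rcases h : f w with _ | x
    · exact (homog_of_eq_zero rfl).symm
    · have hx : x ≠ 0 := by rintro rfl; exact hw h
      change (x : OnePoint ℂ) = homog 1 (x⁻¹)
      rw [homog_of_ne_zero (inv_ne_zero hx)]; simp
  · refine ⟨_, fun _ => 1, hf.2.1 hz, analyticAt_const, fun w => Or.inr one_ne_zero, ?_⟩
    filter_upwards [hf.1.eventually_ne hz] with w hw
    rw [homog_of_ne_zero one_ne_zero, div_one]
    rcases h : f w with _ | x
    · exact absurd h hw
    · rfl

lemma IsHolomorphicAt.eventually {f : ℂ → OnePoint ℂ} {z : ℂ} (hf : IsHolomorphicAt f z) :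
    ∀ᶠ w in 𝓝 z, IsHolomorphicAt f w := by
  obtain ⟨p, q, hp, hq, h, hfe⟩ := hf.exists_homog
  filter_upwards [hp.eventually_analyticAt, hq.eventually_analyticAt,
    hfe.eventually_nhds] with w h1 h2 h3
  exact (isHolomorphicAt_homog h1 h2 (h w)).congr (h3.mono fun _ => Eq.symm)

lemma isHolomorphicAt_coe {g : ℂ → ℂ} {z : ℂ} (hg : AnalyticAt ℂ g z) :
    IsHolomorphicAt (fun w => (g w : OnePoint ℂ)) z := by
  refine (isHolomorphicAt_homog hg (analyticAt_const (v := 1)) (Or.inr one_ne_zero)).congr ?_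
  filter_upwards with w
  simp [homog]

lemma isHolomorphicAt_const (v : OnePoint ℂ) (z : ℂ) : IsHolomorphicAt (fun _ => v) z := by
  rcases v with _ | x
  · exact ⟨continuousAt_const, fun _ => analyticAt_const, fun _ => analyticAt_const⟩
  · exact ⟨continuousAt_const, fun _ => analyticAt_const, fun _ => analyticAt_const⟩

lemma mem_moebiusGroup_iff {γ : Equiv.Perm (OnePoint ℂ)} : γ ∈ moebiusGroup ↔
    ∃ g : Matrix.GeneralLinearGroup (Fin 2) ℂ, ∀ x, γ x = g • x := by
  constructor
  · rintro ⟨g, rfl⟩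
    exact ⟨g, fun x => rfl⟩
  · rintro ⟨g, hg⟩
    exact ⟨g, Equiv.ext fun x => (hg x).symm⟩

lemma IsHolomorphicAt.moebius {f : ℂ → OnePoint ℂ} {z : ℂ} (hf : IsHolomorphicAt f z)
    {γ : Equiv.Perm (OnePoint ℂ)} (hγ : γ ∈ moebiusGroup) :
    IsHolomorphicAt (fun w => γ (f w)) z := by
  obtain ⟨g, hg⟩ := mem_moebiusGroup_iff.1 hγ
  obtain ⟨p, q, hp, hq, h, hfe⟩ := hf.exists_homog
  refine (isHolomorphicAt_homog (p := fun w => g 0 0 * p w + g 0 1 * q w)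
    (q := fun w => g 1 0 * p w + g 1 1 * q w) (by fun_prop) (by fun_prop)
    (smul_homog_ne_zero g (h z))).congr ?_
  filter_upwards [hfe] with w hw
  rw [hg, hw, smul_homog g (h w)]

/-! ### Identity theorem and freeness of the Möbius action on germs -/

/-- Identity theorem for sphere-valued maps. -/
lemma IsHolomorphicAt.eventuallyEq_of_frequently {f g : ℂ → OnePoint ℂ} {z : ℂ}
    (hf : IsHolomorphicAt f z) (hg : IsHolomorphicAt g z)
    (h : ∃ᶠ w in 𝓝[≠] z, f w = g w) : f =ᶠ[𝓝 z] g := by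
  obtain ⟨p, q, hp, hq, h0, hfe⟩ := hf.exists_homog
  obtain ⟨p', q', hp', hq', h0', hge⟩ := hg.exists_homog
  have han : AnalyticAt ℂ (fun w => p w * q' w - p' w * q w) z := by fun_prop
  have hfr : ∃ᶠ w in 𝓝[≠] z, p w * q' w - p' w * q w = 0 := by
    refine (h.and_eventually (eventually_nhdsWithin_of_eventually_nhds (hfe.and hge))).mono ?_
    rintro w ⟨h1, h2, h3⟩
    rw [h2, h3] at h1
    exact (homog_eq_homog_iff (h0 w) (h0' w)).1 h1
  have := han.frequently_zero_iff_eventually_zero.1 hfr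
  filter_upwards [this, hfe, hge] with w h1 h2 h3
  rw [h2, h3]
  exact (homog_eq_homog_iff (h0 w) (h0' w)).2 h1

/-- The points w may all equal z, but a neighbourhood of w contains points other than z. This lets
the identity theorem be applied at limits of points where germs agree. -/
lemma frequently_nhdsNE_of_frequently_eventually {P : ℂ → Prop} {z : ℂ}
    (h : ∃ᶠ w in 𝓝 z, ∀ᶠ y in 𝓝 w, P y) : ∃ᶠ w in 𝓝[≠] z, P w := by
  intro hc
  rw [eventually_nhdsWithin_iff] at hc
  obtain ⟨w, hw, hw'⟩ := (h.and_eventually hc.eventually_nhds).exists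
  have h3 : ∃ᶠ y in 𝓝[≠] w, y ≠ z ∧ P y := by
    refine Eventually.frequently ?_
    have h4 : ∀ᶠ y in 𝓝[≠] w, y ≠ z := by
      by_cases hwz : w = z
      · subst hwz; exact eventually_mem_nhdsWithin
      · exact eventually_nhdsWithin_of_eventually_nhds (eventually_ne_nhds hwz)
    exact h4.and (eventually_nhdsWithin_of_eventually_nhds hw)
  obtain ⟨y, ⟨hy1, hy2⟩, hy3⟩ :=
    (h3.and_eventually (eventually_nhdsWithin_of_eventually_nhds hw')).exists
  exact hy3 hy1 hy2

lemma IsHolomorphicAt.eventuallyEq_of_frequently_eventuallyEq {f g : ℂ → OnePoint ℂ} {z : ℂ}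
    (hf : IsHolomorphicAt f z) (hg : IsHolomorphicAt g z)
    (h : ∃ᶠ w in 𝓝 z, f =ᶠ[𝓝 w] g) : f =ᶠ[𝓝 z] g :=
  hf.eventuallyEq_of_frequently hg (frequently_nhdsNE_of_frequently_eventually h)

lemma eventuallyEq_of_isPreconnected {f g : ℂ → OnePoint ℂ} {V : Set ℂ} (hV : IsPreconnected V)
    (hf : ∀ z ∈ V, IsHolomorphicAt f z) (hg : ∀ z ∈ V, IsHolomorphicAt g z)
    {z₀ : ℂ} (hz₀ : z₀ ∈ V) (h : f =ᶠ[𝓝 z₀] g) {z : ℂ} (hz : z ∈ V) : f =ᶠ[𝓝 z] g := by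
  have key : V ⊆ {w | f =ᶠ[𝓝 w] g} := by
    refine hV.subset_of_closure_inter_subset ?_ ⟨z₀, hz₀, h⟩ ?_
    · rw [isOpen_iff_eventually]
      intro w hw
      exact hw.eventually_nhds
    · rintro w ⟨hw, hwV⟩
      exact (hf w hwV).eventuallyEq_of_frequently_eventuallyEq (hg w hwV)
        (mem_closure_iff_frequently.1 hw)
  exact key hz

lemma eventually_ne_of_not_const {f : ℂ → OnePoint ℂ} {z : ℂ} (hf : IsHolomorphicAt f z)
    (hc : ¬ ∀ᶠ w in 𝓝 z, f w = f z) (v : OnePoint ℂ) : ∀ᶠ w in 𝓝[≠] z, f w ≠ v := by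
  by_contra h
  have h' : ∃ᶠ w in 𝓝[≠] z, f w = v := by
    rw [Filter.Frequently]; exact h
  have := hf.eventuallyEq_of_frequently (isHolomorphicAt_const v z) h'
  apply hc
  have hz := this.eq_of_nhds
  filter_upwards [this] with w hw
  rw [hw, hz]

lemma eventually_not_const {f : ℂ → OnePoint ℂ} {z : ℂ} (hf : IsHolomorphicAt f z)
    (hc : ¬ ∀ᶠ w in 𝓝 z, f w = f z) : ∀ᶠ y in 𝓝 z, ¬ ∀ᶠ w in 𝓝 y, f w = f y := by
  obtain ⟨ε, hε, hb⟩ := Metric.eventually_nhds_iff_ball.1 hf.eventually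
  filter_upwards [Metric.ball_mem_nhds z hε] with y hy hcy
  apply hc
  have := eventuallyEq_of_isPreconnected (convex_ball z ε).isPreconnected hb
    (fun w _ => isHolomorphicAt_const (f y) w) hy hcy (Metric.mem_ball_self hε)
  have hz := this.eq_of_nhds
  filter_upwards [this] with w hw
  rw [hw, hz]

/-- A Möbius transformation with three finite fixed points is the identity. -/
lemma moebius_eq_one_of_fixed {γ : Equiv.Perm (OnePoint ℂ)} (hγ : γ ∈ moebiusGroup)
    {s : Set ℂ} (hs : s.Infinite) (h : ∀ x ∈ s, γ x = x) : γ = 1 := by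
  obtain ⟨g, hg⟩ := mem_moebiusGroup_iff.1 hγ
  have h0 : g.fixpointPolynomial = 0 := by
    refine Polynomial.eq_zero_of_infinite_isRoot _ (hs.mono ?_)
    intro x hx
    have := h x hx
    rw [hg] at this
    have := Matrix.GeneralLinearGroup.fixpointPolynomial_aeval_eq_zero_iff.2 this
    simpa [Polynomial.IsRoot] using this
  obtain ⟨a, ha⟩ := Matrix.GeneralLinearGroup.fixpointPolynomial_eq_zero_iff.1 h0
  have h00 : g 0 0 = a := by rw [← ha]; simp
  have h01 : g 0 1 = 0 := by rw [← ha]; simp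
  have h10 : g 1 0 = 0 := by rw [← ha]; simp
  have h11 : g 1 1 = a := by rw [← ha]; simp
  have ha0 : a ≠ 0 := by
    intro h
    apply g.det_ne_zero
    rw [Matrix.det_fin_two]
    simp [h00, h01, h]
  ext x
  rw [hg]
  rcases x with _ | x
  · exact smul_infty_eq_self_iff.2 h10
  · change g • (x : OnePoint ℂ) = x
    rw [smul_some_eq_ite, if_neg (by simp [h10, h11, ha0])]
    simp [h00, h01, h10, h11, ha0]

/-- The action of the Möbius group on non-constant holomorphic germs is free. -/
lemma moebius_unique {f : ℂ → OnePoint ℂ} {z : ℂ} (hf : IsHolomorphicAt f z)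
    (hc : ¬ ∀ᶠ w in 𝓝 z, f w = f z) {γ γ' : Equiv.Perm (OnePoint ℂ)} (hγ : γ ∈ moebiusGroup)
    (hγ' : γ' ∈ moebiusGroup) (h : ∀ᶠ w in 𝓝 z, γ (f w) = γ' (f w)) : γ = γ' := by
  suffices h1 : γ'⁻¹ * γ = 1 by
    rw [inv_mul_eq_one] at h1; exact h1.symm
  refine moebius_eq_one_of_fixed (mul_mem (inv_mem hγ') hγ)
    (s := {x : ℂ | γ x = γ' x}) ?_ ?_
  -- A nonconstant germ avoids ∞ and any finite set of values on a punctured neighbourhood, whereas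
  -- all its finite values near z are coincidence points of γ and γ'.
  · intro hfin
    have h2 : ∀ᶠ w in 𝓝[≠] z, f w ≠ ∞ ∧ ∀ x ∈ {x : ℂ | γ x = γ' x}, f w ≠ x :=
      (eventually_ne_of_not_const hf hc _).and
        ((hfin.eventually_all).2 fun x _ => eventually_ne_of_not_const hf hc x)
    obtain ⟨w, ⟨hw1, hw2⟩, hw3⟩ :=
      (h2.and (eventually_nhdsWithin_of_eventually_nhds h)).exists
    obtain ⟨x, hx⟩ := OnePoint.ne_infty_iff_exists.1 hw1
    refine hw2 x ?_ hx.symm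
    rw [← hx] at hw3
    exact hw3
  · intro x hx
    change γ'⁻¹ (γ x) = x
    rw [Set.mem_ofPred_eq] at hx
    rw [hx]; exact Equiv.symm_apply_apply _ _

/-! ### The Schwarzian through the nonlinearity g''/g' -/

lemma schwarzianExpr_congr {g h : ℂ → ℂ} {z : ℂ} (H : g =ᶠ[𝓝 z] h) :
    schwarzianExpr g z = schwarzianExpr h z := by
  unfold schwarzianExpr
  rw [H.iteratedDeriv_eq 3, H.iteratedDeriv_eq 2, H.deriv_eq]

/-- With g' = e and N = e'/e one has g''/g' = N and g'''/g' = N' + N², so the Schwarzian is N' -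
N²/2. Later computations need only the logarithmic derivative of g'. -/
lemma schwarzianExpr_of_logDeriv {g e N : ℂ → ℂ} {n' w : ℂ}
    (hg : ∀ᶠ y in 𝓝 w, HasDerivAt g (e y) y) (he : ∀ᶠ y in 𝓝 w, HasDerivAt e (e y * N y) y)
    (he0 : e w ≠ 0) (hN : HasDerivAt N n' w) : schwarzianExpr g w = n' - N w ^ 2 / 2 := by
  have h1 : deriv g =ᶠ[𝓝 w] e := hg.mono fun y hy => hy.deriv
  have h2 : iteratedDeriv 2 g =ᶠ[𝓝 w] fun y => e y * N y := by
    have : iteratedDeriv 2 g = deriv (deriv g) := by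
      rw [iteratedDeriv_succ, iteratedDeriv_one]
    rw [this]
    exact h1.deriv.trans (he.mono fun y hy => hy.deriv)
  have h3 : iteratedDeriv 3 g w = e w * N w * N w + e w * n' := by
    rw [iteratedDeriv_succ, h2.deriv_eq]
    exact (he.self_of_nhds.mul hN).deriv
  unfold schwarzianExpr
  rw [h3, h2.eq_of_nhds, h1.eq_of_nhds]
  field_simp
  ring

/-- The nonlinearity `g'' / g'`. -/
def nonlinearity (g : ℂ → ℂ) (z : ℂ) : ℂ := deriv (deriv g) z / deriv g z

lemma analyticAt_nonlinearity {g : ℂ → ℂ} {w : ℂ} (hg : AnalyticAt ℂ g w) (h0 : deriv g w ≠ 0) :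
    AnalyticAt ℂ (nonlinearity g) w :=
  hg.deriv.deriv.div hg.deriv h0

lemma eventually_hasDerivAt {g : ℂ → ℂ} {w : ℂ} (hg : AnalyticAt ℂ g w) :
    ∀ᶠ y in 𝓝 w, HasDerivAt g (deriv g y) y :=
  hg.eventually_analyticAt.mono fun _ hy => hy.differentiableAt.hasDerivAt

lemma eventually_hasDerivAt_deriv {g : ℂ → ℂ} {w : ℂ} (hg : AnalyticAt ℂ g w)
    (h0 : deriv g w ≠ 0) :
    ∀ᶠ y in 𝓝 w, HasDerivAt (deriv g) (deriv g y * nonlinearity g y) y := by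
  filter_upwards [eventually_hasDerivAt hg.deriv, hg.deriv.continuousAt.eventually_ne h0]
    with y h1 h2
  convert h1 using 1
  unfold nonlinearity
  field_simp

lemma schwarzianExpr_eq {g : ℂ → ℂ} {w : ℂ} (hg : AnalyticAt ℂ g w) (h0 : deriv g w ≠ 0) :
    schwarzianExpr g w = deriv (nonlinearity g) w - nonlinearity g w ^ 2 / 2 :=
  schwarzianExpr_of_logDeriv (eventually_hasDerivAt hg) (eventually_hasDerivAt_deriv hg h0) h0
    (analyticAt_nonlinearity hg h0).differentiableAt.hasDerivAt

lemma nonlinearity_of_hasDerivAt {g e N : ℂ → ℂ} {w : ℂ}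
    (hg : ∀ᶠ y in 𝓝 w, HasDerivAt g (e y) y) (he : HasDerivAt e (e w * N w) w)
    (he0 : e w ≠ 0) : nonlinearity g w = N w := by
  have h1 : deriv g =ᶠ[𝓝 w] e := hg.mono fun y hy => hy.deriv
  unfold nonlinearity
  rw [h1.deriv_eq, h1.eq_of_nhds, he.deriv]
  field_simp

section fractional

variable {g : ℂ → ℂ} {w : ℂ} (hg : AnalyticAt ℂ g w) (h0 : deriv g w ≠ 0) (a b c d : ℂ)
  (hden : c * g w + d ≠ 0)
include hg hden

lemma eventually_hasDerivAt_fractional :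
    ∀ᶠ y in 𝓝 w, HasDerivAt (fun y => (a * g y + b) / (c * g y + d))
      ((a * d - b * c) * deriv g y / (c * g y + d) ^ 2) y := by
  have hden' : ∀ᶠ y in 𝓝 w, c * g y + d ≠ 0 :=
    ContinuousAt.eventually_ne (g := fun y => c * g y + d)
      (by have := hg.continuousAt; fun_prop) hden
  filter_upwards [hden', eventually_hasDerivAt hg] with y h1 h2
  exact (((h2.const_mul a).add_const b).div ((h2.const_mul c).add_const d) h1).congr_deriv
    (by ring)

include h0

lemma eventually_hasDerivAt_fractional' :
    ∀ᶠ y in 𝓝 w, HasDerivAt (fun y => (a * d - b * c) * deriv g y / (c * g y + d) ^ 2)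
      ((a * d - b * c) * deriv g y / (c * g y + d) ^ 2 *
        (nonlinearity g y - 2 * c * deriv g y / (c * g y + d))) y := by
  have hden' : ∀ᶠ y in 𝓝 w, c * g y + d ≠ 0 :=
    ContinuousAt.eventually_ne (g := fun y => c * g y + d)
      (by have := hg.continuousAt; fun_prop) hden
  filter_upwards [hden', eventually_hasDerivAt hg, eventually_hasDerivAt_deriv hg h0]
    with y h1 h2 h3
  refine ((h3.const_mul (a * d - b * c)).div (((h2.const_mul c).add_const d).pow 2)
    (pow_ne_zero 2 h1)).congr_deriv ?_
  simp only [Pi.pow_apply]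
  field_simp
  push_cast
  ring

/-- The transformation replaces N by N - 2h with h = c g'/(c g + d). Since h' = hN - h², the
quantity N' - N²/2 does not change. -/
lemma schwarzianExpr_fractional (hdet : a * d - b * c ≠ 0) :
    schwarzianExpr (fun y => (a * g y + b) / (c * g y + d)) w = schwarzianExpr g w := by
  have h2 := (eventually_hasDerivAt hg).self_of_nhds
  have h3 := (eventually_hasDerivAt_deriv hg h0).self_of_nhds
  have h4 := (analyticAt_nonlinearity hg h0).differentiableAt.hasDerivAt
  have h5 := h4.sub ((h3.const_mul (2 * c)).div ((h2.const_mul c).add_const d) hden)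
  rw [schwarzianExpr_of_logDeriv (eventually_hasDerivAt_fractional hg a b c d hden)
    (eventually_hasDerivAt_fractional' hg h0 a b c d hden)
    (div_ne_zero (mul_ne_zero hdet h0) (pow_ne_zero 2 hden)) h5, schwarzianExpr_eq hg h0]
  field_simp
  ring

end fractional

/-! ### Regular points and Möbius invariance of primitives -/

/-- Near `w` the map `f` is finite, with non-vanishing derivative and Schwarzian `φ` at `w`. -/
def IsRegularAt (φ : ℂ → ℂ) (f : ℂ → OnePoint ℂ) (w : ℂ) : Prop :=
  ∃ g : ℂ → ℂ, AnalyticAt ℂ g w ∧ (f =ᶠ[𝓝 w] fun y => (g y : OnePoint ℂ)) ∧ deriv g w ≠ 0 ∧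
    schwarzianExpr g w = φ w

lemma IsRegularAt.schwarzian_eq {φ : ℂ → ℂ} {f : ℂ → OnePoint ℂ} {w : ℂ}
    (h : IsRegularAt φ f w) : schwarzian f w = φ w := by
  obtain ⟨g, hg, hfg, -, hS⟩ := h
  unfold schwarzian
  rw [if_neg (by rw [hfg.eq_of_nhds]; exact OnePoint.coe_ne_infty _), ← hS]
  refine schwarzianExpr_congr ?_
  filter_upwards [hfg] with y hy
  rw [hy]; rfl

lemma eventually_const_of_deriv_eq_zero {g : ℂ → ℂ} {w : ℂ} (hg : AnalyticAt ℂ g w)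
    (h : ∀ᶠ y in 𝓝 w, deriv g y = 0) : ∀ᶠ y in 𝓝 w, g y = g w := by
  obtain ⟨ε, hε, hb⟩ := Metric.eventually_nhds_iff_ball.1 (h.and hg.eventually_analyticAt)
  filter_upwards [Metric.ball_mem_nhds w hε] with y hy
  exact (convex_ball w ε).is_const_of_fderivWithin_eq_zero (𝕜 := ℂ)
    (fun x hx => (hb x hx).2.differentiableAt.differentiableWithinAt)
    (fun x hx => by
      rw [fderivWithin_of_isOpen Metric.isOpen_ball hx]
      ext; simp [(hb x hx).1]) hy (Metric.mem_ball_self hε)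

/-- For f = p/q the numerator p'q - pq' of the derivative is analytic. If it vanished identically
near z, then f would be constant near some point, so its zeros are isolated, as are the points where
f = ∞. -/
lemma IsSchwarzianPrimitiveAt.eventually_isRegularAt {φ : ℂ → ℂ} {f : ℂ → OnePoint ℂ} {z : ℂ}
    (h : IsSchwarzianPrimitiveAt φ f z) : ∀ᶠ w in 𝓝[≠] z, IsRegularAt φ f w := by
  obtain ⟨hf, hc, hS⟩ := h
  obtain ⟨p, q, hp, hq, h0, hfe⟩ := hf.exists_homog
  have han : AnalyticAt ℂ (fun w => deriv p w * q w - p w * deriv q w) z := by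
    have := hp.deriv; have := hq.deriv; fun_prop
  have hfin := eventually_ne_of_not_const hf hc ∞
  have hmain : ∀ᶠ w in 𝓝[≠] z, f w ≠ ∞ ∧ IsHolomorphicAt f w ∧ AnalyticAt ℂ p w ∧
      AnalyticAt ℂ q w ∧ (∀ᶠ y in 𝓝 w, f y = homog (p y) (q y)) ∧ schwarzian f w = φ w ∧
      ¬ ∀ᶠ y in 𝓝 w, f y = f w :=
    hfin.and <| (eventually_nhdsWithin_of_eventually_nhds hf.eventually).and <|
      (eventually_nhdsWithin_of_eventually_nhds hp.eventually_analyticAt).and <|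
      (eventually_nhdsWithin_of_eventually_nhds hq.eventually_analyticAt).and <|
      (eventually_nhdsWithin_of_eventually_nhds hfe.eventually_nhds).and <| hS.and <|
      eventually_nhdsWithin_of_eventually_nhds (eventually_not_const hf hc)
  have key : ∀ w, f w ≠ ∞ → AnalyticAt ℂ p w → AnalyticAt ℂ q w →
      (∀ᶠ y in 𝓝 w, f y = homog (p y) (q y)) → q w ≠ 0 ∧ AnalyticAt ℂ (fun y => p y / q y) w ∧
      (f =ᶠ[𝓝 w] fun y => ((p y / q y : ℂ) : OnePoint ℂ)) ∧
      (∀ᶠ y in 𝓝 w, deriv (fun y => p y / q y) y =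
        (deriv p y * q y - p y * deriv q y) / q y ^ 2) := by
    intro w h1 h3 h4 h5
    have hqw : q w ≠ 0 := by
      rw [h5.self_of_nhds] at h1
      exact fun h => h1 (homog_eq_infty_iff.2 h)
    refine ⟨hqw, h3.div h4 hqw, ?_, ?_⟩
    · filter_upwards [h5, h4.continuousAt.eventually_ne hqw] with y hy hy'
      rw [hy, homog_of_ne_zero hy']
    · filter_upwards [h4.continuousAt.eventually_ne hqw, eventually_hasDerivAt h3,
        eventually_hasDerivAt h4] with y hy h1 h2
      exact (h1.div h2 hy).deriv
  rcases han.eventually_eq_zero_or_eventually_ne_zero with hz | hz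
  · exfalso
    obtain ⟨w, ⟨h1, h2, h3, h4, h5, h6, h7⟩, h8⟩ :=
      (hmain.and (eventually_nhdsWithin_of_eventually_nhds hz.eventually_nhds)).exists
    obtain ⟨-, k2, k3, k4⟩ := key w h1 h3 h4 h5
    apply h7
    have := eventually_const_of_deriv_eq_zero k2 (by
      filter_upwards [k4, h8] with y hy hy'
      rw [hy, hy', zero_div])
    filter_upwards [k3, this] with y hy hy'
    rw [hy, hy', k3.eq_of_nhds]
  · filter_upwards [hmain, hz] with w ⟨h1, h2, h3, h4, h5, h6, h7⟩ h8
    obtain ⟨k1, k2, k3, k4⟩ := key w h1 h3 h4 h5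
    refine ⟨_, k2, k3, ?_, ?_⟩
    · rw [k4.self_of_nhds]
      exact div_ne_zero h8 (pow_ne_zero 2 k1)
    · rw [← h6, schwarzian, if_neg h1]
      refine schwarzianExpr_congr ?_
      filter_upwards [k3] with y hy
      rw [hy]; rfl

/-- Removes `limUnder` from the definition: the points where f = ∞ are isolated, so only points
where f is finite with nonzero derivative matter. -/
lemma isSchwarzianPrimitiveAt_iff {φ : ℂ → ℂ} {f : ℂ → OnePoint ℂ} {z : ℂ} :
    IsSchwarzianPrimitiveAt φ f z ↔ IsHolomorphicAt f z ∧ (¬ ∀ᶠ w in 𝓝 z, f w = f z) ∧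
      ∀ᶠ w in 𝓝[≠] z, IsRegularAt φ f w :=
  ⟨fun h => ⟨h.1, h.2.1, h.eventually_isRegularAt⟩,
    fun h => ⟨h.1, h.2.1, h.2.2.mono fun _ hw => hw.schwarzian_eq⟩⟩

lemma IsRegularAt.congr {φ : ℂ → ℂ} {f f' : ℂ → OnePoint ℂ} {w : ℂ}
    (h : IsRegularAt φ f w) (hff : f =ᶠ[𝓝 w] f') : IsRegularAt φ f' w := by
  obtain ⟨g, hg, hfg, h1, h2⟩ := h
  exact ⟨g, hg, hff.symm.trans hfg, h1, h2⟩

lemma IsSchwarzianPrimitiveAt.congr {φ : ℂ → ℂ} {f f' : ℂ → OnePoint ℂ} {z : ℂ}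
    (h : IsSchwarzianPrimitiveAt φ f z) (hff : f =ᶠ[𝓝 z] f') :
    IsSchwarzianPrimitiveAt φ f' z := by
  rw [isSchwarzianPrimitiveAt_iff] at h ⊢
  refine ⟨h.1.congr hff, fun hc => h.2.1 ?_, ?_⟩
  · filter_upwards [hc, hff] with w h1 h2
    rw [h2, h1, hff.eq_of_nhds]
  · filter_upwards [h.2.2, eventually_nhdsWithin_of_eventually_nhds hff.eventually_nhds]
      with w h1 h2
    exact h1.congr h2

lemma IsSchwarzianPrimitiveAt.eventually {φ : ℂ → ℂ} {f : ℂ → OnePoint ℂ} {z : ℂ}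
    (h : IsSchwarzianPrimitiveAt φ f z) : ∀ᶠ w in 𝓝 z, IsSchwarzianPrimitiveAt φ f w := by
  have h3 : ∀ᶠ w in 𝓝 z, w ≠ z → ∀ᶠ y in 𝓝 w, IsRegularAt φ f y := by
    refine (eventually_nhdsWithin_iff (s := {z}ᶜ)).1 ?_
    exact eventually_nhdsNE_eventually_nhds_iff.2 h.eventually_isRegularAt
  filter_upwards [h.1.eventually, eventually_not_const h.1 h.2.1, h3] with w h1 h2 h3
  by_cases hw : w = z
  · rw [hw]; exact h
  · exact isSchwarzianPrimitiveAt_iff.2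
      ⟨h1, h2, eventually_nhdsWithin_of_eventually_nhds (h3 hw)⟩

lemma moebius_coe_eventuallyEq {g : ℂ → ℂ} {w : ℂ} (hg : AnalyticAt ℂ g w)
    (A : Matrix.GeneralLinearGroup (Fin 2) ℂ) (hden : A 1 0 * g w + A 1 1 ≠ 0) :
    ∀ᶠ y in 𝓝 w, A • (g y : OnePoint ℂ) =
      (((A 0 0 * g y + A 0 1) / (A 1 0 * g y + A 1 1) : ℂ) : OnePoint ℂ) := by
  have hden' : ∀ᶠ y in 𝓝 w, A 1 0 * g y + A 1 1 ≠ 0 :=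
    ContinuousAt.eventually_ne (g := fun y => A 1 0 * g y + A 1 1)
      (by have := hg.continuousAt; fun_prop) hden
  filter_upwards [hden'] with y hy
  rw [smul_some_eq_ite, if_neg hy]

lemma IsRegularAt.moebius {φ : ℂ → ℂ} {f : ℂ → OnePoint ℂ} {w : ℂ} (h : IsRegularAt φ f w)
    {γ : Equiv.Perm (OnePoint ℂ)} (hγ : γ ∈ moebiusGroup) (hfin : γ (f w) ≠ ∞) :
    IsRegularAt φ (fun y => γ (f y)) w := by
  obtain ⟨A, hA⟩ := mem_moebiusGroup_iff.1 hγ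
  obtain ⟨g, hg, hfg, h0, hS⟩ := h
  have hden : A 1 0 * g w + A 1 1 ≠ 0 := by
    intro hc
    rw [hA, hfg.eq_of_nhds, smul_some_eq_ite, if_pos hc] at hfin
    exact hfin rfl
  have hdet : A 0 0 * A 1 1 - A 0 1 * A 1 0 ≠ 0 := by
    have := A.det_ne_zero
    rwa [Matrix.det_fin_two] at this
  refine ⟨fun y => (A 0 0 * g y + A 0 1) / (A 1 0 * g y + A 1 1), ?_, ?_, ?_, ?_⟩
  · exact AnalyticAt.div (by fun_prop) (by fun_prop) hden
  · filter_upwards [hfg, moebius_coe_eventuallyEq hg A hden] with y h1 h2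
    rw [hA, h1, h2]
  · rw [(eventually_hasDerivAt_fractional hg _ _ _ _ hden).self_of_nhds.deriv]
    exact div_ne_zero (mul_ne_zero hdet h0) (pow_ne_zero 2 hden)
  · rw [schwarzianExpr_fractional hg h0 _ _ _ _ hden hdet, hS]

lemma IsSchwarzianPrimitiveAt.moebius {φ : ℂ → ℂ} {f : ℂ → OnePoint ℂ} {z : ℂ}
    (h : IsSchwarzianPrimitiveAt φ f z) {γ : Equiv.Perm (OnePoint ℂ)} (hγ : γ ∈ moebiusGroup) :
    IsSchwarzianPrimitiveAt φ (fun y => γ (f y)) z := by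
  have hc : ¬ ∀ᶠ w in 𝓝 z, γ (f w) = γ (f z) := fun hc =>
    h.2.1 (hc.mono fun _ hw => γ.injective hw)
  refine isSchwarzianPrimitiveAt_iff.2 ⟨h.1.moebius hγ, hc, ?_⟩
  filter_upwards [h.eventually_isRegularAt, eventually_ne_of_not_const (h.1.moebius hγ) hc ∞]
    with w h1 h2
  exact h1.moebius hγ h2

/-! ### Uniqueness of primitives up to Möbius transformations -/

/-- If D vanished to a finite order n ≥ 1, then D' would have order n - 1 while h D has order at
least n. -/
lemma eventually_eq_zero_of_deriv_eq_mul {D h : ℂ → ℂ} {w : ℂ} (hD : AnalyticAt ℂ D w)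
    (hh : AnalyticAt ℂ h w) (hD0 : D w = 0) (H : ∀ᶠ y in 𝓝 w, deriv D y = h y * D y) :
    ∀ᶠ y in 𝓝 w, D y = 0 := by
  rw [← analyticOrderAt_eq_top]
  have h1 := hD.analyticOrderAt_deriv_add_one
  rw [hD0] at h1
  simp only [sub_zero] at h1
  have h2 : analyticOrderAt (deriv D) w = analyticOrderAt h w + analyticOrderAt D w := by
    rw [← analyticOrderAt_mul hh hD]
    exact analyticOrderAt_congr H
  rw [h2] at h1
  by_contra hne
  obtain ⟨n, hn⟩ := ENat.ne_top_iff_exists.1 hne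
  rw [← hn] at h1
  cases hm : analyticOrderAt h w using ENat.recTopCoe with
  | top => rw [hm] at h1; simp at h1
  | coe m =>
    rw [hm] at h1
    have : m + n + 1 = n := by exact_mod_cast h1
    omega

/-- Three linear uniqueness problems in turn. Equal Schwarzians give (N_G - N_H)' = ((N_G +
N_H)/2)(N_G - N_H). Once N_G = N_H, the difference D of first derivatives satisfies D' = N_G D. Then
G - H has zero derivative. -/
lemma eventuallyEq_of_jet {G H : ℂ → ℂ} {w : ℂ} (hG : AnalyticAt ℂ G w) (hH : AnalyticAt ℂ H w)
    (h0 : G w = H w) (h1 : deriv G w = deriv H w) (h1' : deriv H w ≠ 0)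
    (h2 : nonlinearity G w = nonlinearity H w)
    (hS : ∀ᶠ y in 𝓝 w, schwarzianExpr G y = schwarzianExpr H y) : G =ᶠ[𝓝 w] H := by
  have hG' : deriv G w ≠ 0 := h1 ▸ h1'
  have aG := analyticAt_nonlinearity hG hG'
  have aH := analyticAt_nonlinearity hH h1'
  have hN : ∀ᶠ y in 𝓝 w, nonlinearity G y - nonlinearity H y = 0 := by
    refine eventually_eq_zero_of_deriv_eq_mul (aG.sub aH)
      (h := fun y => (nonlinearity G y + nonlinearity H y) / 2)
      ((aG.add aH).div_const) (sub_eq_zero.2 h2) ?_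
    filter_upwards [hS, aG.eventually_analyticAt, aH.eventually_analyticAt,
      hG.eventually_analyticAt, hH.eventually_analyticAt,
      hG.deriv.continuousAt.eventually_ne hG', hH.deriv.continuousAt.eventually_ne h1']
      with y k1 k2 k3 k4 k5 k6 k7
    rw [schwarzianExpr_eq k4 k6, schwarzianExpr_eq k5 k7] at k1
    have := (k2.differentiableAt.hasDerivAt.sub k3.differentiableAt.hasDerivAt).deriv
    rw [show (fun y => nonlinearity G y - nonlinearity H y) = nonlinearity G - nonlinearity H
      from rfl, this]
    linear_combination k1
  have hd : ∀ᶠ y in 𝓝 w, deriv G y - deriv H y = 0 := by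
    refine eventually_eq_zero_of_deriv_eq_mul (hG.deriv.sub hH.deriv) aG (sub_eq_zero.2 h1) ?_
    filter_upwards [hN, eventually_hasDerivAt_deriv hG hG', eventually_hasDerivAt_deriv hH h1']
      with y k1 k2 k3
    rw [show (fun y => deriv G y - deriv H y) = deriv G - deriv H from rfl, (k2.sub k3).deriv,
      sub_eq_zero.1 k1]
    ring
  have hz : ∀ᶠ y in 𝓝 w, G y - H y = 0 := by
    refine eventually_eq_zero_of_deriv_eq_mul (hG.sub hH) (analyticAt_const (v := 0))
      (sub_eq_zero.2 h0) ?_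
    filter_upwards [hd, eventually_hasDerivAt hG, eventually_hasDerivAt hH] with y k1 k2 k3
    rw [show (fun y => G y - H y) = G - H from rfl, (k2.sub k3).deriv, k1, zero_mul]
  exact hz.mono fun y hy => sub_eq_zero.1 hy

lemma exists_moebius_normalized {g : ℂ → ℂ} {w : ℂ} (hg : AnalyticAt ℂ g w)
    (h0 : deriv g w ≠ 0) : ∃ γ ∈ moebiusGroup, ∃ G : ℂ → ℂ, AnalyticAt ℂ G w ∧
      (∀ᶠ y in 𝓝 w, γ (g y) = (G y : OnePoint ℂ)) ∧ G w = 0 ∧ deriv G w = 1 ∧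
      nonlinearity G w = 0 ∧ ∀ᶠ y in 𝓝 w, schwarzianExpr G y = schwarzianExpr g y := by
  -- c cancels the nonlinearity at w, and d makes both the determinant and the denominator at w
  -- equal to g'(w), so that the new derivative there is g' · g' / g'² = 1.
  set c := nonlinearity g w / 2 with hc
  set d := deriv g w - c * g w with hd
  have hdet : (1 : ℂ) * d - (-g w) * c ≠ 0 := by rw [hd]; convert h0 using 1; ring
  let A : Matrix.GeneralLinearGroup (Fin 2) ℂ :=
    Matrix.GeneralLinearGroup.mkOfDetNeZero !![1, -g w; c, d] (by
      rw [Matrix.det_fin_two_of]; exact hdet)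
  have A00 : A 0 0 = 1 := rfl
  have A01 : A 0 1 = -g w := rfl
  have A10 : A 1 0 = c := rfl
  have A11 : A 1 1 = d := rfl
  have hden : c * g w + d ≠ 0 := by rw [hd]; convert h0 using 1; ring
  have hden' : ∀ᶠ y in 𝓝 w, c * g y + d ≠ 0 :=
    ContinuousAt.eventually_ne (g := fun y => c * g y + d)
      (by have := hg.continuousAt; fun_prop) hden
  refine ⟨MulAction.toPermHom _ _ A, ⟨A, rfl⟩,
    fun y => (1 * g y + -g w) / (c * g y + d), ?_, ?_, by simp, ?_, ?_, ?_⟩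
  · exact AnalyticAt.div (by fun_prop) (by fun_prop) hden
  · exact moebius_coe_eventuallyEq hg A hden
  · rw [(eventually_hasDerivAt_fractional hg _ _ _ _ hden).self_of_nhds.deriv]
    have : c * g w + d = deriv g w := by rw [hd]; ring
    rw [this, hd]; field_simp; ring
  · rw [nonlinearity_of_hasDerivAt (N := fun y => nonlinearity g y - 2 * c * deriv g y / (c * g y + d))
      (eventually_hasDerivAt_fractional hg _ _ _ _ hden)
      (eventually_hasDerivAt_fractional' hg h0 _ _ _ _ hden).self_of_nhds
      (div_ne_zero (mul_ne_zero hdet h0) (pow_ne_zero 2 hden))]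
    have : c * g w + d = deriv g w := by rw [hd]; ring
    rw [this, hc]; field_simp; ring
  · filter_upwards [hden', hg.eventually_analyticAt, hg.deriv.continuousAt.eventually_ne h0]
      with y k1 k2 k3
    exact schwarzianExpr_fractional k2 k3 _ _ _ _ k1 hdet

/-- Two Schwarzian primitives differ, near any point, by a Möbius transformation. -/
lemma IsSchwarzianPrimitiveAt.exists_moebius {φ : ℂ → ℂ} {f f' : ℂ → OnePoint ℂ} {z : ℂ}
    (h : IsSchwarzianPrimitiveAt φ f z) (h' : IsSchwarzianPrimitiveAt φ f' z) :
    ∃ γ ∈ moebiusGroup, f' =ᶠ[𝓝 z] fun w => γ (f w) := by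
  obtain ⟨ε, hε, hb⟩ := Metric.eventually_nhds_iff_ball.1 (h.1.eventually.and h'.1.eventually)
  -- z may be a critical point or a pole of f, so the comparison is made at a nearby regular point w
  -- and carried back to z by the identity theorem.
  have hreg := eventually_nhdsNE_eventually_nhds_iff.2
    (h.eventually_isRegularAt.and h'.eventually_isRegularAt)
  obtain ⟨w, hw, hwb⟩ := (hreg.and (eventually_nhdsWithin_of_eventually_nhds
    (Metric.ball_mem_nhds z hε))).exists
  obtain ⟨⟨g, hg, hfg, h0, -⟩, ⟨g', hg', hfg', h0', -⟩⟩ := hw.self_of_nhds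
  obtain ⟨γ, hγ, G, hG, hγG, hG0, hG1, hG2, hGS⟩ := exists_moebius_normalized hg h0
  obtain ⟨γ', hγ', G', hG', hγG', hG0', hG1', hG2', hGS'⟩ := exists_moebius_normalized hg' h0'
  have hSg : ∀ᶠ y in 𝓝 w, schwarzianExpr g y = schwarzianExpr g' y := by
    filter_upwards [hw, hfg.eventually_nhds, hfg'.eventually_nhds] with y ⟨k1, k2⟩ k3 k4
    obtain ⟨g₁, -, l1, -, l2⟩ := k1
    obtain ⟨g₂, -, l3, -, l4⟩ := k2
    have e1 : g =ᶠ[𝓝 y] g₁ := by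
      filter_upwards [k3, l1] with x h1 h2
      exact OnePoint.coe_injective (h1.symm.trans h2)
    have e2 : g' =ᶠ[𝓝 y] g₂ := by
      filter_upwards [k4, l3] with x h1 h2
      exact OnePoint.coe_injective (h1.symm.trans h2)
    rw [schwarzianExpr_congr e1, schwarzianExpr_congr e2, l2, l4]
  have hGG : G =ᶠ[𝓝 w] G' := by
    refine eventuallyEq_of_jet hG hG' (by rw [hG0, hG0']) (by rw [hG1, hG1'])
      (by rw [hG1']; exact one_ne_zero) (by rw [hG2, hG2']) ?_
    filter_upwards [hSg, hGS, hGS'] with y h1 h2 h3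
    rw [h2, h3, h1]
  have hmem : γ'⁻¹ * γ ∈ moebiusGroup := mul_mem (inv_mem hγ') hγ
  refine ⟨γ'⁻¹ * γ, hmem, ?_⟩
  refine eventuallyEq_of_isPreconnected (convex_ball z ε).isPreconnected
    (fun x hx => (hb x hx).2) (fun x hx => (hb x hx).1.moebius hmem) hwb ?_
    (Metric.mem_ball_self hε)
  filter_upwards [hfg, hfg', hγG, hγG', hGG] with y k1 k2 k3 k4 k5
  rw [k2, Equiv.Perm.mul_apply, k1, k3, k5, ← k4]
  exact (Equiv.symm_apply_apply γ' _).symm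

/-! ### Taylor coefficients and power series with geometric bounds -/

/-- The `n`-th Taylor coefficient of `f` at `c`. -/
def taylorCoeff (c : ℂ) (f : ℂ → ℂ) (n : ℕ) : ℂ := iteratedDeriv n f c / n.factorial

section taylor

variable {c : ℂ}

lemma hasSum_taylorCoeff {f : ℂ → ℂ} (hf : AnalyticAt ℂ f c) :
    ∀ᶠ z in 𝓝 c, HasSum (fun n => taylorCoeff c f n * (z - c) ^ n) (f z) := by
  have := hasFPowerSeriesAt_iff'.1 hf.hasFPowerSeriesAt
  refine this.mono fun z hz => ?_
  simpa [FormalMultilinearSeries.coeff_ofScalars, taylorCoeff, mul_comm] using hz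

lemma hasFPowerSeriesAt_of_hasSum {f : ℂ → ℂ} {b : ℕ → ℂ}
    (h : ∀ᶠ z in 𝓝 c, HasSum (fun n => b n * (z - c) ^ n) (f z)) :
    HasFPowerSeriesAt f (FormalMultilinearSeries.ofScalars ℂ b) c := by
  rw [hasFPowerSeriesAt_iff']
  refine h.mono fun z hz => ?_
  simpa [FormalMultilinearSeries.coeff_ofScalars, mul_comm] using hz

lemma taylorCoeff_of_hasSum {f : ℂ → ℂ} {b : ℕ → ℂ}
    (h : ∀ᶠ z in 𝓝 c, HasSum (fun n => b n * (z - c) ^ n) (f z)) (n : ℕ) :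
    taylorCoeff c f n = b n := by
  have h1 := hasFPowerSeriesAt_of_hasSum h
  have h2 := h1.eq_formalMultilinearSeries h1.analyticAt.hasFPowerSeriesAt
  have := congrArg (fun p => FormalMultilinearSeries.coeff p n) h2
  simp only [FormalMultilinearSeries.coeff_ofScalars] at this
  exact this.symm

lemma eventually_eq_zero_of_taylorCoeff {f : ℂ → ℂ} (hf : AnalyticAt ℂ f c)
    (h : ∀ n, taylorCoeff c f n = 0) : ∀ᶠ z in 𝓝 c, f z = 0 := by
  filter_upwards [hasSum_taylorCoeff hf] with z hz
  simp only [h, zero_mul] at hz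
  exact hz.unique hasSum_zero

lemma taylorCoeff_zero (f : ℂ → ℂ) : taylorCoeff c f 0 = f c := by simp [taylorCoeff]

lemma taylorCoeff_congr {f g : ℂ → ℂ} (h : f =ᶠ[𝓝 c] g) (n : ℕ) :
    taylorCoeff c f n = taylorCoeff c g n := by
  rw [taylorCoeff, taylorCoeff, h.iteratedDeriv_eq n]

lemma taylorCoeff_const_zero (n : ℕ) : taylorCoeff c (fun _ => 0) n = 0 := by
  rw [taylorCoeff_of_hasSum (b := fun _ => 0) (by simp [hasSum_zero])]

lemma taylorCoeff_deriv (f : ℂ → ℂ) (n : ℕ) :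
    taylorCoeff c (deriv f) n = (n + 1) * taylorCoeff c f (n + 1) := by
  unfold taylorCoeff
  rw [iteratedDeriv_succ', Nat.factorial_succ]
  push_cast
  field_simp

lemma taylorCoeff_add {f g : ℂ → ℂ} (hf : AnalyticAt ℂ f c) (hg : AnalyticAt ℂ g c) (n : ℕ) :
    taylorCoeff c (fun z => f z + g z) n = taylorCoeff c f n + taylorCoeff c g n := by
  refine taylorCoeff_of_hasSum (b := fun n => _ + _) ?_ n
  filter_upwards [hasSum_taylorCoeff hf, hasSum_taylorCoeff hg] with z h1 h2
  simpa only [add_mul] using h1.add h2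

lemma taylorCoeff_const_mul {f : ℂ → ℂ} (hf : AnalyticAt ℂ f c) (k : ℂ) (n : ℕ) :
    taylorCoeff c (fun z => k * f z) n = k * taylorCoeff c f n := by
  refine taylorCoeff_of_hasSum (b := fun n => k * taylorCoeff c f n) ?_ n
  filter_upwards [hasSum_taylorCoeff hf] with z h1
  simpa only [mul_assoc] using h1.mul_left k

lemma taylorCoeff_sub_pow (d n : ℕ) :
    taylorCoeff c (fun z => (z - c) ^ d) n = if n = d then 1 else 0 := by
  refine taylorCoeff_of_hasSum (b := fun n => if n = d then 1 else 0) ?_ n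
  filter_upwards with z
  convert hasSum_ite_eq d ((z - c) ^ d) using 2 with n
  by_cases h : n = d <;> simp [h]

lemma taylorCoeff_mul {f g : ℂ → ℂ} (hf : AnalyticAt ℂ f c) (hg : AnalyticAt ℂ g c) (n : ℕ) :
    taylorCoeff c (fun z => f z * g z) n =
      ∑ i ∈ Finset.range (n + 1), taylorCoeff c f i * taylorCoeff c g (n - i) := by
  unfold taylorCoeff
  rw [iteratedDeriv_fun_mul hf.contDiffAt hg.contDiffAt, Finset.sum_div]
  refine Finset.sum_congr rfl fun i hi => ?_
  rw [Nat.cast_choose ℂ (Nat.lt_succ_iff.1 (Finset.mem_range.1 hi))]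
  have h1 : (n.factorial : ℂ) ≠ 0 := by exact_mod_cast n.factorial_ne_zero
  have h2 : (i.factorial : ℂ) ≠ 0 := by exact_mod_cast i.factorial_ne_zero
  have h3 : ((n - i).factorial : ℂ) ≠ 0 := by exact_mod_cast (n - i).factorial_ne_zero
  field_simp

lemma taylorCoeff_sub_mul {f : ℂ → ℂ} (hf : AnalyticAt ℂ f c) (n : ℕ) :
    taylorCoeff c (fun z => (z - c) * f z) n = if n = 0 then 0 else taylorCoeff c f (n - 1) := by
  rcases n with _ | n
  · simp [taylorCoeff_zero]
  · refine taylorCoeff_of_hasSum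
      (b := fun n => if n = 0 then 0 else taylorCoeff c f (n - 1)) ?_ (n + 1)
    filter_upwards [hasSum_taylorCoeff hf] with z hz
    rw [hasSum_nat_add_iff' 1 |>.symm]
    have := hz.mul_left (z - c)
    simp only [Finset.sum_range_one, if_true, zero_mul, sub_zero, Nat.succ_ne_zero, if_false,
      Nat.add_sub_cancel]
    have e : (fun k => taylorCoeff c f k * (z - c) ^ (k + 1)) =
        fun k => (z - c) * (taylorCoeff c f k * (z - c) ^ k) := funext fun k => by ring
    rw [e]
    exact this

lemma exists_analyticAt_of_bound (c : ℂ) {b : ℕ → ℂ} {C ρ : ℝ} (hρ : 0 < ρ)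
    (h : ∀ n, ‖b n‖ ≤ C * ρ ^ n) : ∃ f : ℂ → ℂ, AnalyticAt ℂ f c ∧
      (∀ᶠ z in 𝓝 c, HasSum (fun n => b n * (z - c) ^ n) (f z)) ∧
      ∀ n, taylorCoeff c f n = b n := by
  have hs : ∀ᶠ z in 𝓝 c, HasSum (fun n => b n * (z - c) ^ n) (∑' n, b n * (z - c) ^ n) := by
    filter_upwards [Metric.ball_mem_nhds c (inv_pos.2 hρ)] with z hz
    refine Summable.hasSum ?_
    have hlt : ρ * ‖z - c‖ < 1 := by
      rw [Metric.mem_ball, dist_eq_norm, ← one_div, lt_div_iff₀ hρ] at hz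
      linarith
    refine Summable.of_norm_bounded (g := fun n => C * (ρ * ‖z - c‖) ^ n)
      ((summable_geometric_of_lt_one (by positivity) hlt).mul_left C) fun n => ?_
    rw [norm_mul, norm_pow, mul_pow, ← mul_assoc]
    gcongr
    exact h n
  exact ⟨_, (hasFPowerSeriesAt_of_hasSum hs).analyticAt, hs, fun n => taylorCoeff_of_hasSum hs n⟩

lemma exists_bound_of_hasSum {b : ℕ → ℂ} {z s : ℂ} (hz : z ≠ c)
    (h : HasSum (fun n => b n * (z - c) ^ n) s) :
    ∃ C ρ : ℝ, 0 < C ∧ 0 < ρ ∧ ∀ n, ‖b n‖ ≤ C * ρ ^ n := by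
  have hpos : 0 < ‖z - c‖ := norm_pos_iff.2 (sub_ne_zero.2 hz)
  obtain ⟨K, hK⟩ := h.summable.tendsto_atTop_zero.norm.bddAbove_range
  refine ⟨max K 1, ‖z - c‖⁻¹, by positivity, by positivity, fun n => ?_⟩
  have h1 : ‖b n‖ * ‖z - c‖ ^ n ≤ max K 1 := by
    rw [← norm_pow, ← norm_mul]
    exact (hK ⟨n, rfl⟩).trans (le_max_left _ _)
  rw [inv_pow, ← div_eq_mul_inv, le_div_iff₀ (by positivity)]
  exact h1

lemma exists_bound_taylorCoeff {f : ℂ → ℂ} (hf : AnalyticAt ℂ f c) :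
    ∃ C ρ : ℝ, 0 < C ∧ 0 < ρ ∧ ∀ n, ‖taylorCoeff c f n‖ ≤ C * ρ ^ n := by
  obtain ⟨z, hz, hz'⟩ := ((eventually_nhdsWithin_of_eventually_nhds
    (hasSum_taylorCoeff hf)).and (eventually_mem_nhdsWithin (a := c) (s := {c}ᶜ))).exists
  exact exists_bound_of_hasSum hz' hz

end taylor

/-! ### The Frobenius method -/

/-- The solution of the recursion
`2 n (n - σ) b n = - ∑ i < n, a (n - i) * b i` for `n ≥ J`, with given entries before `J`. -/
def frobenius (σ : ℤ) (a init : ℕ → ℂ) (J : ℕ) : ℕ → ℂ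
  | n => if n < J then init n else
      -(∑ i : Fin n, a (n - i) * frobenius σ a init J i) / (2 * n * (n - σ))
decreasing_by exact i.2

lemma frobenius_of_lt {σ : ℤ} {a init : ℕ → ℂ} {J n : ℕ} (h : n < J) :
    frobenius σ a init J n = init n := by
  rw [frobenius, if_pos h]

lemma frobenius_of_ge {σ : ℤ} {a init : ℕ → ℂ} {J n : ℕ} (h : J ≤ n) :
    frobenius σ a init J n =
      -(∑ i ∈ Finset.range n, a (n - i) * frobenius σ a init J i) / (2 * n * (n - σ)) := by
  rw [frobenius, if_neg (not_lt.2 h), Finset.sum_range]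

/-- Induction with ρ = R + M. The divisor 2n(n - σ) is a positive integer for n ≥ J, so it can be
dropped, and M ∑ ρ^i R^(n-1-i) = ρ^n - R^n ≤ ρ^n closes the step. C absorbs the first J entries. -/
lemma frobenius_bound {σ : ℤ} {a init : ℕ → ℂ} {J : ℕ} (hJ : ∀ n : ℕ, J ≤ n → 1 ≤ n ∧ σ < n)
    {M R : ℝ} (hM : 0 < M) (hR : 0 < R) (ha : ∀ n, ‖a (n + 1)‖ ≤ M * R ^ n) :
    ∃ C ρ : ℝ, 0 < ρ ∧ ∀ n, ‖frobenius σ a init J n‖ ≤ C * ρ ^ n := by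
  set b := frobenius σ a init J with hb
  set ρ := R + M with hρ
  have hρ0 : 0 < ρ := by positivity
  set C := ∑ i ∈ Finset.range J, ‖b i‖ / ρ ^ i with hC
  have hC0 : 0 ≤ C := Finset.sum_nonneg fun i _ => by positivity
  refine ⟨C, ρ, hρ0, fun n => ?_⟩
  induction n using Nat.strong_induction_on with
  | _ n ih =>
  by_cases hn : n < J
  · have : ‖b n‖ / ρ ^ n ≤ C := Finset.single_le_sum (f := fun i => ‖b i‖ / ρ ^ i)
      (fun i _ => by positivity) (Finset.mem_range.2 hn)
    rwa [div_le_iff₀ (by positivity)] at this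
  · push Not at hn
    obtain ⟨hn1, hnσ⟩ := hJ n hn
    obtain ⟨m, rfl⟩ : ∃ m, n = m + 1 := ⟨n - 1, by omega⟩
    have hden : (1 : ℝ) ≤ ‖(2 : ℂ) * (m + 1 : ℕ) * ((m + 1 : ℕ) - σ)‖ := by
      have e : (2 : ℂ) * (m + 1 : ℕ) * ((m + 1 : ℕ) - σ) =
          ((2 * (m + 1 : ℕ) * ((m + 1 : ℕ) - σ) : ℤ) : ℂ) := by push_cast; ring
      rw [e, Complex.norm_intCast]
      have h1 : (1 : ℤ) ≤ 2 * (m + 1 : ℕ) * ((m + 1 : ℕ) - σ) := by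
        have : (1 : ℤ) ≤ (m + 1 : ℕ) - σ := by omega
        have : (1 : ℤ) ≤ (m + 1 : ℕ) := by omega
        nlinarith
      have h2 : (1 : ℝ) ≤ ((2 * (m + 1 : ℕ) * ((m + 1 : ℕ) - σ) : ℤ) : ℝ) := by exact_mod_cast h1
      exact h2.trans (le_abs_self _)
    rw [hb, frobenius_of_ge hn, ← hb, norm_div, norm_neg]
    refine (div_le_self (norm_nonneg _) hden).trans ?_
    refine (norm_sum_le _ _).trans ?_
    have hterm : ∀ i ∈ Finset.range (m + 1), ‖a (m + 1 - i) * b i‖ ≤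
        C * M * (ρ ^ i * R ^ (m + 1 - 1 - i)) := by
      intro i hi
      rw [Finset.mem_range] at hi
      rw [norm_mul, show m + 1 - i = (m - i) + 1 by omega, Nat.add_sub_cancel]
      calc _ ≤ (M * R ^ (m - i)) * (C * ρ ^ i) :=
            mul_le_mul (ha _) (ih i hi) (norm_nonneg _) (by positivity)
        _ = _ := by ring
    refine (Finset.sum_le_sum hterm).trans ?_
    rw [← Finset.mul_sum]
    have hg := (Commute.all ρ R).geom_sum₂_mul (m + 1)
    have : (∑ i ∈ Finset.range (m + 1), ρ ^ i * R ^ (m + 1 - 1 - i)) * M ≤ ρ ^ (m + 1) := by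
      have hMe : M = ρ - R := by rw [hρ]; ring
      rw [hMe, hg]
      have : 0 ≤ R ^ (m + 1) := by positivity
      linarith
    calc _ = C * ((∑ i ∈ Finset.range (m + 1), ρ ^ i * R ^ (m + 1 - 1 - i)) * M) := by ring
      _ ≤ _ := mul_le_mul_of_nonneg_left this hC0

/-- The operator `x w'' + (1 - σ) w' + (q / 2) w`, where `x = z - c`. -/
def frobeniusOp (c : ℂ) (σ : ℤ) (q w : ℂ → ℂ) (z : ℂ) : ℂ :=
  (z - c) * deriv (deriv w) z + ((1 - σ) * deriv w z + 1 / 2 * (q z * w z))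

lemma analyticAt_frobeniusOp {c : ℂ} {σ : ℤ} {q w : ℂ → ℂ} (hq : AnalyticAt ℂ q c)
    (hw : AnalyticAt ℂ w c) : AnalyticAt ℂ (frobeniusOp c σ q w) c := by
  have := hw.deriv
  have := hw.deriv.deriv
  unfold frobeniusOp
  fun_prop

lemma taylorCoeff_frobeniusOp {c : ℂ} {σ : ℤ} {q w : ℂ → ℂ} (hq : AnalyticAt ℂ q c)
    (hw : AnalyticAt ℂ w c) (n : ℕ) :
    taylorCoeff c (frobeniusOp c σ q w) n =
      (n + 1) * (n + 1 - σ) * taylorCoeff c w (n + 1) +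
        1 / 2 * ∑ i ∈ Finset.range (n + 1), taylorCoeff c q (n - i) * taylorCoeff c w i := by
  have hw1 := hw.deriv
  have hw2 := hw.deriv.deriv
  have e := taylorCoeff_add (c := c) (f := fun z => (z - c) * deriv (deriv w) z)
    (g := fun z => (1 - σ) * deriv w z + 1 / 2 * (q z * w z)) (by fun_prop) (by fun_prop) n
  have e2 := taylorCoeff_add (c := c) (f := fun z => (1 - σ) * deriv w z)
    (g := fun z => 1 / 2 * (q z * w z)) (by fun_prop) (by fun_prop) n
  have e3 := taylorCoeff_const_mul (f := fun z => q z * w z) (hq.mul hw) (1 / 2) n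
  have e4 := taylorCoeff_mul hq hw n
  rw [← Finset.sum_range_reflect] at e4
  have e5 : ∑ j ∈ Finset.range (n + 1), taylorCoeff c q (n + 1 - 1 - j) *
      taylorCoeff c w (n - (n + 1 - 1 - j)) =
      ∑ i ∈ Finset.range (n + 1), taylorCoeff c q (n - i) * taylorCoeff c w i := by
    refine Finset.sum_congr rfl fun i hi => ?_
    rw [Finset.mem_range] at hi
    rw [Nat.add_sub_cancel, show n - (n - i) = i by omega]
  unfold frobeniusOp
  rw [e, e2, e3, e4, e5, taylorCoeff_sub_mul hw2, taylorCoeff_const_mul hw1]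
  rcases n with _ | n
  · have := taylorCoeff_deriv (c := c) w 0
    simp [this]
  · rw [if_neg (Nat.succ_ne_zero n), Nat.add_sub_cancel, taylorCoeff_deriv, taylorCoeff_deriv]
    push_cast
    ring

/-- A Frobenius solution with given initial entries. -/
lemma exists_frobenius_solution {c : ℂ} {σ : ℤ} {a init : ℕ → ℂ} {q : ℂ → ℂ} {J : ℕ}
    (hq : AnalyticAt ℂ q c) (hqa : ∀ n, taylorCoeff c q n = a (n + 1))
    (hJ : ∀ n : ℕ, J ≤ n → 1 ≤ n ∧ σ < n)
    (hinit : ∀ n, n + 1 < J → (n + 1) * (n + 1 - σ) * init (n + 1) +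
      1 / 2 * ∑ i ∈ Finset.range (n + 1), a (n - i + 1) * init i = 0) :
    ∃ w : ℂ → ℂ, AnalyticAt ℂ w c ∧ w c = init 0 ∧
      ∀ᶠ z in 𝓝 c, frobeniusOp c σ q w z = 0 := by
  obtain ⟨M, R, hM, hR, hMR⟩ := exists_bound_taylorCoeff hq
  simp only [hqa] at hMR
  obtain ⟨C, ρ, hρ, hb⟩ := frobenius_bound (init := init) hJ hM hR hMR
  obtain ⟨w, hw, -, hwb⟩ := exists_analyticAt_of_bound c hρ hb
  have hJ0 : 0 < J := by
    by_contra h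
    have := (hJ 0 (by omega)).1
    omega
  refine ⟨w, hw, ?_, eventually_eq_zero_of_taylorCoeff (analyticAt_frobeniusOp hq hw) fun n => ?_⟩
  · rw [← taylorCoeff_zero (c := c) w, hwb, frobenius_of_lt hJ0]
  · rw [taylorCoeff_frobeniusOp hq hw]
    simp only [hwb, hqa]
    by_cases hn : n + 1 < J
    · rw [← hinit n hn, frobenius_of_lt hn]
      congr 2
      refine Finset.sum_congr rfl fun i hi => ?_
      rw [Finset.mem_range] at hi
      rw [frobenius_of_lt (hi.trans hn)]
    · push Not at hn
      rw [frobenius_of_ge hn]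
      have hσ := (hJ _ hn).2
      have h1 : ((n : ℂ) + 1 - σ) ≠ 0 := by
        have : ((n + 1 : ℕ) : ℤ) - σ ≠ 0 := by omega
        have : ((((n + 1 : ℕ) : ℤ) - σ : ℤ) : ℂ) ≠ 0 := by exact_mod_cast this
        push_cast at this
        exact this
      have h2 : ((n : ℂ) + 1) ≠ 0 := by exact_mod_cast Nat.succ_ne_zero n
      have e : ∑ i ∈ Finset.range (n + 1), a (n + 1 - i) * frobenius σ a init J i =
          ∑ i ∈ Finset.range (n + 1), a (n - i + 1) * frobenius σ a init J i := by
        refine Finset.sum_congr rfl fun i hi => ?_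
        rw [Finset.mem_range] at hi
        rw [show n + 1 - i = n - i + 1 by omega]
      rw [e]
      push_cast
      field_simp
      ring

/-! ### Laurent expansions and solutions of the linear equation -/

/-- `φ(z) = (1 - d²) / (2 (z - c)²) + q(z) / (z - c)` near `c`, with `q` analytic at `c`. -/
def HasExpansion (φ : ℂ → ℂ) (c : ℂ) (d : ℕ) (q : ℂ → ℂ) : Prop :=
  AnalyticAt ℂ q c ∧
    ∀ᶠ z in 𝓝[≠] c, φ z = (1 - (d : ℂ) ^ 2) / (2 * (z - c) ^ 2) + q z / (z - c)

/-- After multiplication by z - c, convergence at a single point other than c bounds the a_n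
geometrically, which is enough for an analytic q. -/
lemma HasLocalForm.exists_expansion {φ : ℂ → ℂ} {c : ℂ} {d : ℕ} {a : ℕ → ℂ}
    (h : HasLocalForm φ c d a) :
    ∃ q, HasExpansion φ c d q ∧ ∀ n, taylorCoeff c q n = a (n + 1) := by
  have h1 : ∀ᶠ z in 𝓝[≠] c, HasSum (fun n : ℕ => a (n + 1) * (z - c) ^ n)
      ((z - c) * (φ z - (1 - (d : ℂ) ^ 2) / (2 * (z - c) ^ 2))) := by
    filter_upwards [h, eventually_mem_nhdsWithin] with z hz hzc
    have hne : z - c ≠ 0 := sub_ne_zero.2 hzc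
    have e : (fun n : ℕ => a (n + 1) * (z - c) ^ n) =
        fun n : ℕ => (z - c) * (a (n + 1) * (z - c) ^ ((n : ℤ) - 1)) := by
      funext n
      rw [zpow_sub_one₀ hne, zpow_natCast]
      field_simp
    rw [e]
    exact hz.mul_left _
  obtain ⟨z, hz, hzc⟩ := (h1.and eventually_mem_nhdsWithin).exists
  obtain ⟨C, ρ, -, hρ, hb⟩ := exists_bound_of_hasSum hzc hz
  obtain ⟨q, hq, hqs, hqc⟩ := exists_analyticAt_of_bound c hρ hb
  refine ⟨q, ⟨hq, ?_⟩, hqc⟩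
  filter_upwards [h1, eventually_nhdsWithin_of_eventually_nhds hqs, eventually_mem_nhdsWithin]
    with z k1 k2 k3
  have hne : z - c ≠ 0 := sub_ne_zero.2 k3
  rw [k2.unique k1]
  field_simp
  ring

/-- An ordinary point is the degenerate case d = 1: the double pole term vanishes, and q = (z - c) ψ
where ψ is the analytic extension of φ. -/
lemma exists_expansion_of_order_nonneg {φ : ℂ → ℂ} {c : ℂ} (h : MeromorphicAt φ c)
    (h0 : 0 ≤ meromorphicOrderAt φ c) : ∃ q, HasExpansion φ c 1 q ∧ q c = 0 := by
  obtain ⟨ψ, hψ, hφψ⟩ : ∃ ψ, AnalyticAt ℂ ψ c ∧ φ =ᶠ[𝓝[≠] c] ψ := by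
    exact h.meromorphicOrderAt_nonneg_iff.1 h0
  refine ⟨fun z => (z - c) * ψ z, ⟨by fun_prop, ?_⟩, by simp⟩
  filter_upwards [hφψ, eventually_mem_nhdsWithin] with z h1 h2
  have hne : z - c ≠ 0 := sub_ne_zero.2 h2
  rw [h1]
  field_simp
  simp

section frobenius

variable {c : ℂ} {q : ℂ → ℂ}

lemma hasDerivAt_sub_zpow {y : ℂ} (σ : ℤ) (h : y ≠ c) :
    HasDerivAt (fun y => (y - c) ^ σ) (σ * (y - c) ^ (σ - 1)) y := by
  have := (hasDerivAt_zpow σ (y - c) (Or.inl (sub_ne_zero.2 h))).comp y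
    ((hasDerivAt_id y).sub_const c)
  exact this.congr_deriv (by simp)

/-- The classical linearisation: 1/√f' solves y'' + (φ/2) y = 0, and w is what remains after
splitting off the power (z - c)^((1-σ)/2). The root never appears, since only the logarithmic
derivative (σ - 1)/(y - c) - 2w'/w of f' is used. -/
lemma schwarzianExpr_of_frobeniusOp {σ : ℤ} {w g : ℂ → ℂ} {z : ℂ} (hzc : z ≠ c)
    (hw : AnalyticAt ℂ w z) (hw0 : w z ≠ 0) (hop : frobeniusOp c σ q w z = 0)
    (hg : ∀ᶠ y in 𝓝 z, HasDerivAt g ((y - c) ^ (σ - 1) / w y ^ 2) y) :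
    schwarzianExpr g z = (1 - (σ : ℂ) ^ 2) / (2 * (z - c) ^ 2) + q z / (z - c) := by
  have hne : z - c ≠ 0 := sub_ne_zero.2 hzc
  have hN : HasDerivAt (fun y => (σ - 1) / (y - c) - 2 * deriv w y / w y)
      (-(σ - 1) / (z - c) ^ 2 -
        2 * (deriv (deriv w) z * w z - deriv w z ^ 2) / w z ^ 2) z := by
    have h1 := (hasDerivAt_const z ((σ : ℂ) - 1)).div ((hasDerivAt_id z).sub_const c) hne
    have h2 := ((eventually_hasDerivAt hw.deriv).self_of_nhds.const_mul 2).div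
      (eventually_hasDerivAt hw).self_of_nhds hw0
    refine (h1.sub h2).congr_deriv ?_
    simp only [id]
    field_simp
    ring
  have he : ∀ᶠ y in 𝓝 z, HasDerivAt (fun y => (y - c) ^ (σ - 1) / w y ^ 2)
      ((y - c) ^ (σ - 1) / w y ^ 2 * ((σ - 1) / (y - c) - 2 * deriv w y / w y)) y := by
    filter_upwards [eventually_ne_nhds hzc, hw.continuousAt.eventually_ne hw0,
      eventually_hasDerivAt hw] with y h1 h2 h3
    have hy : y - c ≠ 0 := sub_ne_zero.2 h1
    refine ((hasDerivAt_sub_zpow (σ - 1) h1).div (h3.pow 2) (pow_ne_zero 2 h2)).congr_deriv ?_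
    rw [zpow_sub_one₀ hy (σ - 1)]
    simp only [Pi.pow_apply]
    field_simp
    push_cast
    ring
  rw [schwarzianExpr_of_logDeriv hg he
    (div_ne_zero (zpow_ne_zero _ hne) (pow_ne_zero 2 hw0)) hN]
  unfold frobeniusOp at hop
  have : deriv (deriv w) z = -((1 - σ) * deriv w z + 1 / 2 * (q z * w z)) / (z - c) := by
    field_simp
    linear_combination 2 * hop
  rw [this]
  field_simp
  ring

/-- For σ = d ≥ 1 the density (z - c)^(d-1)/w² has no pole at c, so it integrates on a disc. -/
lemma exists_primitive_of_solution {φ : ℂ → ℂ} {d : ℕ} (hd : 1 ≤ d)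
    (hφ : HasExpansion φ c d q) {w : ℂ → ℂ} (hw : AnalyticAt ℂ w c) (hw0 : w c ≠ 0)
    (hop : ∀ᶠ z in 𝓝 c, frobeniusOp c d q w z = 0) :
    ∃ f, IsSchwarzianPrimitiveAt φ f c := by
  obtain ⟨r, hr, hb⟩ := Metric.eventually_nhds_iff_ball.1
    ((hw.eventually_analyticAt.and (hw.continuousAt.eventually_ne hw0)).and
      (hop.and (eventually_nhdsWithin_iff.1 hφ.2)))
  have hdiff : DifferentiableOn ℂ (fun z => (z - c) ^ (d - 1) / w z ^ 2) (Metric.ball c r) := by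
    intro z hz
    have h1 := (hb z hz).1.1.differentiableAt
    have h2 := (hb z hz).1.2
    exact DifferentiableAt.differentiableWithinAt (DifferentiableAt.fun_div
      (c := fun z => (z - c) ^ (d - 1)) (d := fun z => w z ^ 2) (by fun_prop) (by fun_prop)
      (pow_ne_zero 2 h2))
  obtain ⟨g, hg⟩ := hdiff.isExactOn_ball
  have hga : ∀ z ∈ Metric.ball c r, AnalyticAt ℂ g z := fun z hz =>
    DifferentiableOn.analyticAt
      (fun y hy => (hg y hy).differentiableAt.differentiableWithinAt)
      (Metric.isOpen_ball.mem_nhds hz)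
  have hcb := Metric.mem_ball_self (x := c) hr
  have hne : ∀ z ∈ Metric.ball c r, z ≠ c → deriv g z ≠ 0 := by
    intro z hz hzc
    rw [(hg z hz).deriv]
    exact div_ne_zero (pow_ne_zero _ (sub_ne_zero.2 hzc)) (pow_ne_zero 2 (hb z hz).1.2)
  refine ⟨fun z => (g z : OnePoint ℂ), isSchwarzianPrimitiveAt_iff.2
    ⟨isHolomorphicAt_coe (hga c hcb), fun hc => ?_, ?_⟩⟩
  · have hc' : g =ᶠ[𝓝 c] fun _ => g c := hc.mono fun z hz => OnePoint.coe_injective hz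
    obtain ⟨z, ⟨h1, h2⟩, h3⟩ := ((eventually_nhdsWithin_of_eventually_nhds
      (hc'.deriv.and (Metric.ball_mem_nhds c hr))).and
        (eventually_mem_nhdsWithin (a := c) (s := {c}ᶜ))).exists
    exact hne z h2 h3 (by rw [h1]; simp)
  · filter_upwards [eventually_nhdsWithin_of_eventually_nhds (Metric.ball_mem_nhds c hr),
      eventually_mem_nhdsWithin] with z hz hzc
    refine ⟨g, hga z hz, EventuallyEq.rfl, hne z hz hzc, ?_⟩
    rw [(hb z hz).2.2 hzc, schwarzianExpr_of_frobeniusOp (σ := d) hzc (hb z hz).1.1 (hb z hz).1.2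
      (hb z hz).2.1]
    · simp
    · filter_upwards [Metric.isOpen_ball.mem_nhds hz] with y hy
      have : HasDerivAt g ((y - c) ^ (d - 1) / w y ^ 2) y := hg y hy
      rwa [← zpow_natCast (y - c), Nat.cast_sub hd, Nat.cast_one] at this

/-- The solution with the larger exponent, and the integral of the reciprocal of its square,
up to a logarithm with coefficient `r`. -/
lemma exists_log_solution {d : ℕ} (hd : 1 ≤ d) (hq : AnalyticAt ℂ q c) :
    ∃ (u m : ℂ → ℂ) (r : ℂ), AnalyticAt ℂ u c ∧ u c ≠ 0 ∧ AnalyticAt ℂ m c ∧ m c ≠ 0 ∧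
      (∀ᶠ z in 𝓝 c, frobeniusOp c (-d) q u z = 0) ∧
      ∀ᶠ z in 𝓝 c, (z - c) * deriv m z - d * m z = 1 / u z ^ 2 - r * (z - c) ^ d := by
  -- For the exponent -d the divisors 2n(n + d) never vanish for n ≥ 1, so only u(c) has to be
  -- prescribed.
  obtain ⟨u, hu, hu0, hop⟩ := exists_frobenius_solution (c := c) (σ := -(d : ℤ))
    (a := fun n => taylorCoeff c q (n - 1)) (init := fun _ => 1) (J := 1) hq (fun n => rfl)
    (fun n hn => ⟨hn, by omega⟩) (fun n hn => by omega)
  have hu0' : u c ≠ 0 := by rw [hu0]; exact one_ne_zero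
  have hg : AnalyticAt ℂ (fun z => 1 / u z ^ 2) c :=
    analyticAt_const.div (hu.pow 2) (pow_ne_zero 2 hu0')
  set g := fun z => 1 / u z ^ 2 with hgdef
  obtain ⟨C, ρ, hC, hρ, hb⟩ := exists_bound_taylorCoeff hg
  -- Comparing coefficients in x m' - d m = g gives m_n = g_n/(n - d). The index n = d is resonant:
  -- m_d is free, here 0, and g_d becomes the logarithmic coefficient r.
  have hmb : ∀ n : ℕ, ‖if n = d then 0 else taylorCoeff c g n / ((n : ℂ) - d)‖ ≤ C * ρ ^ n := by
    intro n
    split_ifs with hn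
    · rw [norm_zero]; positivity
    · have : (1 : ℝ) ≤ ‖(n : ℂ) - d‖ := by
        have e : (n : ℂ) - d = (((n : ℤ) - d : ℤ) : ℂ) := by push_cast; rfl
        rw [e, Complex.norm_intCast]
        have h1 : (1 : ℤ) ≤ |(n : ℤ) - d| := Int.one_le_abs (by omega)
        exact_mod_cast h1
      rw [norm_div]
      exact (div_le_self (norm_nonneg _) this).trans (hb n)
  obtain ⟨m, hm, -, hmc⟩ := exists_analyticAt_of_bound c hρ hmb
  have hd0 : (d : ℂ) ≠ 0 := by exact_mod_cast (by omega : d ≠ 0)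
  refine ⟨u, m, taylorCoeff c g d, hu, hu0', hm, ?_, hop, ?_⟩
  · rw [← taylorCoeff_zero (c := c) m, hmc, if_neg (by omega), taylorCoeff_zero]
    simp only [hgdef]
    refine div_ne_zero (div_ne_zero one_ne_zero (pow_ne_zero 2 hu0')) ?_
    simpa using hd0
  · have hm' := hm.deriv
    have han : AnalyticAt ℂ (fun z => (z - c) * deriv m z + ((-d : ℂ) * m z +
        ((-1 : ℂ) * g z + taylorCoeff c g d * (z - c) ^ d))) c := by fun_prop
    have := eventually_eq_zero_of_taylorCoeff han fun n => by
      rw [taylorCoeff_add (by fun_prop) (by fun_prop), taylorCoeff_add (by fun_prop) (by fun_prop),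
        taylorCoeff_add (by fun_prop) (by fun_prop), taylorCoeff_sub_mul hm',
        taylorCoeff_const_mul hm, taylorCoeff_const_mul hg,
        taylorCoeff_const_mul (by fun_prop), taylorCoeff_sub_pow]
      have e : (if n = 0 then 0 else taylorCoeff c (deriv m) (n - 1)) = n * taylorCoeff c m n := by
        rcases n with _ | n
        · simp
        · rw [if_neg (Nat.succ_ne_zero n), Nat.add_sub_cancel, taylorCoeff_deriv]
          push_cast; ring
      rw [e, hmc]
      split_ifs with hn
      · rw [hn]; ring
      · have : (n : ℂ) - d ≠ 0 := by
          rw [sub_ne_zero]; exact_mod_cast hn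
        field_simp
        ring
    refine this.mono fun z hz => ?_
    linear_combination hz

/-- Reduction of order: the hypothesis on m says that x^(-d) m is an antiderivative of x^(-d-1)/u²,
with x = z - c. The second solution y ∫ y⁻² for y = x^((1+d)/2) u is then x^((1-d)/2) m u. -/
lemma frobeniusOp_mul_eq_zero {d : ℕ} {u m : ℂ → ℂ} (hu : AnalyticAt ℂ u c) (hu0 : u c ≠ 0)
    (hm : AnalyticAt ℂ m c) (hop : ∀ᶠ z in 𝓝 c, frobeniusOp c (-d) q u z = 0)
    (hmu : ∀ᶠ z in 𝓝 c, (z - c) * deriv m z - d * m z = 1 / u z ^ 2) :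
    ∀ᶠ z in 𝓝 c, frobeniusOp c d q (fun z => m z * u z) z = 0 := by
  have h2 : ∀ᶠ z in 𝓝 c, deriv (fun z => m z * u z) z = deriv m z * u z + m z * deriv u z := by
    filter_upwards [eventually_hasDerivAt hu, eventually_hasDerivAt hm] with z k1 k2
    exact (k2.mul k1).deriv
  filter_upwards [hop, hmu.eventually_nhds, h2.eventually_nhds, eventually_hasDerivAt hu,
    eventually_hasDerivAt hm, eventually_hasDerivAt hu.deriv, eventually_hasDerivAt hm.deriv,
    hu.continuousAt.eventually_ne hu0] with z k1 k2 k3 k4 k5 k6 k7 k8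
  have e1 : deriv (deriv fun z => m z * u z) z =
      deriv (deriv m) z * u z + deriv m z * deriv u z +
        (deriv m z * deriv u z + m z * deriv (deriv u) z) := by
    rw [EventuallyEq.deriv_eq k3]
    exact ((k7.mul k4).add (k5.mul k6)).deriv
  -- The derivative of the first-order equation for m.
  have e2 : (1 * deriv m z + (z - c) * deriv (deriv m) z) - d * deriv m z =
      -2 * deriv u z / u z ^ 3 := by
    have hl := ((((hasDerivAt_id z).sub_const c).mul k7).sub (k5.const_mul (d : ℂ)))
    have hr := (hasDerivAt_const z (1 : ℂ)).div (k4.pow 2) (pow_ne_zero 2 k8)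
    have := (hl.congr_of_eventuallyEq (f₁ := fun z => 1 / u z ^ 2)
      (k2.mono fun y hy => hy.symm)).unique hr
    simp only [Pi.pow_apply, id] at this
    rw [this]
    field_simp
    push_cast
    ring
  have e3 := k2.self_of_nhds
  unfold frobeniusOp at k1 ⊢
  rw [e1, k3.self_of_nhds]
  push_cast at k1 ⊢
  have e2' : ((1 * deriv m z + (z - c) * deriv (deriv m) z) - d * deriv m z) * u z ^ 3 =
      -2 * deriv u z := by rw [e2]; field_simp
  have e3' : ((z - c) * deriv m z - d * m z) * u z ^ 2 = 1 := by rw [e3]; field_simp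
  refine mul_left_cancel₀ (pow_ne_zero 2 k8) ?_
  linear_combination (m z * u z ^ 2) * k1 + e2' + 2 * deriv u z * e3'

end frobenius

/-! ### The determinant condition -/

section matrix

variable {d : ℕ} {a : ℕ → ℂ}

/-- Row n is twice the n-th Taylor coefficient of the operator with exponent d, so the matrix
encodes the recursion up to the resonance. -/
lemma coeffMatrix_mulVec (b : ℕ → ℂ) (n : Fin d) :
    (coeffMatrix d a).mulVec (fun i => b i) n =
      2 * (((n : ℕ) + 1) * ((n : ℕ) + 1 - (d : ℂ)) * b (n + 1) +
        1 / 2 * ∑ i ∈ Finset.range (n + 1), a (n - i + 1) * b i) := by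
  have h1 : (coeffMatrix d a).mulVec (fun i => b i) n = ∑ j ∈ Finset.range d,
      ((if j ≤ n then a (n - j + 1) * b j else 0) +
        if j = n + 1 then 2 * (((n : ℕ) + 1) * ((n : ℕ) + 1 - (d : ℂ)) * b (n + 1)) else 0) := by
    rw [Finset.sum_range]
    simp only [Matrix.mulVec, dotProduct, coeffMatrix, Matrix.of_apply]
    refine Finset.sum_congr rfl fun j _ => ?_
    by_cases hj : (j : ℕ) ≤ n
    · rw [if_pos hj, if_pos hj, if_neg (by omega), add_zero]
    · rw [if_neg hj, if_neg hj]
      by_cases hj' : (j : ℕ) = n + 1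
      · rw [if_pos hj', if_pos hj', hj']; push_cast; ring
      · rw [if_neg hj', if_neg hj']; ring
  rw [h1, Finset.sum_add_distrib, Finset.sum_ite_eq']
  have h2 : ∑ j ∈ Finset.range d, (if j ≤ (n : ℕ) then a (n - j + 1) * b j else 0) =
      ∑ i ∈ Finset.range (n + 1), a (n - i + 1) * b i := by
    rw [← Finset.sum_filter]
    congr 1
    ext j
    have := n.2
    simp only [Finset.mem_filter, Finset.mem_range]
    omega
  rw [h2]
  split_ifs with hn
  · ring
  -- In the last row b (n + 1) lies outside the vector, but its factor n + 1 - d is zero.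
  · have : ((n : ℕ) : ℂ) + 1 = d := by
      have := n.2
      rw [Finset.mem_range] at hn
      exact_mod_cast (by omega : (n : ℕ) + 1 = d)
    rw [this]; ring

/-- The first d Taylor coefficients of w form a kernel vector, and the entry w(c) is not zero. -/
lemma det_coeffMatrix_eq_zero_of_solution {c : ℂ} {q w : ℂ → ℂ} (hd : 1 ≤ d)
    (hq : AnalyticAt ℂ q c) (hqa : ∀ n, taylorCoeff c q n = a (n + 1)) (hw : AnalyticAt ℂ w c)
    (hw0 : w c ≠ 0) (hop : ∀ᶠ z in 𝓝 c, frobeniusOp c d q w z = 0) :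
    (coeffMatrix d a).det = 0 := by
  rw [← Matrix.exists_mulVec_eq_zero_iff]
  refine ⟨fun i => taylorCoeff c w i, fun h => hw0 ?_, ?_⟩
  · have := congrFun h ⟨0, hd⟩
    simpa [taylorCoeff_zero] using this
  · funext n
    rw [coeffMatrix_mulVec, Pi.zero_apply]
    have h1 : taylorCoeff c (frobeniusOp c d q w) n = 0 := by
      rw [taylorCoeff_congr (g := fun _ => 0) hop, taylorCoeff_const_zero]
    rw [taylorCoeff_frobeniusOp hq hw] at h1
    simp only [hqa, Int.cast_natCast] at h1
    rw [h1, mul_zero]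

/-- A kernel vector satisfies all equations up to the resonance. Past it the divisors are nonzero
again, so the recursion continues it to a full solution. -/
lemma exists_primitive_of_det_eq_zero {φ : ℂ → ℂ} {c : ℂ} {q : ℂ → ℂ} (hd : 1 ≤ d)
    (hφ : HasExpansion φ c d q) (hqa : ∀ n, taylorCoeff c q n = a (n + 1))
    (hdet : (coeffMatrix d a).det = 0) : ∃ f, IsSchwarzianPrimitiveAt φ f c := by
  obtain ⟨v, hv, hMv⟩ := Matrix.exists_mulVec_eq_zero_iff.2 hdet
  -- The padding sets b d = 0. This coefficient is free, as the equation at the resonance does not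
  -- involve it.
  set b : ℕ → ℂ := fun i => if h : i < d then v ⟨i, h⟩ else 0 with hb
  have hbv : (fun i : Fin d => b i) = v := by
    funext i
    simp [hb]
  have hrow : ∀ n < d, ((n : ℂ) + 1) * ((n : ℂ) + 1 - d) * b (n + 1) +
      1 / 2 * ∑ i ∈ Finset.range (n + 1), a (n - i + 1) * b i = 0 := by
    intro n hn
    have := congrFun hMv ⟨n, hn⟩
    rw [← hbv, coeffMatrix_mulVec] at this
    simpa using this
  -- The entries above the diagonal are nonzero, so b 0 determines all of b and b 0 = 0 would make
  -- the kernel vector zero.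
  have hb0 : b 0 ≠ 0 := by
    intro h0
    apply hv
    have hall : ∀ n < d, b n = 0 := by
      intro n
      induction n using Nat.strong_induction_on with
      | _ n ih =>
      intro hn
      rcases n with _ | n
      · exact h0
      · have h1 := hrow n (by omega)
        rw [Finset.sum_eq_zero, mul_zero, add_zero] at h1
        · have h2 : ((n : ℂ) + 1) ≠ 0 := by exact_mod_cast Nat.succ_ne_zero n
          have h3 : ((n : ℂ) + 1 - d) ≠ 0 := by
            rw [sub_ne_zero]; exact_mod_cast hn.ne
          simpa [h2, h3] using h1
        · intro i hi
          rw [Finset.mem_range] at hi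
          rw [ih i hi (by omega), mul_zero]
    rw [← hbv]
    funext i
    exact hall i i.2
  obtain ⟨w, hw, hw0, hop⟩ := exists_frobenius_solution (c := c) (σ := (d : ℤ)) (a := a)
    (init := b) (J := d + 1) hφ.1 hqa (fun n hn => ⟨by omega, by omega⟩)
    (fun n hn => by simpa using hrow n (by omega))
  exact exists_primitive_of_solution hd hφ hw (hw0 ▸ hb0) hop

lemma exists_primitive_of_order_nonneg {φ : ℂ → ℂ} {c : ℂ} (h : MeromorphicAt φ c)
    (h0 : 0 ≤ meromorphicOrderAt φ c) : ∃ f, IsSchwarzianPrimitiveAt φ f c := by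
  obtain ⟨q, hq, hq0⟩ := exists_expansion_of_order_nonneg h h0
  refine exists_primitive_of_det_eq_zero (a := fun n => taylorCoeff c q (n - 1)) le_rfl hq
    (fun n => rfl) ?_
  -- For d = 1 the matrix has the single entry q(c) = 0.
  simp [coeffMatrix, taylorCoeff_zero, hq0]

end matrix

/-! ### Analytic continuation over simply connected spaces -/

/-- A locally coherent family of holomorphic germs `F x` at `π x`. -/
structure IsContinuation {X : Type*} [TopologicalSpace X] (π : X → ℂ)
    (F : X → ℂ → OnePoint ℂ) : Prop where
  holomorphic : ∀ x, IsHolomorphicAt (F x) (π x)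
  compatible : ∀ x, ∀ᶠ y in 𝓝 x, F y =ᶠ[𝓝 (π y)] F x

section continuation

variable {X Y : Type*} [TopologicalSpace X] [TopologicalSpace Y] {π : X → ℂ}
  {F F' : X → ℂ → OnePoint ℂ} {φ : ℂ → ℂ}

lemma IsContinuation.comp (h : IsContinuation π F) {g : Y → X} (hg : Continuous g) :
    IsContinuation (fun y => π (g y)) (fun y => F (g y)) :=
  ⟨fun y => h.holomorphic (g y), fun y => hg.continuousAt.eventually (h.compatible (g y))⟩

lemma IsContinuation.moebius (h : IsContinuation π F) {γ : Equiv.Perm (OnePoint ℂ)}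
    (hγ : γ ∈ moebiusGroup) : IsContinuation π (fun x z => γ (F x z)) := by
  refine ⟨fun x => (h.holomorphic x).moebius hγ, fun x => ?_⟩
  filter_upwards [h.compatible x] with y hy
  filter_upwards [hy] with z hz
  rw [hz]

lemma isContinuation_const {f : ℂ → OnePoint ℂ} (hf : ∀ x, IsHolomorphicAt f (π x)) :
    IsContinuation π (fun _ => f) :=
  ⟨hf, fun _ => Eventually.of_forall fun _ => EventuallyEq.rfl⟩

lemma IsContinuation.unique [PreconnectedSpace X] (hπ : Continuous π) (h : IsContinuation π F)
    (h' : IsContinuation π F') {x₀ : X} (h0 : F x₀ =ᶠ[𝓝 (π x₀)] F' x₀) (x : X) :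
    F x =ᶠ[𝓝 (π x)] F' x := by
  have key : (Set.univ : Set X) ⊆ {x | F x =ᶠ[𝓝 (π x)] F' x} := by
    refine isPreconnected_univ.subset_of_closure_inter_subset ?_ ⟨x₀, trivial, h0⟩ ?_
    · rw [isOpen_iff_eventually]
      intro y hy
      filter_upwards [h.compatible y, h'.compatible y,
        hπ.continuousAt.eventually hy.eventually_nhds] with w h1 h2 h3
      exact h1.trans (EventuallyEq.trans h3 h2.symm)
    · rintro y ⟨hy, -⟩
      refine (h.holomorphic y).eventuallyEq_of_frequently_eventuallyEq (h'.holomorphic y) ?_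
      have : ∃ᶠ w in 𝓝 y, F y =ᶠ[𝓝 (π w)] F' y :=
        ((mem_closure_iff_frequently.1 hy).and_eventually
          ((h.compatible y).and (h'.compatible y))).mono
          fun w ⟨h1, h2, h3⟩ => h2.symm.trans (EventuallyEq.trans h1 h3)
      exact hπ.continuousAt.tendsto.frequently this
  exact key (Set.mem_univ x)

/-- Being a primitive is open along X. It is also closed: at a limit point a local primitive f
exists, the germ differs from f by a Möbius transformation at a nearby good point, and the identity
theorem carries this to the limit. -/
lemma IsContinuation.isSchwarzianPrimitiveAt [PreconnectedSpace X] (hπ : Continuous π)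
    (h : IsContinuation π F) (hloc : ∀ x, ∃ f, IsSchwarzianPrimitiveAt φ f (π x)) {x₀ : X}
    (h0 : IsSchwarzianPrimitiveAt φ (F x₀) (π x₀)) (x : X) :
    IsSchwarzianPrimitiveAt φ (F x) (π x) := by
  have key : (Set.univ : Set X) ⊆ {x | IsSchwarzianPrimitiveAt φ (F x) (π x)} := by
    refine isPreconnected_univ.subset_of_closure_inter_subset ?_ ⟨x₀, trivial, h0⟩ ?_
    · rw [isOpen_iff_eventually]
      intro y hy
      filter_upwards [h.compatible y, hπ.continuousAt.eventually hy.eventually] with w h1 h2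
      exact h2.congr h1.symm
    · rintro y ⟨hy, -⟩
      obtain ⟨f, hf⟩ := hloc y
      obtain ⟨ε, hε, hb⟩ := Metric.eventually_nhds_iff_ball.1
        ((h.holomorphic y).eventually.and hf.eventually)
      obtain ⟨w, hw1, hw2, hw3⟩ := ((mem_closure_iff_frequently.1 hy).and_eventually
        ((h.compatible y).and (hπ.continuousAt.eventually
          (Metric.ball_mem_nhds (π y) hε)))).exists
      obtain ⟨γ, hγ, hγf⟩ := (hb _ hw3).2.exists_moebius hw1
      have := eventuallyEq_of_isPreconnected (convex_ball (π y) ε).isPreconnected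
        (fun z hz => (hb z hz).1) (fun z hz => (hb z hz).2.1.moebius hγ) hw3
        (hw2.symm.trans hγf) (Metric.mem_ball_self hε)
      exact (hf.moebius hγ).congr this.symm
  exact key (Set.mem_univ x)

omit [TopologicalSpace X] in
-- One γ serves the whole overlap because an intersection of two discs is convex, hence connected.
-- On an empty overlap γ is irrelevant and set to 1.
lemma exists_transition (f : X → ℂ → OnePoint ℂ) (r : X → ℝ)
    (hf : ∀ x, ∀ z ∈ Metric.ball (π x) (r x), IsSchwarzianPrimitiveAt φ (f x) z) (i j : X) :
    ∃ γ : moebiusGroup, ∀ z ∈ Metric.ball (π i) (r i) ∩ Metric.ball (π j) (r j),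
      f i =ᶠ[𝓝 z] fun w => γ.1 (f j w) := by
  by_cases hne : (Metric.ball (π i) (r i) ∩ Metric.ball (π j) (r j)).Nonempty
  · obtain ⟨z₀, hz₀⟩ := hne
    obtain ⟨γ, hγ, hγf⟩ := (hf j z₀ hz₀.2).exists_moebius (hf i z₀ hz₀.1)
    exact ⟨⟨γ, hγ⟩, fun z hz => eventuallyEq_of_isPreconnected
      ((convex_ball (π i) (r i)).inter (convex_ball (π j) (r j))).isPreconnected
      (fun w hw => (hf i w hw.1).1) (fun w hw => (hf j w hw.2).1.moebius hγ) hz₀ hγf hz⟩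
  · exact ⟨1, fun z hz => absurd ⟨z, hz⟩ hne⟩

/-- Analytic continuation over a simply connected space. -/
theorem exists_continuation [SimplyConnectedSpace X] [LocallyPathConnectedSpace X]
    (hπ : Continuous π) (hloc : ∀ x, ∃ f, IsSchwarzianPrimitiveAt φ f (π x)) (x₀ : X)
    {f₀ : ℂ → OnePoint ℂ} (h0 : IsSchwarzianPrimitiveAt φ f₀ (π x₀)) :
    ∃ F : X → ℂ → OnePoint ℂ, IsContinuation π F ∧
      (∀ x, IsSchwarzianPrimitiveAt φ (F x) (π x)) ∧ F x₀ =ᶠ[𝓝 (π x₀)] f₀ := by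
  choose f hf using hloc
  choose r hr hb using fun x => Metric.eventually_nhds_iff_ball.1 (hf x).eventually
  choose c hc using exists_transition (π := π) f r hb
  have hself : ∀ x, π x ∈ Metric.ball (π x) (r x) := fun x => Metric.mem_ball_self (hr x)
  -- The cocycle identity follows from freeness of the Möbius action on nonconstant germs.
  have hcomp : ∀ i j k, ∀ z ∈ Metric.ball (π i) (r i) ∩ Metric.ball (π j) (r j) ∩
      Metric.ball (π k) (r k), c i j * c j k = c i k := by
    rintro i j k z ⟨⟨hi, hj⟩, hk⟩
    refine Subtype.ext (moebius_unique (hb k z hk).1 (hb k z hk).2.1 (c i j * c j k).2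
      (c i k).2 ?_)
    filter_upwards [hc i j z ⟨hi, hj⟩, hc j k z ⟨hj, hk⟩, hc i k z ⟨hi, hk⟩] with w h1 h2 h3
    rw [← h3, h1, h2]; rfl
  have hcself : ∀ i, c i i = 1 := by
    intro i
    have := hcomp i i i (π i) ⟨⟨hself i, hself i⟩, hself i⟩
    simpa using this
  let _ : TopologicalSpace moebiusGroup := ⊥
  have _ : DiscreteTopology moebiusGroup := ⟨rfl⟩
  -- With the discrete topology on the fibre, the bundle with these transition elements is a
  -- covering of X. A section multiplies each local primitive f x by some g x so that the results
  -- agree on overlaps, and over a simply connected base the identity map lifts to such a section.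
  let Z : FiberBundleCore X X moebiusGroup :=
    { baseSet := fun i => π ⁻¹' Metric.ball (π i) (r i)
      isOpen_baseSet := fun i => Metric.isOpen_ball.preimage hπ
      indexAt := id
      mem_baseSet_at := hself
      coordChange := fun i j _ γ => γ * c i j
      coordChange_self := fun i x _ γ => by rw [hcself, mul_one]
      continuousOn_coordChange := fun i j =>
        ((continuous_of_discreteTopology (f := fun γ : moebiusGroup => γ * c i j)).comp
          continuous_snd).continuousOn
      coordChange_comp := fun i j k x hx γ => by
        rw [mul_assoc, hcomp i j k (π x) hx] }
  have hcov : IsCoveringMap Z.proj := FiberBundle.isCoveringMap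
  obtain ⟨γ₀, hγ₀, hγf₀⟩ := (hf x₀).exists_moebius h0
  obtain ⟨L, ⟨hL0, hL⟩, -⟩ := hcov.existsUnique_continuousMap_lifts (ContinuousMap.id X) x₀
    (⟨x₀, ⟨γ₀, hγ₀⟩⟩ : Z.TotalSpace) rfl
  have hL1 : ∀ x, (L x).1 = x := fun x => congrFun hL x
  let g : X → moebiusGroup := fun x => (L x).2
  refine ⟨fun x z => (g x).1 (f x z), ⟨fun x => (hf x).1.moebius (g x).2, fun x => ?_⟩,
    fun x => (hf x).moebius (g x).2, ?_⟩
  · have hcont : ContinuousAt (fun y => (Z.localTriv x (L y)).2) x := by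
      refine continuous_snd.continuousAt.comp (ContinuousAt.comp ?_ L.continuous.continuousAt)
      refine (Z.localTriv x).continuousOn_toFun.continuousAt
        ((Z.localTriv x).open_source.mem_nhds ?_)
      rw [Z.mem_localTriv_source, hL1]
      exact hself x
    have hval : ∀ y, (Z.localTriv x (L y)).2 = g y * c y x := by
      intro y
      rw [Z.localTriv_apply]
      exact congrArg (fun t => g y * c t x) (hL1 y)
    have hloc : ∀ᶠ y in 𝓝 x, g y * c y x = g x := by
      have h1 := hcont.eventually (IsOpen.mem_nhds (isOpen_discrete {(Z.localTriv x (L x)).2}) rfl)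
      filter_upwards [h1] with y hy
      have : (Z.localTriv x (L y)).2 = (Z.localTriv x (L x)).2 := hy
      rwa [hval, hval, hcself, mul_one] at this
    filter_upwards [hloc, (Metric.isOpen_ball.preimage hπ).mem_nhds (hself x)] with y h1 h2
    filter_upwards [hc y x (π y) ⟨hself y, h2⟩] with z hz
    rw [hz, ← h1]; rfl
  · have hg0 : (g x₀).1 = γ₀ := by
      change (Subtype.val (L x₀).2) = γ₀
      rw [hL0]
    change (fun z => (g x₀).1 (f x₀ z)) =ᶠ[𝓝 (π x₀)] f₀
    rw [hg0]
    exact hγf₀.symm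

end continuation

/-! ### Transport along paths, holonomy and a van Kampen argument -/

section path_transport

open scoped unitInterval

instance contractibleSpace_unitInterval : ContractibleSpace I :=
  (convex_Icc (0 : ℝ) 1).contractibleSpace ⟨0, by simp⟩

instance locallyPathConnectedSpace_unitInterval : LocallyPathConnectedSpace I :=
  (convex_Icc (0 : ℝ) 1).locallyPathConnectedSpace

/-- Analytic continuation along some path in `A` from `x` to `y`, with centres read through `k`,
leads from `f` to `g`. -/
def Transport (k : ℂ → ℂ) (A : Set ℂ) (x : ℂ) (f : ℂ → OnePoint ℂ) (y : ℂ)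
    (g : ℂ → OnePoint ℂ) : Prop :=
  ∃ p : Path x y, (∀ t, p t ∈ A) ∧ ∃ F : I → ℂ → OnePoint ℂ,
    IsContinuation (fun t => k (p t)) F ∧ F 0 =ᶠ[𝓝 (k x)] f ∧ F 1 =ᶠ[𝓝 (k y)] g

section transport

variable {k : ℂ → ℂ} {A B : Set ℂ} {x y z : ℂ} {f g h f' g' : ℂ → OnePoint ℂ} {φ : ℂ → ℂ}

lemma Transport.mono (H : Transport k A x f y g) (hAB : A ⊆ B) : Transport k B x f y g := by
  obtain ⟨p, hp, F, hF⟩ := H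
  exact ⟨p, fun t => hAB (hp t), F, hF⟩

lemma Transport.left_mem (H : Transport k A x f y g) : x ∈ A := by
  obtain ⟨p, hp, -⟩ := H
  simpa using hp 0

lemma Transport.right_mem (H : Transport k A x f y g) : y ∈ A := by
  obtain ⟨p, hp, -⟩ := H
  simpa using hp 1

lemma Transport.congr (H : Transport k A x f y g) (hf : f =ᶠ[𝓝 (k x)] f')
    (hg : g =ᶠ[𝓝 (k y)] g') : Transport k A x f' y g' := by
  obtain ⟨p, hp, F, hF, h0, h1⟩ := H
  exact ⟨p, hp, F, hF, h0.trans hf, h1.trans hg⟩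

lemma Transport.moebius (H : Transport k A x f y g) {γ : Equiv.Perm (OnePoint ℂ)}
    (hγ : γ ∈ moebiusGroup) :
    Transport k A x (fun z => γ (f z)) y (fun z => γ (g z)) := by
  obtain ⟨p, hp, F, hF, h0, h1⟩ := H
  refine ⟨p, hp, _, hF.moebius hγ, ?_, ?_⟩
  · filter_upwards [h0] with z hz
    rw [hz]
  · filter_upwards [h1] with z hz
    rw [hz]

/-- A continuation over a path-connected space gives transports along all its paths. -/
lemma IsContinuation.transport {Y : Type*} [TopologicalSpace Y] [PathConnectedSpace Y]
    {j : Y → ℂ} (hj : Continuous j) {F : Y → ℂ → OnePoint ℂ}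
    (hF : IsContinuation (fun y => k (j y)) F) (hA : ∀ y, j y ∈ A) (y y' : Y) :
    Transport k A (j y) (F y) (j y') (F y') := by
  obtain ⟨p⟩ := PathConnectedSpace.joined y y'
  refine ⟨p.map hj, fun t => hA (p t), fun t => F (p t), hF.comp p.continuous, ?_, ?_⟩
  · simp only [Path.source]; exact EventuallyEq.rfl
  · simp only [Path.target]; exact EventuallyEq.rfl

lemma Transport.symm (H : Transport k A x f y g) : Transport k A y g x f := by
  obtain ⟨p, hp, F, hF, h0, h1⟩ := H
  have := (hF.transport p.continuous hp 1 0)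
  simp only [Path.source, Path.target] at this
  exact this.congr h1 h0

lemma Transport.refl (hx : x ∈ A) (hf : IsHolomorphicAt f (k x)) : Transport k A x f x f :=
  ⟨Path.refl x, fun _ => hx, fun _ => f, isContinuation_const fun _ => hf,
    EventuallyEq.rfl, EventuallyEq.rfl⟩

/-- The standing assumption on `k` and `A`: centres move continuously, and Schwarzian primitives
exist locally. -/
structure IsAdmissible (φ k : ℂ → ℂ) (A : Set ℂ) : Prop where
  continuousOn : ContinuousOn k A
  exists_primitive : ∀ x ∈ A, ∃ f, IsSchwarzianPrimitiveAt φ f (k x)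

lemma IsAdmissible.mono (hA : IsAdmissible φ k B) (h : A ⊆ B) : IsAdmissible φ k A :=
  ⟨hA.1.mono h, fun x hx => hA.2 x (h hx)⟩

lemma IsAdmissible.continuous_comp {Y : Type*} [TopologicalSpace Y] (hA : IsAdmissible φ k A)
    {j : Y → ℂ} (hj : Continuous j) (hjA : ∀ y, j y ∈ A) : Continuous fun y => k (j y) :=
  hA.continuousOn.comp_continuous hj hjA

lemma Transport.isSchwarzianPrimitiveAt (hA : IsAdmissible φ k A) (H : Transport k A x f y g)
    (hf : IsSchwarzianPrimitiveAt φ f (k x)) : IsSchwarzianPrimitiveAt φ g (k y) := by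
  obtain ⟨p, hp, F, hF, h0, h1⟩ := H
  have := hF.isSchwarzianPrimitiveAt (φ := φ) (hA.continuous_comp p.continuous hp)
    (fun t => hA.2 _ (hp t)) (x₀ := 0) (by simpa using hf.congr (by simpa using h0.symm)) 1
  simp only [Path.target] at this
  exact this.congr h1

lemma exists_continuation_path (hA : IsAdmissible φ k A) (p : Path x y) (hp : ∀ t, p t ∈ A)
    (hf : IsSchwarzianPrimitiveAt φ f (k x)) :
    ∃ F : I → ℂ → OnePoint ℂ, IsContinuation (fun t => k (p t)) F ∧ F 0 =ᶠ[𝓝 (k x)] f := by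
  obtain ⟨F, hF, -, hF0⟩ := exists_continuation (φ := φ) (hA.continuous_comp p.continuous hp)
    (fun t => hA.2 _ (hp t)) 0 (f₀ := f) (by simpa using hf)
  exact ⟨F, hF, by simpa using hF0⟩

lemma exists_transport (hA : IsAdmissible φ k A) (hxy : JoinedIn A x y)
    (hf : IsSchwarzianPrimitiveAt φ f (k x)) :
    ∃ g, Transport k A x f y g ∧ IsSchwarzianPrimitiveAt φ g (k y) := by
  obtain ⟨p, hp⟩ := hxy
  obtain ⟨F, hF, hF0⟩ := exists_continuation_path hA p hp hf
  have : Transport k A x f y (F 1) := ⟨p, hp, F, hF, hF0, EventuallyEq.rfl⟩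
  exact ⟨F 1, this, this.isSchwarzianPrimitiveAt hA hf⟩

/-- The two given families need not fit together at the junction as functions, only as germs. A
fresh continuation along the concatenated path is therefore built and identified with each family on
its half by uniqueness. -/
lemma Transport.trans (hA : IsAdmissible φ k A) (hf : IsSchwarzianPrimitiveAt φ f (k x))
    (H : Transport k A x f y g) (H' : Transport k A y g z h) : Transport k A x f z h := by
  obtain ⟨p, hp, F, hF, h0, h1⟩ := H
  obtain ⟨p', hp', F', hF', h0', h1'⟩ := H'
  have hq : ∀ t, (p.trans p') t ∈ A := by
    intro t
    rw [Path.trans_apply]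
    split_ifs
    · exact hp _
    · exact hp' _
  obtain ⟨G, hG, hG0⟩ := exists_continuation_path hA (p.trans p') hq hf
  let s₁ : I → I := fun t => ⟨t / 2, by
    have := t.2.1; have := t.2.2; constructor <;> linarith⟩
  let s₂ : I → I := fun t => ⟨(1 + t) / 2, by
    have := t.2.1; have := t.2.2; constructor <;> linarith⟩
  have hs₁ : Continuous s₁ := by fun_prop
  have hs₂ : Continuous s₂ := by fun_prop
  have e₁ : ∀ t, (p.trans p') (s₁ t) = p t := by
    intro t
    rw [Path.trans_apply, dif_pos (by change (t : ℝ) / 2 ≤ 1 / 2; linarith [t.2.2])]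
    congr 1
    ext
    change 2 * ((t : ℝ) / 2) = t
    ring
  have e₂ : ∀ t, (p.trans p') (s₂ t) = p' t := by
    intro t
    rw [Path.trans_apply]
    split_ifs with ht
    · have ht0 : (t : ℝ) = 0 := by
        change (1 + (t : ℝ)) / 2 ≤ 1 / 2 at ht
        linarith [t.2.1]
      have : t = 0 := by ext; exact ht0
      subst this
      rw [p'.source]
      convert p.target
      change 2 * ((1 + (0 : ℝ)) / 2) = 1
      norm_num
    · congr 1
      ext
      change 2 * ((1 + (t : ℝ)) / 2) - 1 = t
      ring
  have hG₁ := hG.comp hs₁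
  have hG₂ := hG.comp hs₂
  simp only [e₁] at hG₁
  simp only [e₂] at hG₂
  have z1 : s₁ 0 = 0 := by ext; change (0 : ℝ) / 2 = 0; norm_num
  have z2 : s₁ 1 = s₂ 0 := by ext; change (1 : ℝ) / 2 = (1 + 0) / 2; norm_num
  have z3 : s₂ 1 = 1 := by ext; change (1 + (1 : ℝ)) / 2 = 1; norm_num
  have u1 := hG₁.unique (hA.continuous_comp p.continuous hp) hF (x₀ := 0)
    (by simpa [z1] using hG0.trans h0.symm) 1
  have u2 := hG₂.unique (hA.continuous_comp p'.continuous hp') hF' (x₀ := 0) (by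
    simp only [Path.target, z2] at u1
    simpa using u1.trans (h1.trans h0'.symm)) 1
  refine ⟨p.trans p', hq, G, hG, hG0, ?_⟩
  simp only [Path.target, z3] at u2
  exact u2.trans h1'

/-- Holonomy group of germs transported along loops in `A`. -/
def hol (k : ℂ → ℂ) (A : Set ℂ) (x : ℂ) (f : ℂ → OnePoint ℂ) : Set (Equiv.Perm (OnePoint ℂ)) :=
  {γ | γ ∈ moebiusGroup ∧ Transport k A x f x (fun z => γ (f z))}

lemma hol_mono (h : A ⊆ B) : hol k A x f ⊆ hol k B x f := fun _ hγ => ⟨hγ.1, hγ.2.mono h⟩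

lemma mul_mem_hol (hA : IsAdmissible φ k A) (hf : IsSchwarzianPrimitiveAt φ f (k x))
    {γ γ' : Equiv.Perm (OnePoint ℂ)} (h : γ ∈ hol k A x f) (h' : γ' ∈ hol k A x f) :
    γ * γ' ∈ hol k A x f :=
  ⟨mul_mem h.1 h'.1, h.2.trans hA hf (h'.2.moebius h.1)⟩

lemma inv_mem_hol {γ : Equiv.Perm (OnePoint ℂ)} (h : γ ∈ hol k A x f) :
    γ⁻¹ ∈ hol k A x f := by
  refine ⟨inv_mem h.1, (h.2.symm.moebius (inv_mem h.1)).congr ?_ EventuallyEq.rfl⟩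
  filter_upwards with z
  exact Equiv.symm_apply_apply γ _

/-- The holonomy group as a subgroup. -/
def holSubgroup (hA : IsAdmissible φ k A) (hx : x ∈ A) (hf : IsSchwarzianPrimitiveAt φ f (k x)) :
    Subgroup (Equiv.Perm (OnePoint ℂ)) where
  carrier := hol k A x f
  mul_mem' := mul_mem_hol hA hf
  one_mem' := ⟨one_mem _, Transport.refl hx hf.1⟩
  inv_mem' := inv_mem_hol

lemma transport_moebius_iff {γ γ' : Equiv.Perm (OnePoint ℂ)} (hγ : γ ∈ moebiusGroup)
    (hγ' : γ' ∈ moebiusGroup)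
    (H : Transport k A x (fun z => γ (f z)) x (fun z => γ' (f z))) : γ⁻¹ * γ' ∈ hol k A x f := by
  refine ⟨mul_mem (inv_mem hγ) hγ', (H.moebius (inv_mem hγ)).congr ?_ EventuallyEq.rfl⟩
  filter_upwards with z
  exact Equiv.symm_apply_apply γ _

lemma hol_eq_of_transport (hA : IsAdmissible φ k A) (hf : IsSchwarzianPrimitiveAt φ f (k x))
    (H : Transport k A x f y g) : hol k A x f = hol k A y g := by
  have key : ∀ {x y f g}, IsSchwarzianPrimitiveAt φ f (k x) → Transport k A x f y g →
      hol k A x f ⊆ hol k A y g := fun {x y f g} hf H γ hγ =>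
    ⟨hγ.1, H.symm.trans hA (H.isSchwarzianPrimitiveAt hA hf)
      (hγ.2.trans hA hf (H.moebius hγ.1))⟩
  exact (key hf H).antisymm (key (H.isSchwarzianPrimitiveAt hA hf) H.symm)

/-- Van Kampen: the holonomy group of a union is generated by the holonomy groups of the parts. -/
lemma hol_subset_closure_iUnion {ι : Type*} (hA : IsAdmissible φ k A) {V : ι → Set ℂ}
    (hV : ∀ i, IsOpen (V i)) (hVA : ∀ i, V i ⊆ A) (hAV : ∀ z ∈ A, ∃ i, z ∈ V i)
    (hjoin : ∀ i j, i ≠ j → ∀ z ∈ V i ∩ V j, JoinedIn (V i ∩ V j) x z)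
    (hf : IsSchwarzianPrimitiveAt φ f (k x)) :
    hol k A x f ⊆ Subgroup.closure (⋃ i, hol k (V i) x f) := by
  set H := Subgroup.closure (⋃ i, hol k (V i) x f) with hH
  have hHm : H ≤ moebiusGroup := (Subgroup.closure_le _).2 fun γ hγ => by
    obtain ⟨i, hi⟩ := Set.mem_iUnion.1 hγ
    exact hi.1
  have hVad : ∀ i, IsAdmissible φ k (V i) := fun i => hA.mono (hVA i)
  have hmemH : ∀ i, ∀ γ ∈ hol k (V i) x f, γ ∈ H := fun i γ hγ =>
    Subgroup.subset_closure (Set.mem_iUnion.2 ⟨i, hγ⟩)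
  -- If z lies in both sets, returning to x inside the intersection closes up a loop in V i. Its
  -- holonomy is in H and is absorbed into η, and the way back to z then runs in V j.
  have switch : ∀ i j z g, z ∈ V j → (∃ η ∈ H, Transport k (V i) x (fun w => η (f w)) z g) →
      ∃ η ∈ H, Transport k (V j) x (fun w => η (f w)) z g := by
    rintro i j z g hzj ⟨η, hη, hT⟩
    by_cases hij : i = j
    · subst hij; exact ⟨η, hη, hT⟩
    have hz : z ∈ V i ∩ V j := ⟨hT.right_mem, hzj⟩
    obtain ⟨g', hT', hg'⟩ := exists_transport ((hVad i).mono Set.inter_subset_left)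
      (hjoin i j hij z hz) hf
    have hηf := hf.moebius (hHm hη)
    obtain ⟨δ, hδ, hδg⟩ := hg'.exists_moebius (hT.isSchwarzianPrimitiveAt (hVad i) hηf)
    have h1 : Transport k (V i) x (fun w => η (f w)) x (fun w => δ (f w)) :=
      (hT.congr EventuallyEq.rfl hδg).trans (hVad i) hηf
        ((hT'.symm.mono Set.inter_subset_left).moebius hδ)
    have h2 := hmemH i _ (transport_moebius_iff (hHm hη) hδ h1)
    have h3 : δ ∈ H := by simpa using mul_mem hη h2
    exact ⟨δ, h3, ((hT'.mono Set.inter_subset_right).moebius hδ).congr EventuallyEq.rfl hδg.symm⟩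
  rintro γ ⟨hγ, p, hp, F, hF, h0, h1⟩
  -- F t is good if, up to an element of H, it is reached from x within one of the sets. The good
  -- times form a nonempty clopen subset of the interval, and goodness at time 1 puts γ in H.
  let good : I → Prop := fun t => ∃ i, ∃ η ∈ H, Transport k (V i) x (fun w => η (f w)) (p t) (F t)
  have hloc : ∀ t, ∃ i, ∀ᶠ s in 𝓝 t, Transport k (V i) (p t) (F t) (p s) (F s) := by
    intro t
    obtain ⟨i, hi⟩ := hAV _ (hp t)
    refine ⟨i, ?_⟩
    have hN : p ⁻¹' V i ∈ 𝓝 t := p.continuous.continuousAt.preimage_mem_nhds ((hV i).mem_nhds hi)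
    obtain ⟨N, ⟨hN1, hN2⟩, hN3⟩ := (path_connected_basis t).mem_iff.1 hN
    filter_upwards [hN1] with s hs
    have : PathConnectedSpace N := isPathConnected_iff_pathConnectedSpace.1 hN2
    exact (hF.comp (continuous_subtype_val (p := (· ∈ N)))).transport
      (p.continuous.comp continuous_subtype_val) (fun y => hN3 y.2)
      ⟨t, mem_of_mem_nhds hN1⟩ ⟨s, hs⟩
  have hclopen : IsClopen {t | good t} := by
    constructor
    · rw [← closure_subset_iff_isClosed]
      intro t ht
      obtain ⟨i, hi⟩ := hloc t
      obtain ⟨s, ⟨j, hj⟩, hs⟩ := ((mem_closure_iff_frequently.1 ht).and_eventually hi).exists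
      obtain ⟨η, hη, hT⟩ := switch j i _ _ hs.right_mem hj
      exact ⟨i, η, hη, hT.trans (hVad i) (hf.moebius (hHm hη)) hs.symm⟩
    · rw [isOpen_iff_eventually]
      rintro t ⟨j, hj⟩
      obtain ⟨i, hi⟩ := hloc t
      filter_upwards [hi] with s hs
      obtain ⟨η, hη, hT⟩ := switch j i _ _ hs.left_mem hj
      exact ⟨i, η, hη, hT.trans (hVad i) (hf.moebius (hHm hη)) hs⟩
  have hx : x ∈ A := by simpa using hp 0
  have hgood0 : good 0 := by
    obtain ⟨i, hi⟩ := hAV x hx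
    refine ⟨i, 1, one_mem _, ?_⟩
    simp only [Path.source]
    exact (Transport.refl hi hf.1).congr EventuallyEq.rfl h0.symm
  have huniv := hclopen.eq_univ ⟨0, hgood0⟩
  obtain ⟨i, η, hη, hT⟩ : good 1 := (Set.ext_iff.1 huniv 1).2 trivial
  simp only [Path.target] at hT
  have h2 := hmemH i _ (transport_moebius_iff (hHm hη) hγ (hT.congr EventuallyEq.rfl h1))
  simpa using mul_mem hη h2

/-- Over a simply connected part of the plane the holonomy is trivial. -/
lemma hol_eq_one {D : Set ℂ} [SimplyConnectedSpace D] (hD : IsOpen D) (hA : IsAdmissible φ k D)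
    (hf : IsSchwarzianPrimitiveAt φ f (k x)) {γ : Equiv.Perm (OnePoint ℂ)}
    (hγ : γ ∈ hol k D x f) : γ = 1 := by
  have := hD.locallyPathConnectedSpace
  obtain ⟨hγ, p, hp, G, hG, h0, h1⟩ := hγ
  have hx : x ∈ D := by simpa using hp 0
  obtain ⟨F, hF, -, hF0⟩ := exists_continuation (φ := φ)
    (hA.continuous_comp (continuous_subtype_val (p := (· ∈ D))) fun y => y.2)
    (fun y => hA.2 _ y.2) ⟨x, hx⟩ hf
  have hFp := hF.comp (g := fun t => ⟨p t, hp t⟩) (p.continuous.subtype_mk hp)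
  have u := hG.unique (hA.continuous_comp p.continuous hp) hFp (x₀ := 0)
    (by simp only [Path.source]; exact h0.trans hF0.symm) 1
  simp only [Path.target] at u
  refine moebius_unique hf.1 hf.2.1 hγ (one_mem _) ?_
  filter_upwards [h1, u, hF0] with z k1 k2 k3
  rw [← k1, k2, k3]; rfl

end transport

end path_transport

/-! ### Connectedness of domains minus finite sets -/

section connectedness

/-- A punctured disc is the image of a half-plane under c + exp. -/
lemma isPreconnected_ball_diff_singleton (c : ℂ) {r : ℝ} (hr : 0 < r) :
    IsPreconnected (Metric.ball c r \ {c}) := by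
  have h : Metric.ball c r \ {c} = (fun w => c + Complex.exp w) '' {w | w.re < Real.log r} := by
    ext z
    constructor
    · rintro ⟨h1, h2⟩
      have hne : z - c ≠ 0 := sub_ne_zero.2 h2
      refine ⟨Complex.log (z - c), ?_, by simp [Complex.exp_log hne]⟩
      rw [Set.mem_ofPred, Complex.log_re]
      rw [Metric.mem_ball, dist_eq_norm] at h1
      exact Real.log_lt_log (norm_pos_iff.2 hne) h1
    · rintro ⟨w, hw, rfl⟩
      rw [Set.mem_ofPred] at hw
      refine ⟨?_, by simp [Complex.exp_ne_zero]⟩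
      rw [Metric.mem_ball, dist_eq_norm, add_sub_cancel_left, Complex.norm_exp]
      exact (Real.lt_log_iff_exp_lt hr).1 hw
  rw [h]
  refine IsPreconnected.image ?_ _ (by fun_prop)
  exact (convex_halfSpace_re_lt (Real.log r)).isPreconnected

/-- Given a separation of V \ {c}, a small punctured disc around c lies in one of the two parts.
Adding the full disc to that part gives a separation of V. -/
lemma isPreconnected_diff_singleton {V : Set ℂ} (hV : IsOpen V) (hc : IsPreconnected V) (c : ℂ) :
    IsPreconnected (V \ {c}) := by
  by_cases hcV : c ∈ V
  swap
  · rwa [Set.sdiff_singleton_eq_self hcV]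
  obtain ⟨r, hr, hrV⟩ := Metric.isOpen_iff.1 hV c hcV
  have hball := isPreconnected_ball_diff_singleton c hr
  have hsub : Metric.ball c r \ {c} ⊆ V \ {c} := fun z hz => ⟨hrV hz.1, hz.2⟩
  rw [isPreconnected_iff_subset_of_disjoint] at hball ⊢
  intro U₁ U₂ hU₁ hU₂ hcov hdis
  have hdis' : Metric.ball c r \ {c} ∩ (U₁ ∩ U₂) = ∅ :=
    Set.subset_empty_iff.1 ((Set.inter_subset_inter_left _ hsub).trans hdis.subset)
  have main : ∀ A B : Set ℂ, IsOpen A → IsOpen B → V \ {c} ⊆ A ∪ B →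
      V \ {c} ∩ (A ∩ B) = ∅ → Metric.ball c r \ {c} ⊆ A → V \ {c} ⊆ A ∨ V \ {c} ⊆ B := by
    intro A B hA hB hcov hdis hbA
    have hB' : IsOpen (B \ {c}) := hB.sdiff isClosed_singleton
    have h := isPreconnected_iff_subset_of_disjoint.1 hc (A ∪ Metric.ball c r) (B \ {c})
      (hA.union Metric.isOpen_ball) hB' ?_ ?_
    · rcases h with h | h
      · left
        rintro z ⟨hz, hzc⟩
        rcases h hz with h | h
        · exact h
        · exact hbA ⟨h, hzc⟩
      · exact absurd rfl (h hcV).2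
    · intro z hz
      by_cases hzc : z = c
      · left; right; rw [hzc]; exact Metric.mem_ball_self hr
      · rcases hcov ⟨hz, hzc⟩ with h | h
        · exact Or.inl (Or.inl h)
        · exact Or.inr ⟨h, hzc⟩
    · rw [Set.eq_empty_iff_forall_notMem]
      rintro z ⟨hz, h1, h2, h3⟩
      have hzA : z ∈ A := by
        rcases h1 with h | h
        · exact h
        · exact hbA ⟨h, h3⟩
      exact Set.eq_empty_iff_forall_notMem.1 hdis z ⟨⟨hz, h3⟩, hzA, h2⟩
  rcases hball U₁ U₂ hU₁ hU₂ (hsub.trans hcov) hdis' with h | h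
  · exact main U₁ U₂ hU₁ hU₂ hcov hdis h
  · exact (main U₂ U₁ hU₂ hU₁ (by rwa [Set.union_comm]) (by rwa [Set.inter_comm U₂]) h).symm

lemma isPreconnected_diff_finite {V Q : Set ℂ} (hV : IsOpen V) (hc : IsPreconnected V)
    (hQ : Q.Finite) : IsPreconnected (V \ Q) := by
  induction Q, hQ using Set.Finite.induction_on with
  | empty => simpa
  | @insert a s _ hs ih =>
    rw [← Set.union_singleton, ← Set.sdiff_sdiff]
    exact isPreconnected_diff_singleton (hV.sdiff hs.isClosed) ih a

lemma nonempty_diff_finite {V Q : Set ℂ} (hV : IsOpen V) (hne : V.Nonempty) (hQ : Q.Finite) :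
    (V \ Q).Nonempty :=
  ((infinite_of_mem_nhds _ (hV.mem_nhds hne.choose_spec)).sdiff hQ).nonempty

lemma isPathConnected_diff_finite {V Q : Set ℂ} (hV : IsOpen V) (hc : IsPreconnected V)
    (hne : V.Nonempty) (hQ : Q.Finite) : IsPathConnected (V \ Q) :=
  ((hV.sdiff hQ.isClosed).isConnected_iff_isPathConnected).1
    ⟨nonempty_diff_finite hV hne hQ, isPreconnected_diff_finite hV hc hQ⟩

end connectedness

/-! ### Translations as parabolic transformations -/

section translation

/-- The translation `x ↦ x + τ` as a permutation of the sphere. -/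
def translationGL (τ : ℂ) : Matrix.GeneralLinearGroup (Fin 2) ℂ :=
  Matrix.GeneralLinearGroup.mkOfDetNeZero !![1, τ; 0, 1] (by simp)

/-- The translation `x ↦ x + τ` as a permutation of the sphere. -/
def translation (τ : ℂ) : Equiv.Perm (OnePoint ℂ) := MulAction.toPermHom _ _ (translationGL τ)

lemma translation_mem (τ : ℂ) : translation τ ∈ moebiusGroup := ⟨_, rfl⟩

lemma translation_coe (τ x : ℂ) : translation τ x = ((x + τ : ℂ) : OnePoint ℂ) := by
  change translationGL τ • (x : OnePoint ℂ) = _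
  rw [smul_some_eq_ite]
  simp [translationGL, Matrix.GeneralLinearGroup.mkOfDetNeZero]

lemma isParabolicMoebius_conj_translation {β : Equiv.Perm (OnePoint ℂ)} (hβ : β ∈ moebiusGroup)
    {τ : ℂ} (hτ : τ ≠ 0) : IsParabolicMoebius (β * translation τ * β⁻¹) := by
  obtain ⟨B, rfl⟩ := hβ
  refine ⟨B * translationGL τ * B⁻¹, ?_, by rw [map_mul, map_mul, map_inv]; rfl⟩
  rw [Matrix.GeneralLinearGroup.isParabolic_conj_iff,
    Matrix.GeneralLinearGroup.isParabolic_iff_of_upperTriangular rfl]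
  exact ⟨rfl, hτ⟩

end translation

/-! ### Continuation of antiderivatives -/

section antiderivative

/-- The germ of `f` at `z` is finite with derivative `e`. -/
def IsAntiderivAt (e : ℂ → ℂ) (f : ℂ → OnePoint ℂ) (z : ℂ) : Prop :=
  ∃ E : ℂ → ℂ, AnalyticAt ℂ E z ∧ (∀ᶠ w in 𝓝 z, HasDerivAt E (e w) w) ∧
    f =ᶠ[𝓝 z] fun w => (E w : OnePoint ℂ)

variable {e : ℂ → ℂ} {f : ℂ → OnePoint ℂ} {z : ℂ}

lemma IsAntiderivAt.congr {f' : ℂ → OnePoint ℂ} (h : IsAntiderivAt e f z) (hf : f =ᶠ[𝓝 z] f') :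
    IsAntiderivAt e f' z := by
  obtain ⟨E, h1, h2, h3⟩ := h
  exact ⟨E, h1, h2, hf.symm.trans h3⟩

lemma IsAntiderivAt.eventually (h : IsAntiderivAt e f z) : ∀ᶠ w in 𝓝 z, IsAntiderivAt e f w := by
  obtain ⟨E, h1, h2, h3⟩ := h
  filter_upwards [h1.eventually_analyticAt, h2.eventually_nhds, h3.eventually_nhds]
    with w k1 k2 k3
  exact ⟨E, k1, k2, k3⟩

lemma exists_antideriv (he : AnalyticAt ℂ e z) : ∃ E : ℂ → ℂ, AnalyticAt ℂ E z ∧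
    ∀ᶠ w in 𝓝 z, HasDerivAt E (e w) w := by
  obtain ⟨r, hr, hb⟩ := Metric.eventually_nhds_iff_ball.1 he.eventually_analyticAt
  obtain ⟨E, hE⟩ := DifferentiableOn.isExactOn_ball (f := e) (c := z) (r := r)
    fun w hw => (hb w hw).differentiableAt.differentiableWithinAt
  refine ⟨E, DifferentiableOn.analyticAt (s := Metric.ball z r)
    (fun y hy => (hE y hy).differentiableAt.differentiableWithinAt)
    (Metric.ball_mem_nhds z hr), ?_⟩
  filter_upwards [Metric.ball_mem_nhds z hr] with w hw
  exact hE w hw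

lemma exists_isAntiderivAt (he : AnalyticAt ℂ e z) : ∃ f, IsAntiderivAt e f z := by
  obtain ⟨E, h1, h2⟩ := exists_antideriv he
  exact ⟨_, E, h1, h2, EventuallyEq.rfl⟩

lemma IsAntiderivAt.holomorphic (h : IsAntiderivAt e f z) : IsHolomorphicAt f z := by
  obtain ⟨E, h1, -, h3⟩ := h
  exact (isHolomorphicAt_coe h1).congr h3.symm

lemma IsAntiderivAt.translation (h : IsAntiderivAt e f z) (τ : ℂ) :
    IsAntiderivAt e (fun w => translation τ (f w)) z := by
  obtain ⟨E, h1, h2, h3⟩ := h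
  refine ⟨fun w => E w + τ, by fun_prop, h2.mono fun w hw => hw.add_const τ, ?_⟩
  filter_upwards [h3] with w hw
  rw [hw, translation_coe]

lemma IsAntiderivAt.exists_translation {f' : ℂ → OnePoint ℂ} (h : IsAntiderivAt e f z)
    (h' : IsAntiderivAt e f' z) :
    ∃ τ, f' =ᶠ[𝓝 z] fun w => SchwarzianPrimitive.translation τ (f w) := by
  obtain ⟨E, h1, h2, h3⟩ := h
  obtain ⟨E', h1', h2', h3'⟩ := h'
  have := eventually_const_of_deriv_eq_zero (h1'.sub h1) (by
    filter_upwards [h2, h2'] with w k1 k2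
    rw [(k2.sub k1).deriv, sub_self])
  refine ⟨E' z - E z, ?_⟩
  filter_upwards [this, h3, h3'] with w k1 k2 k3
  rw [k2, k3, translation_coe]
  simp only [Pi.sub_apply] at k1
  rw [← k1]
  congr 1
  ring

lemma IsContinuation.isAntiderivAt {X : Type*} [TopologicalSpace X] [PreconnectedSpace X]
    {π : X → ℂ} {F : X → ℂ → OnePoint ℂ} (hπ : Continuous π)
    (h : IsContinuation π F) (he : ∀ x, AnalyticAt ℂ e (π x)) {x₀ : X}
    (h0 : IsAntiderivAt e (F x₀) (π x₀)) (x : X) : IsAntiderivAt e (F x) (π x) := by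
  have key : (Set.univ : Set X) ⊆ {x | IsAntiderivAt e (F x) (π x)} := by
    refine isPreconnected_univ.subset_of_closure_inter_subset ?_ ⟨x₀, trivial, h0⟩ ?_
    · rw [isOpen_iff_eventually]
      intro y hy
      filter_upwards [h.compatible y, hπ.continuousAt.eventually hy.eventually] with w h1 h2
      exact h2.congr h1.symm
    · rintro y ⟨hy, -⟩
      obtain ⟨f, hf⟩ := exists_isAntiderivAt (he y)
      obtain ⟨ε, hε, hb⟩ := Metric.eventually_nhds_iff_ball.1
        ((h.holomorphic y).eventually.and hf.eventually)
      obtain ⟨w, hw1, hw2, hw3⟩ := ((mem_closure_iff_frequently.1 hy).and_eventually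
        ((h.compatible y).and (hπ.continuousAt.eventually
          (Metric.ball_mem_nhds (π y) hε)))).exists
      obtain ⟨τ, hτ⟩ := (hb _ hw3).2.exists_translation hw1
      have := eventuallyEq_of_isPreconnected (convex_ball (π y) ε).isPreconnected
        (fun z hz => (hb z hz).1) (fun z hz => ((hb z hz).2.translation τ).holomorphic) hw3
        (hw2.symm.trans hτ) (Metric.mem_ball_self hε)
      exact (hf.translation τ).congr this.symm
  exact key (Set.mem_univ x)

end antiderivative

/-! ### Monodromy around one pole -/

section local_monodromy

variable {φ q : ℂ → ℂ} {c : ℂ} {d : ℕ}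

/-- Near `c` there is a single-valued function `e` on the punctured disc, all of whose
antiderivatives are Schwarzian primitives; `e` is exact up to a multiple of `1 / (z - c)`. -/
lemma exists_density (hd : 1 ≤ d) (hφ : HasExpansion φ c d q) :
    ∃ (e M : ℂ → ℂ) (r : ℂ) (ε : ℝ), 0 < ε ∧
      (∀ z ∈ Metric.ball c ε \ {c}, AnalyticAt ℂ e z) ∧
      (∀ z ∈ Metric.ball c ε \ {c}, ∀ f, IsAntiderivAt e f z → IsSchwarzianPrimitiveAt φ f z) ∧
      (∀ z ∈ Metric.ball c ε \ {c}, HasDerivAt M (e z - r / (z - c)) z) ∧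
      (r = 0 → ∃ w, AnalyticAt ℂ w c ∧ w c ≠ 0 ∧ ∀ᶠ z in 𝓝 c, frobeniusOp c d q w z = 0) := by
  obtain ⟨u, m, r, hu, hu0, hm, hm0, hop, hmu⟩ := exists_log_solution hd hφ.1
  obtain ⟨ε, hε, hb⟩ := Metric.eventually_nhds_iff_ball.1
    (hu.eventually_analyticAt.and ((hu.continuousAt.eventually_ne hu0).and
      (hop.and ((eventually_nhdsWithin_iff.1 hφ.2).and
        (hmu.and hm.eventually_analyticAt)))))
  -- The density for σ = -d. Only σ² enters the Schwarzian, so it belongs to the same φ.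
  set e : ℂ → ℂ := fun z => (z - c) ^ (-(d : ℤ) - 1) / u z ^ 2 with he
  have hea : ∀ z ∈ Metric.ball c ε \ {c}, AnalyticAt ℂ e z := by
    rintro z ⟨hz, hzc⟩
    obtain ⟨k1, k2, -⟩ := hb z hz
    have h1 : AnalyticAt ℂ (fun z : ℂ => (z - c) ^ (-(d : ℤ) - 1)) z :=
      AnalyticAt.zpow (f := fun z => z - c) (by fun_prop) (sub_ne_zero.2 hzc)
    exact h1.div (k1.pow 2) (pow_ne_zero 2 k2)
  have hopen : IsOpen (Metric.ball c ε \ {c}) := Metric.isOpen_ball.sdiff isClosed_singleton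
  have hreg : ∀ z ∈ Metric.ball c ε \ {c}, ∀ f, IsAntiderivAt e f z → IsRegularAt φ f z := by
    rintro z ⟨hz, hzc⟩ f ⟨E, h1, h2, h3⟩
    obtain ⟨k1, k2, k3, k4, -⟩ := hb z hz
    refine ⟨E, h1, h3, ?_, ?_⟩
    · rw [h2.self_of_nhds.deriv]
      exact div_ne_zero (zpow_ne_zero _ (sub_ne_zero.2 hzc)) (pow_ne_zero 2 k2)
    · rw [k4 hzc, schwarzianExpr_of_frobeniusOp (σ := -d) hzc k1 k2 k3 h2]
      push_cast
      rw [neg_sq]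
  refine ⟨e, fun z => (z - c) ^ (-(d : ℤ)) * m z, r, ε, hε, hea, ?_, ?_, ?_⟩
  · intro z hz f hf
    refine isSchwarzianPrimitiveAt_iff.2 ⟨hf.holomorphic, fun hc => ?_, ?_⟩
    · obtain ⟨E, h1, h2, h3⟩ := hf
      have hEc : E =ᶠ[𝓝 z] fun _ => E z := by
        filter_upwards [hc, h3] with w k1 k2
        rw [k2, h3.eq_of_nhds] at k1
        exact OnePoint.coe_injective k1
      have h4 := h2.self_of_nhds.deriv
      rw [hEc.deriv_eq, deriv_const] at h4
      exact div_ne_zero (zpow_ne_zero _ (sub_ne_zero.2 hz.2)) (pow_ne_zero 2 (hb z hz.1).2.1)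
        h4.symm
    · filter_upwards [eventually_nhdsWithin_of_eventually_nhds hf.eventually,
        eventually_nhdsWithin_of_eventually_nhds (hopen.mem_nhds hz)] with w h1 h2
      exact hreg w h2 f h1
  · rintro z ⟨hz, hzc⟩
    obtain ⟨k1, k2, k3, k4, k5, k6⟩ := hb z hz
    have hne : z - c ≠ 0 := sub_ne_zero.2 hzc
    refine ((hasDerivAt_sub_zpow (-(d : ℤ)) hzc).mul
      k6.differentiableAt.hasDerivAt).congr_deriv ?_
    have h5 : deriv m z = (1 / u z ^ 2 - r * (z - c) ^ d + d * m z) / (z - c) := by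
      rw [eq_div_iff hne]; linear_combination k5
    rw [h5, he]
    simp only [zpow_sub_one₀ hne, zpow_neg, zpow_natCast]
    have := pow_ne_zero d hne
    push_cast
    field_simp
    ring
  -- Without the logarithm, m u solves the equation with exponent d by reduction of order.
  · intro hr
    refine ⟨fun z => m z * u z, hm.mul hu, mul_ne_zero hm0 hu0,
      frobeniusOp_mul_eq_zero hu hu0 hm hop ?_⟩
    filter_upwards [hmu] with z hz
    rw [hz, hr]; ring

lemma hol_conj {k : ℂ → ℂ} {A : Set ℂ} {x : ℂ} {f : ℂ → OnePoint ℂ}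
    {β γ : Equiv.Perm (OnePoint ℂ)} (hβ : β ∈ moebiusGroup)
    (h : γ ∈ hol k A x (fun z => β (f z))) : β⁻¹ * (γ * β) ∈ hol k A x f :=
  transport_moebius_iff hβ (mul_mem h.1 hβ) h.2

lemma hol_congr {k : ℂ → ℂ} {A : Set ℂ} {x : ℂ} {f f' : ℂ → OnePoint ℂ}
    (h : f =ᶠ[𝓝 (k x)] f') : hol k A x f ⊆ hol k A x f' := fun γ hγ =>
  ⟨hγ.1, hγ.2.congr h (by filter_upwards [h] with z hz; rw [hz])⟩

/-- Continuing an antiderivative of the single-valued e again gives an antiderivative, so a loop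
acts by a translation. The given germ is β applied to an antiderivative, which conjugates the
translation by β. -/
lemma hol_of_density {e : ℂ → ℂ} {V : Set ℂ} (he : ∀ z ∈ V, AnalyticAt ℂ e z)
    (hprim : ∀ z ∈ V, ∀ f, IsAntiderivAt e f z → IsSchwarzianPrimitiveAt φ f z) {x : ℂ}
    (hx : x ∈ V) {f : ℂ → OnePoint ℂ} (hf : IsSchwarzianPrimitiveAt φ f x)
    {γ : Equiv.Perm (OnePoint ℂ)} (hγ : γ ∈ hol id V x f) : γ = 1 ∨ IsParabolicMoebius γ := by
  obtain ⟨E, hE⟩ := exists_isAntiderivAt (he x hx)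
  have hEp := hprim x hx E hE
  obtain ⟨β, hβ, hβf⟩ := hEp.exists_moebius hf
  have h1 := hol_conj hβ (hol_congr (k := id) hβf hγ)
  obtain ⟨hm, p, hp, F, hF, h0, h1⟩ := h1
  have h2 := hF.isAntiderivAt (e := e) (show Continuous fun t => id (p t) from p.continuous)
    (fun t => he _ (hp t)) (x₀ := 0) (by simpa using hE.congr (by simpa using h0.symm)) 1
  simp only [Path.target, id] at h2
  obtain ⟨τ, hτ⟩ := hE.exists_translation (h2.congr h1)
  have h3 := moebius_unique hEp.1 hEp.2.1 hm (translation_mem τ) hτ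
  have h4 : γ = β * translation τ * β⁻¹ := by rw [← h3]; group
  by_cases hτ0 : τ = 0
  · left
    have : translation τ = 1 := by
      refine moebius_unique hEp.1 hEp.2.1 (translation_mem τ) (one_mem _) ?_
      obtain ⟨E₁, -, -, h5⟩ := hE
      filter_upwards [h5] with w hw
      rw [hw, translation_coe, hτ0, add_zero]; rfl
    rw [h4, this]; group
  · right
    rw [h4]
    exact isParabolicMoebius_conj_translation hβ hτ0

/-- The imaginary part stays below 1 + 1 < π in absolute value, so the principal logarithm does not
jump. This makes the branches used below compatible. -/
lemma log_mul_exp {v : ℂ} {s : ℝ} (hv : v ∈ Metric.ball (0 : ℂ) 1) (hs : |s| < 1) :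
    Complex.log (Complex.exp v * Complex.exp (s * Complex.I)) = v + s * Complex.I := by
  rw [← Complex.exp_add]
  rw [Metric.mem_ball, dist_zero_right] at hv
  have h1 := (abs_le.1 ((Complex.abs_im_le_norm v).trans hv.le))
  have h2 := abs_lt.1 hs
  have hpi := Real.pi_gt_three
  refine Complex.log_exp ?_ ?_ <;> simp <;> linarith

/-- Continuing M + r log(z - c) once around a circle adds 2πi r. Trivial holonomy makes this
translation the identity, so r = 0. -/
lemma residue_eq_zero {e M : ℂ → ℂ} {r : ℂ} {ε : ℝ} (hε : 0 < ε)
    (he : ∀ z ∈ Metric.ball c ε \ {c}, AnalyticAt ℂ e z)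
    (hprim : ∀ z ∈ Metric.ball c ε \ {c}, ∀ f, IsAntiderivAt e f z →
      IsSchwarzianPrimitiveAt φ f z)
    (hM : ∀ z ∈ Metric.ball c ε \ {c}, HasDerivAt M (e z - r / (z - c)) z)
    {x : ℂ} (hx : x ∈ Metric.ball c ε \ {c}) {f : ℂ → OnePoint ℂ}
    (hf : IsSchwarzianPrimitiveAt φ f x) (hol1 : hol id (Metric.ball c ε \ {c}) x f ⊆ {1}) :
    r = 0 := by
  set V := Metric.ball c ε \ {c} with hV
  have hVo : IsOpen V := Metric.isOpen_ball.sdiff isClosed_singleton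
  have hadm : IsAdmissible φ id V := ⟨continuousOn_id, fun z hz => by
    obtain ⟨E, hE⟩ := exists_isAntiderivAt (he z hz)
    exact ⟨E, hprim z hz E hE⟩⟩
  set ρ : ℝ := ε / 2 with hρ
  have hρ0 : 0 < ρ := by positivity
  have hρc : (ρ : ℂ) ≠ 0 := by exact_mod_cast hρ0.ne'
  let j : ℝ → ℂ := fun θ => c + ρ * Complex.exp (θ * Complex.I)
  have hj : Continuous j := by fun_prop
  have hjne : ∀ θ : ℝ, (ρ : ℂ) * Complex.exp (θ * Complex.I) ≠ 0 := fun θ =>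
    mul_ne_zero hρc (Complex.exp_ne_zero _)
  have hjV : ∀ θ, j θ ∈ V := by
    intro θ
    refine ⟨?_, ?_⟩
    · simp only [j, Metric.mem_ball, dist_eq_norm, add_sub_cancel_left, norm_mul,
        Complex.norm_exp_ofReal_mul_I, mul_one, Complex.norm_real, Real.norm_eq_abs]
      rw [abs_of_pos hρ0]; linarith
    · simp only [j, Set.mem_singleton_iff, add_eq_left]
      exact hjne θ
  -- Near j θ the quotient (ζ - c)/(j θ - c) is close to 1, so the principal logarithm applies.
  -- Adding iθ gives a continuous choice of log(ζ - c) up to the constant log ρ.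
  let E : ℝ → ℂ → ℂ := fun θ ζ =>
    M ζ + r * (Complex.log ((ζ - c) / (ρ * Complex.exp (θ * Complex.I))) + θ * Complex.I)
  have hE : ∀ θ, IsAntiderivAt e (fun ζ => (E θ ζ : OnePoint ℂ)) (j θ) := by
    intro θ
    have hslit : ∀ᶠ ζ in 𝓝 (j θ), (ζ - c) / (ρ * Complex.exp (θ * Complex.I)) ∈
        Complex.slitPlane := by
      have hc : ContinuousAt (fun ζ => (ζ - c) / (ρ * Complex.exp (θ * Complex.I))) (j θ) := by
        fun_prop
      refine hc.eventually (Complex.isOpen_slitPlane.mem_nhds ?_)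
      simp [j, hρc]
    have hder : ∀ᶠ ζ in 𝓝 (j θ), HasDerivAt (E θ) (e ζ) ζ := by
      filter_upwards [hslit, hVo.mem_nhds (hjV θ)] with ζ h1 h2
      have h3 := (((hasDerivAt_id ζ).sub_const c).div_const
        (ρ * Complex.exp (θ * Complex.I))).clog h1
      have h4 := (hM ζ h2).add ((h3.add_const (θ * Complex.I)).const_mul r)
      refine h4.congr_deriv ?_
      have h5 : ζ - c ≠ 0 := sub_ne_zero.2 h2.2
      have h6 := hjne θ
      simp only [id]
      field_simp
      ring
    refine ⟨E θ, ?_, hder, EventuallyEq.rfl⟩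
    obtain ⟨δ, hδ, hb⟩ := Metric.eventually_nhds_iff_ball.1 hder
    exact DifferentiableOn.analyticAt (s := Metric.ball (j θ) δ)
      (fun y hy => (hb y hy).differentiableAt.differentiableWithinAt)
      (Metric.ball_mem_nhds _ hδ)
  have hcont : IsContinuation (fun θ => id (j θ)) (fun θ ζ => (E θ ζ : OnePoint ℂ)) := by
    refine ⟨fun θ => (hE θ).holomorphic, fun θ => ?_⟩
    have hnear : ∀ᶠ θ' in 𝓝 θ, |θ' - θ| < 1 := by
      filter_upwards [Metric.ball_mem_nhds θ one_pos] with θ' h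
      rwa [Metric.mem_ball, Real.dist_eq] at h
    filter_upwards [hnear] with θ' h
    have hc : ContinuousAt (fun ζ => Complex.log ((ζ - c) / (ρ * Complex.exp (θ' * Complex.I))))
        (j θ') := by
      refine ContinuousAt.clog (by fun_prop) ?_
      simp [j, hρc]
    have hlog : ∀ᶠ ζ in 𝓝 (j θ'),
        Complex.log ((ζ - c) / (ρ * Complex.exp (θ' * Complex.I))) ∈ Metric.ball (0 : ℂ) 1 := by
      refine hc.eventually (Metric.isOpen_ball.mem_nhds ?_)
      simp [j, hρc]
    filter_upwards [hlog, hVo.mem_nhds (hjV θ')] with ζ h1 h2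
    have h5 : ζ - c ≠ 0 := sub_ne_zero.2 h2.2
    have h6 := log_mul_exp h1 h
    rw [Complex.exp_log (div_ne_zero h5 (hjne θ'))] at h6
    have h7 : (ζ - c) / (ρ * Complex.exp (θ' * Complex.I)) *
        Complex.exp (((θ' - θ : ℝ) : ℂ) * Complex.I) =
        (ζ - c) / (ρ * Complex.exp (θ * Complex.I)) := by
      have : Complex.exp (θ' * Complex.I) =
          Complex.exp (((θ' - θ : ℝ) : ℂ) * Complex.I) * Complex.exp (θ * Complex.I) := by
        rw [← Complex.exp_add]; congr 1; push_cast; ring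
      rw [this]
      have h8 := Complex.exp_ne_zero (((θ' - θ : ℝ) : ℂ) * Complex.I)
      have h9 := Complex.exp_ne_zero ((θ : ℂ) * Complex.I)
      field_simp
    rw [h7] at h6
    simp only [E]
    rw [h6]
    congr 2
    push_cast
    ring
  have hT := hcont.transport (A := V) hj hjV 0 (2 * Real.pi)
  have hj2 : j (2 * Real.pi) = j 0 := by
    simp [j, Complex.exp_two_pi_mul_I]
  rw [hj2] at hT
  have hE2 : (fun ζ => (E (2 * Real.pi) ζ : OnePoint ℂ)) =
      fun ζ => translation (r * (2 * Real.pi * Complex.I)) (E 0 ζ : OnePoint ℂ) := by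
    funext ζ
    rw [translation_coe]
    simp only [E]
    congr 1
    push_cast
    rw [Complex.exp_two_pi_mul_I, zero_mul, Complex.exp_zero]
    ring
  rw [hE2] at hT
  have hmem : translation (r * (2 * Real.pi * Complex.I)) ∈
      hol id V (j 0) (fun ζ => (E 0 ζ : OnePoint ℂ)) := ⟨translation_mem _, hT⟩
  have hpc : IsPathConnected V := isPathConnected_diff_finite Metric.isOpen_ball
    (convex_ball c ε).isPreconnected ⟨c, Metric.mem_ball_self hε⟩ (Set.finite_singleton c)
  obtain ⟨g, hTg, hg⟩ := exists_transport hadm (hpc.joinedIn x hx (j 0) (hjV 0)) hf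
  rw [hol_eq_of_transport hadm hf hTg] at hol1
  obtain ⟨β, hβ, hβf⟩ := hg.exists_moebius (hprim _ (hjV 0) _ (hE 0))
  have h1 := hol1 (hol_conj hβ (hol_congr (k := id) hβf hmem))
  rw [Set.mem_singleton_iff, inv_mul_eq_one] at h1
  have h2 : translation (r * (2 * Real.pi * Complex.I)) = 1 := by
    exact mul_eq_right.1 h1.symm
  have h3 := congrArg (fun γ : Equiv.Perm (OnePoint ℂ) => γ ((0 : ℂ) : OnePoint ℂ)) h2
  simp only [translation_coe, zero_add, Equiv.Perm.one_apply] at h3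
  have h4 := OnePoint.coe_injective h3
  have hpi : (2 * Real.pi * Complex.I : ℂ) ≠ 0 := Complex.two_pi_I_ne_zero
  simpa [hpi, Real.pi_ne_zero, Complex.I_ne_zero] using h4

end local_monodromy

/-! ### Holonomy of a punctured convex domain -/

section puncture

/-- The preimage of `D` under `w ↦ q + exp w`. -/
def logDomain (q : ℂ) (D : Set ℂ) : Set ℂ := {w | q + Complex.exp w ∈ D}

variable {q : ℂ} {D : Set ℂ}

lemma isOpen_logDomain (hD : IsOpen D) : IsOpen (logDomain q D) :=
  hD.preimage (by fun_prop)

lemma exp_sub_ofReal (w : ℂ) (s : ℝ) :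
    Complex.exp (w - s) = (Real.exp (-s)) • Complex.exp w := by
  rw [sub_eq_add_neg, Complex.exp_add, Complex.real_smul, mul_comm]
  push_cast
  rfl

/-- Moving w to the left moves q + exp w along the segment towards q, which stays in the convex set
D. -/
lemma sub_ofReal_mem_logDomain (hD : Convex ℝ D) (hq : q ∈ D) {w : ℂ} (hw : w ∈ logDomain q D)
    {s : ℝ} (hs : 0 ≤ s) : w - s ∈ logDomain q D := by
  have h := hD.add_smul_sub_mem hq hw
    (t := Real.exp (-s)) ⟨(Real.exp_pos _).le, by rw [Real.exp_le_one_iff]; linarith⟩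
  rw [add_sub_cancel_left] at h
  change q + Complex.exp (w - s) ∈ D
  rwa [exp_sub_ofReal]

/-- The half plane `re w ≤ R`. -/
def leftHalfPlane (R : ℝ) : Set ℂ := {w | w.re ≤ R}

lemma convex_leftHalfPlane (R : ℝ) : Convex ℝ (leftHalfPlane R) :=
  convex_halfSpace_re_le R

lemma exists_leftHalfPlane_subset {W : Set ℂ} (hW : W ∈ 𝓝 q) :
    ∃ R, leftHalfPlane R ⊆ logDomain q W := by
  obtain ⟨ε, hε, hb⟩ := Metric.mem_nhds_iff.1 hW
  refine ⟨Real.log (ε / 2), fun w hw => hb ?_⟩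
  rw [Metric.mem_ball, dist_eq_norm, add_sub_cancel_left, Complex.norm_exp]
  calc Real.exp w.re ≤ Real.exp (Real.log (ε / 2)) := Real.exp_le_exp.2 hw
    _ = ε / 2 := Real.exp_log (by positivity)
    _ < ε := by linarith

/-- Sliding every point to the left by max(0, re w - R) deforms the domain into a half-plane re w ≤
R, which is convex. -/
lemma contractibleSpace_logDomain (hDo : IsOpen D) (hD : Convex ℝ D) (hq : q ∈ D) :
    ContractibleSpace (logDomain q D) := by
  obtain ⟨R, hR⟩ := exists_leftHalfPlane_subset (hDo.mem_nhds hq)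
  have hcH : ContractibleSpace (leftHalfPlane R) :=
    (convex_leftHalfPlane R).contractibleSpace ⟨R, by simp [leftHalfPlane]⟩
  rw [contractible_iff_id_nullhomotopic]
  let s : ℂ → ℝ := fun w => max 0 (w.re - R)
  have hs : Continuous s := by fun_prop
  let r : C(logDomain q D, leftHalfPlane R) :=
    ⟨fun w => ⟨w - s w, by
      change ((w : ℂ) - (s w : ℂ)).re ≤ R
      have := le_max_right 0 ((w : ℂ).re - R)
      simp only [Complex.sub_re, Complex.ofReal_re, s]
      linarith⟩, by fun_prop⟩
  let ι : C(leftHalfPlane R, logDomain q D) :=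
    ⟨fun w => ⟨w, hR w.2⟩, by fun_prop⟩
  have hnull : (ι.comp ((ContinuousMap.id _).comp r)).Nullhomotopic :=
    ((id_nullhomotopic (leftHalfPlane R)).comp_left r).comp_right ι
  obtain ⟨y, hy⟩ := hnull
  refine ⟨y, ContinuousMap.Homotopic.trans ⟨?_⟩ hy⟩
  refine ⟨⟨fun p => ⟨p.2 - ((p.1 : ℝ) * s p.2 : ℝ),
    sub_ofReal_mem_logDomain hD hq p.2.2 (mul_nonneg p.1.2.1 (le_max_left _ _))⟩, ?_⟩, ?_, ?_⟩
  · fun_prop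
  · intro w
    simp
  · intro w
    simp [ι, r]

/-- The translation by `2 π i n` of the logarithmic domain. -/
def deck (n : ℤ) (w : logDomain q D) : logDomain q D :=
  ⟨w + n * (2 * Real.pi * Complex.I), by
    change q + Complex.exp _ ∈ D
    rw [Complex.exp_periodic.int_mul n]
    exact w.2⟩

lemma continuous_deck (n : ℤ) : Continuous (deck (q := q) (D := D) n) := by
  unfold deck; fun_prop

lemma exp_deck (n : ℤ) (w : logDomain q D) :
    Complex.exp (deck n w : ℂ) = Complex.exp (w : ℂ) :=
  Complex.exp_periodic.int_mul n _

lemma deck_deck (m n : ℤ) (w : logDomain q D) : deck m (deck n w) = deck (n + m) w := by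
  ext
  simp only [deck]
  push_cast
  ring

variable {φ k : ℂ → ℂ} {x : ℂ} {f : ℂ → OnePoint ℂ}

lemma add_exp_mem_diff {w : ℂ} (hw : w ∈ logDomain q D) : q + Complex.exp w ∈ D \ {q} :=
  ⟨hw, by simp [Complex.exp_ne_zero]⟩

lemma deck_zero (w : logDomain q D) : deck 0 w = w := by
  ext; simp [deck]

lemma continuation_deck {F : logDomain q D → ℂ → OnePoint ℂ} {γ : Equiv.Perm (OnePoint ℂ)}
    (h : ∀ w : logDomain q D, F (deck 1 w) =ᶠ[𝓝 (k (q + Complex.exp (w : ℂ)))]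
      fun z => γ (F w z)) (n : ℤ) (w : logDomain q D) :
    F (deck n w) =ᶠ[𝓝 (k (q + Complex.exp (w : ℂ)))] fun z => (γ ^ n) (F w z) := by
  induction n generalizing w with
  | zero =>
    rw [deck_zero]
    exact EventuallyEq.rfl
  | succ n ih =>
    have h1 := h (deck n w)
    rw [exp_deck, deck_deck] at h1
    filter_upwards [h1, ih w] with z k1 k2
    rw [k1, k2, add_comm, zpow_add, zpow_one]
    rfl
  | pred n ih =>
    have h1 := h (deck (-n - 1) w)
    rw [exp_deck, deck_deck, sub_add_cancel] at h1
    filter_upwards [h1, ih w] with z k1 k2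
    rw [k1] at k2
    have e : γ ^ (-(n : ℤ) - 1) = γ⁻¹ * γ ^ (-(n : ℤ)) := by
      rw [sub_eq_neg_add, zpow_add, zpow_neg_one]
    rw [e, Equiv.Perm.mul_apply, ← k2]
    exact (Equiv.symm_apply_apply γ _).symm

lemma exists_log_lift (p : Path x x) (hp : ∀ t, p t ∈ D \ {q}) {w₀ : ℂ}
    (hw₀ : q + Complex.exp w₀ = x) : ∃ c : C(unitInterval, ℂ), c 0 = w₀ ∧
      ∀ t, q + Complex.exp (c t) = p t := by
  obtain ⟨c, ⟨hc0, hc⟩, -⟩ := Complex.isCoveringMapOn_exp.existsUnique_continuousMap_lifts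
    (A := unitInterval) (f := ⟨fun t => p t - q, by fun_prop⟩) (a₀ := 0) (e₀ := w₀) (by
      simp [← hw₀]) (fun t => by
      simpa [sub_eq_zero] using (hp t).2)
  refine ⟨c, hc0, fun t => ?_⟩
  have := congrFun hc t
  simp only [Function.comp_apply, ContinuousMap.coe_mk] at this
  rw [this]; ring

/-- The holonomy of a punctured convex domain is cyclic. -/
theorem exists_hol_eq_zpowers (hDo : IsOpen D) (hD : Convex ℝ D) (hq : q ∈ D)
    (hA : IsAdmissible φ k (D \ {q})) (hx : x ∈ D \ {q}) (hf : IsSchwarzianPrimitiveAt φ f (k x)) :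
    ∃ γ : Equiv.Perm (OnePoint ℂ), hol k (D \ {q}) x f = (Subgroup.zpowers γ : Set _) ∧
      ∀ W ∈ 𝓝 q, W ⊆ D → ∃ y ∈ W \ {q}, ∃ g, IsSchwarzianPrimitiveAt φ g (k y) ∧
        γ ∈ hol k (W \ {q}) y g := by
  have hcontr := contractibleSpace_logDomain hDo hD hq
  have hlpc := (isOpen_logDomain (q := q) hDo).locallyPathConnectedSpace
  let j : logDomain q D → ℂ := fun w => q + Complex.exp (w : ℂ)
  have hj : Continuous j := by fun_prop
  have hjA : ∀ w, j w ∈ D \ {q} := fun w => add_exp_mem_diff w.2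
  have hπ : Continuous fun w => k (j w) := hA.continuous_comp hj hjA
  have hloc := fun w => hA.2 _ (hjA w)
  have hw₀ : q + Complex.exp (Complex.log (x - q)) = x := by
    rw [Complex.exp_log (sub_ne_zero.2 hx.2)]; ring
  let w₀ : logDomain q D := ⟨Complex.log (x - q), by
    change q + Complex.exp _ ∈ D
    rw [hw₀]; exact hx.1⟩
  have hjw₀ : j w₀ = x := hw₀
  obtain ⟨F, hF, hFp, hF0⟩ := exists_continuation (φ := φ) hπ hloc w₀
    (f₀ := f) (by rwa [hjw₀])
  have hjdeck : ∀ n w, j (deck n w) = j w := fun n w => by simp only [j, exp_deck]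
  have hFT : IsContinuation (fun w => k (j w)) (fun w => F (deck 1 w)) := by
    have := hF.comp (continuous_deck 1)
    simpa only [hjdeck] using this
  -- γ compares the continuation on the logarithmic cover with its shift by 2πi. By uniqueness the
  -- same γ works at every point of the cover.
  obtain ⟨γ, hγ, hγF⟩ := (hFp w₀).exists_moebius
    (by simpa only [hjdeck] using hFp (deck 1 w₀))
  have hone := hFT.unique hπ (hF.moebius hγ) hγF
  have hall := continuation_deck (k := k) hone
  -- A left half-plane is invariant under the shift by 2πi, so the path from w to its shift can be
  -- kept over any given neighbourhood of q.
  have hmem : ∀ W : Set ℂ, ∀ R, (hR : leftHalfPlane R ⊆ logDomain q W) → W ⊆ D →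
      ∀ w : logDomain q D, (w : ℂ) ∈ leftHalfPlane R → γ ∈ hol k (W \ {q}) (j w) (F w) := by
    intro W R hR hWD w hw
    refine ⟨hγ, ?_⟩
    have : PathConnectedSpace (leftHalfPlane R) := isPathConnected_iff_pathConnectedSpace.1
      ((convex_leftHalfPlane R).isPathConnected ⟨w, hw⟩)
    let i : leftHalfPlane R → logDomain q D := fun w => ⟨w, hWD (hR w.2)⟩
    have hi : Continuous i := by fun_prop
    have hw1 : (deck 1 w : ℂ) ∈ leftHalfPlane R := by
      have h1 : (w : ℂ).re ≤ R := hw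
      change (deck 1 w : ℂ).re ≤ R
      simpa [deck] using h1
    have H := (hF.comp hi).transport (k := k) (A := W \ {q}) (hj.comp hi)
      (fun v => add_exp_mem_diff (hR v.2)) ⟨w, hw⟩ ⟨_, hw1⟩
    have e1 : i ⟨w, hw⟩ = w := rfl
    have e2 : i ⟨_, hw1⟩ = deck 1 w := rfl
    simp only [Function.comp_apply, e1, e2, hjdeck] at H
    exact H.congr EventuallyEq.rfl (hone w)
  refine ⟨γ, Set.Subset.antisymm ?_ ?_, ?_⟩
  -- A loop lifts through the exponential to a path ending at the shift of w₀ by 2πi n, which gives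
  -- the holonomy γ ^ n.
  · rintro γ' ⟨hγ', p, hp, G, hG, h0, h1⟩
    obtain ⟨c, hc0, hc⟩ := exists_log_lift p hp hw₀
    let C : unitInterval → logDomain q D := fun t => ⟨c t, by
      change q + Complex.exp _ ∈ D
      rw [hc]; exact (hp t).1⟩
    have hC : Continuous C := by fun_prop
    have hjC : ∀ t, j (C t) = p t := hc
    have hFC := hF.comp hC
    simp only [hjC] at hFC
    have hC0 : C 0 = w₀ := Subtype.ext hc0
    have u := hG.unique (hA.continuous_comp p.continuous hp) hFC (x₀ := 0)
      (by
        rw [hC0]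
        simp only [Path.source]
        rw [hjw₀] at hF0
        exact h0.trans hF0.symm) 1
    simp only [Path.target] at u
    have hexp : Complex.exp (c 1) = Complex.exp w₀ := by
      have h2 := hc 1
      rw [Path.target, ← hw₀] at h2
      exact add_left_cancel h2
    obtain ⟨n, hn⟩ := Complex.exp_eq_exp_iff_exists_int.1 hexp
    have hC1 : C 1 = deck n w₀ := Subtype.ext hn
    rw [hC1] at u
    have h3 := hall n w₀
    change F (deck n w₀) =ᶠ[𝓝 (k (j w₀))] _ at h3
    rw [hjw₀] at h3 hF0
    refine ⟨n, (moebius_unique hf.1 hf.2.1 hγ' (zpow_mem hγ n) ?_).symm⟩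
    filter_upwards [h1, u, h3, hF0] with z k1 k2 k3 k4
    rw [← k1, k2, k3, k4]
  · have h1 : γ ∈ hol k (D \ {q}) x f := by
      obtain ⟨R, hR⟩ := exists_leftHalfPlane_subset (hDo.mem_nhds hq)
      have : PathConnectedSpace (logDomain q D) := inferInstance
      have H := hF.transport (k := k) hj hjA w₀ (deck 1 w₀)
      rw [hjdeck] at H
      rw [hjw₀] at H hF0
      have h2 := hone w₀
      rw [hjw₀] at h2
      refine ⟨hγ, H.congr hF0 (h2.trans ?_)⟩
      filter_upwards [hF0] with z hz
      rw [hz]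
    exact (Subgroup.zpowers_le (H := holSubgroup hA hx hf)).2 h1
  · intro W hW hWD
    obtain ⟨R, hR⟩ := exists_leftHalfPlane_subset hW
    have hRm : (R : ℂ) ∈ leftHalfPlane R := by simp [leftHalfPlane]
    let w : logDomain q D := ⟨R, hWD (hR hRm)⟩
    exact ⟨j w, add_exp_mem_diff (hR hRm), F w, hFp w, hmem W R hR hWD w hRm⟩

end puncture

/-! ### Finitely many parabolic generators by cutting a convex domain -/

section generators

variable {φ k : ℂ → ℂ} {x : ℂ} {f : ℂ → OnePoint ℂ}

/-- Every germ of Schwarzian primitives near `q` has trivial or parabolic monodromy around `q`. -/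
def HasParabolicMonodromy (φ k : ℂ → ℂ) (q : ℂ) : Prop :=
  ∃ W ∈ 𝓝 q, ∀ y ∈ W \ {q}, ∀ g, IsSchwarzianPrimitiveAt φ g (k y) →
    ∀ γ ∈ hol k (W \ {q}) y g, γ = 1 ∨ IsParabolicMoebius γ

/-- The generator of the cyclic holonomy is also realised inside the small neighbourhood on which
monodromy is known to be trivial or parabolic. -/
lemma exists_generators_of_singleton {D : Set ℂ} {q : ℂ} (hDo : IsOpen D) (hD : Convex ℝ D)
    (hq : q ∈ D) (hA : IsAdmissible φ k (D \ {q})) (hpar : HasParabolicMonodromy φ k q)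
    (hx : x ∈ D \ {q}) (hf : IsSchwarzianPrimitiveAt φ f (k x)) :
    ∃ S : Set (Equiv.Perm (OnePoint ℂ)), S.Finite ∧ (∀ γ ∈ S, IsParabolicMoebius γ) ∧
      hol k (D \ {q}) x f = (Subgroup.closure S : Set _) := by
  obtain ⟨γ, hγ, hγW⟩ := exists_hol_eq_zpowers hDo hD hq hA hx hf
  obtain ⟨W, hW, hWp⟩ := hpar
  obtain ⟨y, hy, g, hg, hgγ⟩ := hγW (W ∩ D) (inter_mem hW (hDo.mem_nhds hq))
    Set.inter_subset_right
  rcases hWp y ⟨hy.1.1, hy.2⟩ g hg γ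
    (hol_mono (Set.sdiff_subset_sdiff_left Set.inter_subset_left) hgγ) with rfl | hp
  · exact ⟨∅, Set.finite_empty, by simp, by simp [hγ]⟩
  · exact ⟨{γ}, Set.finite_singleton _, by simpa using hp, by
      rw [hγ, Subgroup.zpowers_eq_closure]⟩

/-- On a convex domain minus finitely many points, the holonomy group is generated by finitely
many parabolic transformations if the monodromy around each of these points is parabolic. -/
theorem exists_generators {Q : Set ℂ} (hQ : Q.Finite) (n : ℕ) :
    ∀ {D : Set ℂ}, IsOpen D → Convex ℝ D → (Q ∩ D).ncard = n → IsAdmissible φ k (D \ Q) →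
      (∀ q ∈ Q ∩ D, HasParabolicMonodromy φ k q) →
      ∀ {x f}, x ∈ D \ Q → IsSchwarzianPrimitiveAt φ f (k x) →
      ∃ S : Set (Equiv.Perm (OnePoint ℂ)), S.Finite ∧ (∀ γ ∈ S, IsParabolicMoebius γ) ∧
        hol k (D \ Q) x f = (Subgroup.closure S : Set _) := by
  induction n using Nat.strong_induction_on with
  | _ n ih =>
  intro D hDo hD hn hA hpar x f hx hf
  have hfin : (Q ∩ D).Finite := hQ.inter_of_left D
  have hDQ : D \ Q = D \ (Q ∩ D) := by
    ext z; simp only [Set.mem_sdiff, Set.mem_inter_iff]; tauto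
  rcases (Q ∩ D).eq_empty_or_nonempty with h0 | ⟨q₁, hq₁⟩
  · rw [hDQ, h0, Set.sdiff_empty] at hA ⊢
    have := hD.contractibleSpace ⟨x, hx.1⟩
    refine ⟨∅, Set.finite_empty, by simp, Set.Subset.antisymm ?_ ?_⟩
    · intro γ hγ
      simp [hol_eq_one hDo hA hf hγ]
    · rw [Subgroup.closure_empty]
      rintro γ hγ
      rw [Subgroup.coe_bot, Set.mem_singleton_iff] at hγ
      rw [hγ]
      exact (holSubgroup hA hx.1 hf).one_mem
  by_cases h1 : Q ∩ D = {q₁}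
  · rw [hDQ, h1] at hA hx ⊢
    exact exists_generators_of_singleton hDo hD hq₁.2 hA (hpar q₁ hq₁) hx hf
  obtain ⟨q₂, hq₂, hne⟩ : ∃ q₂ ∈ Q ∩ D, q₂ ≠ q₁ := by
    by_contra! hcon
    exact h1 (Set.eq_singleton_iff_unique_mem.2 ⟨hq₁, hcon⟩)
  let L : ℂ →L[ℝ] ℝ := innerSL ℝ (q₂ - q₁)
  have hL : L q₁ < L q₂ := by
    have : 0 < L q₂ - L q₁ := by
      rw [← map_sub]
      simp only [L, innerSL_apply_apply, real_inner_self_eq_norm_sq]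
      have := norm_pos_iff.2 (sub_ne_zero.2 hne)
      positivity
    linarith
  -- Two overlapping convex pieces covering D: one omits q₂ and the other omits q₁, so each contains
  -- fewer punctures.
  let V : Bool → Set ℂ := fun b => bif b then D ∩ {z | L z < L q₂} else D ∩ {z | L q₁ < L z}
  have hVo : ∀ b, IsOpen (V b) := by
    rintro (_ | _)
    · exact hDo.inter (isOpen_lt continuous_const L.continuous)
    · exact hDo.inter (isOpen_lt L.continuous continuous_const)
  have hVc : ∀ b, Convex ℝ (V b) := by
    rintro (_ | _)
    · exact hD.inter (convex_halfSpace_gt L.isLinear _)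
    · exact hD.inter (convex_halfSpace_lt L.isLinear _)
  have hVD : ∀ b, V b ⊆ D := by
    rintro (_ | _) <;> exact Set.inter_subset_left
  have hVlt : ∀ b, (Q ∩ V b).ncard < n := by
    intro b
    rw [← hn]
    refine Set.ncard_lt_ncard ?_ hfin
    refine (Set.ssubset_iff_of_subset (Set.inter_subset_inter_right _ (hVD b))).2 ?_
    rcases b with _ | _
    · exact ⟨q₁, hq₁, fun h => lt_irrefl (L q₁) h.2.2⟩
    · exact ⟨q₂, hq₂, fun h => lt_irrefl (L q₂) h.2.2⟩
  have hinter : (V true ∩ V false).Nonempty := by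
    refine ⟨midpoint ℝ q₁ q₂, ?_⟩
    have h2 : midpoint ℝ q₁ q₂ ∈ D := hD.midpoint_mem hq₁.2 hq₂.2
    have h3 : L (midpoint ℝ q₁ q₂) = (L q₁ + L q₂) / 2 := by
      rw [midpoint_eq_smul_add, _root_.map_smul, map_add, smul_eq_mul, invOf_eq_inv]; ring
    refine ⟨⟨h2, ?_⟩, ⟨h2, ?_⟩⟩
    · change L _ < L q₂
      rw [h3]; linarith
    · change L q₁ < L _
      rw [h3]; linarith
  have hpc : IsPathConnected ((V true ∩ V false) \ Q) :=
    isPathConnected_diff_finite ((hVo _).inter (hVo _))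
      ((hVc _).inter (hVc _)).isPreconnected hinter hQ
  obtain ⟨y, hy⟩ := hpc.nonempty
  have hyV : ∀ b, y ∈ V b \ Q := by
    rintro (_ | _)
    exacts [⟨hy.1.2, hy.2⟩, ⟨hy.1.1, hy.2⟩]
  have hpcD : IsPathConnected (D \ Q) :=
    isPathConnected_diff_finite hDo hD.isPreconnected ⟨x, hx.1⟩ hQ
  obtain ⟨g, hg, hgp⟩ := exists_transport hA (hpcD.joinedIn x hx y ⟨hVD _ hy.1.1, hy.2⟩) hf
  have hVA : ∀ b, V b \ Q ⊆ D \ Q := fun b => Set.sdiff_subset_sdiff_left (hVD b)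
  choose S hSf hSp hS using fun b => ih _ (hVlt b) (hVo b) (hVc b) rfl (hA.mono (hVA b))
    (fun q hq => hpar q ⟨hq.1, hVD b hq.2⟩) (hyV b) hgp
  refine ⟨⋃ b, S b, Set.finite_iUnion hSf, ?_, ?_⟩
  · intro γ hγ
    obtain ⟨b, hb⟩ := Set.mem_iUnion.1 hγ
    exact hSp b γ hb
  rw [hol_eq_of_transport hA hf hg]
  refine Set.Subset.antisymm ?_ ?_
  · refine (hol_subset_closure_iUnion hA (V := fun b => V b \ Q)
      (fun b => (hVo b).sdiff hQ.isClosed) hVA ?_ ?_ hgp).trans ?_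
    · rintro z ⟨hz, hzQ⟩
      rcases lt_or_ge (L z) (L q₂) with h | h
      · exact ⟨true, ⟨hz, h⟩, hzQ⟩
      · exact ⟨false, ⟨hz, hL.trans_le h⟩, hzQ⟩
    · have hset : (V true \ Q) ∩ (V false \ Q) = (V true ∩ V false) \ Q := by
        ext z; simp only [Set.mem_sdiff, Set.mem_inter_iff]; tauto
      rintro (_ | _) (_ | _) hb z hz
      · exact absurd rfl hb
      · rw [Set.inter_comm, hset] at hz ⊢
        exact hpc.joinedIn _ hy _ hz
      · rw [hset] at hz ⊢
        exact hpc.joinedIn _ hy _ hz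
      · exact absurd rfl hb
    · refine (Subgroup.closure_le _).2 (Set.iUnion_subset fun b => ?_)
      rw [hS b]
      exact Subgroup.closure_mono (Set.subset_iUnion S b)
  · refine (Subgroup.closure_le (holSubgroup hA ⟨hVD _ hy.1.1, hy.2⟩ hgp)).2
      (Set.iUnion_subset fun b => ?_)
    refine Subgroup.subset_closure.trans ?_
    rw [← hS b]
    exact hol_mono (hVA b)

end generators

/-! ### Disc embeddings and Koebe's square root trick -/

section riemann_mapping

open Metric ComplexConjugate

/-- The automorphism `z ↦ (z - w) / (1 - conj w * z)` of the unit disc. -/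
def discAut (w z : ℂ) : ℂ := (z - w) / (1 - conj w * z)

variable {w z : ℂ}

lemma one_sub_conj_mul_ne_zero (hw : ‖w‖ < 1) (hz : ‖z‖ < 1) : 1 - conj w * z ≠ 0 := by
  intro h
  have h1 : ‖conj w * z‖ = 1 := by rw [← sub_eq_zero.1 h, norm_one]
  rw [norm_mul, Complex.norm_conj] at h1
  nlinarith [norm_nonneg w, norm_nonneg z]

lemma one_sub_norm_discAut_sq (hw : ‖w‖ < 1) (hz : ‖z‖ < 1) :
    (1 - ‖discAut w z‖ ^ 2) * ‖1 - conj w * z‖ ^ 2 = (1 - ‖w‖ ^ 2) * (1 - ‖z‖ ^ 2) := by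
  have h0 : ‖1 - conj w * z‖ ^ 2 ≠ 0 :=
    pow_ne_zero _ (norm_ne_zero_iff.2 (one_sub_conj_mul_ne_zero hw hz))
  rw [discAut, norm_div, div_pow, sub_mul, div_mul_cancel₀ _ h0, one_mul]
  simp only [Complex.sq_norm, Complex.normSq_apply, Complex.sub_re, Complex.sub_im,
    Complex.mul_re, Complex.mul_im, Complex.conj_re, Complex.conj_im, Complex.one_re,
    Complex.one_im]
  ring

lemma norm_discAut_lt_one (hw : ‖w‖ < 1) (hz : ‖z‖ < 1) : ‖discAut w z‖ < 1 := by
  have h := one_sub_norm_discAut_sq hw hz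
  have h0 : 0 < ‖1 - conj w * z‖ ^ 2 :=
    pow_pos (norm_pos_iff.2 (one_sub_conj_mul_ne_zero hw hz)) _
  have h1 : 0 < (1 - ‖w‖ ^ 2) * (1 - ‖z‖ ^ 2) := by
    apply mul_pos <;> nlinarith [norm_nonneg w, norm_nonneg z]
  rw [← h] at h1
  have h2 := (mul_pos_iff_of_pos_right h0).1 h1
  nlinarith [norm_nonneg (discAut w z)]

lemma discAut_injOn (hw : ‖w‖ < 1) : Set.InjOn (discAut w) (ball 0 1) := by
  intro x hx y hy h
  rw [mem_ball_zero_iff] at hx hy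
  have h1 := one_sub_conj_mul_ne_zero hw hx
  have h2 := one_sub_conj_mul_ne_zero hw hy
  have h3 := one_sub_conj_mul_ne_zero hw hw
  rw [discAut, discAut, div_eq_div_iff h1 h2] at h
  refine mul_right_cancel₀ h3 ?_
  linear_combination h

lemma discAut_eq_zero (hw : ‖w‖ < 1) (hz : ‖z‖ < 1) : discAut w z = 0 ↔ z = w := by
  rw [discAut, div_eq_zero_iff, sub_eq_zero, or_iff_left (one_sub_conj_mul_ne_zero hw hz)]

lemma hasDerivAt_discAut (hw : ‖w‖ < 1) (hz : ‖z‖ < 1) :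
    HasDerivAt (discAut w) ((1 - ‖w‖ ^ 2) / (1 - conj w * z) ^ 2) z := by
  have h0 := one_sub_conj_mul_ne_zero hw hz
  have h := ((hasDerivAt_id z).sub_const w).div
    (((hasDerivAt_id z).const_mul (conj w)).const_sub 1) h0
  refine h.congr_deriv ?_
  simp only [id]
  congr 1
  rw [← Complex.mul_conj']
  ring

/-- The difference quotient of s is that of g divided by s y + s z, which tends to 2 s z ≠ 0. -/
lemma hasDerivAt_of_sq {s g : ℂ → ℂ} {g' : ℂ} (hs : ContinuousAt s z)
    (hsg : ∀ z, s z ^ 2 = g z) (h0 : s z ≠ 0) (hg : HasDerivAt g g' z) :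
    HasDerivAt s (g' / (2 * s z)) z := by
  rw [hasDerivAt_iff_tendsto_slope] at hg ⊢
  have hsum : Tendsto (fun y => s y + s z) (𝓝[≠] z) (𝓝 (2 * s z)) := by
    have := hs.tendsto.add_const (s z)
    rw [← two_mul] at this
    exact this.mono_left nhdsWithin_le_nhds
  have h2 : 2 * s z ≠ 0 := mul_ne_zero two_ne_zero h0
  refine (hg.div hsum h2).congr' ?_
  filter_upwards [hsum.eventually_ne h2] with y hy
  rw [Pi.div_apply, slope_def_field, slope_def_field, ← hsg, ← hsg]
  rw [show s y ^ 2 - s z ^ 2 = (s y - s z) * (s y + s z) by ring, div_div,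
    mul_div_mul_right _ _ hy]

/-- The injective holomorphic maps from `U` to the unit disc. -/
structure IsDiscEmbedding (U : Set ℂ) (f : ℂ → ℂ) : Prop where
  differentiableOn : DifferentiableOn ℂ f U
  mapsTo : Set.MapsTo f U (ball 0 1)
  injOn : Set.InjOn f U

variable {U : Set ℂ} {f : ℂ → ℂ}

lemma isOpen_image_of_injOn (hU : IsOpen U) (hUc : IsPreconnected U)
    (hf : DifferentiableOn ℂ f U) (hinj : Set.InjOn f U) {s : Set ℂ} (hs : IsOpen s)
    (hsU : s ⊆ U) : IsOpen (f '' s) := by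
  rcases s.eq_empty_or_nonempty with rfl | ⟨z, hz⟩
  · simp
  refine ((hf.analyticOnNhd hU).is_constant_or_isOpen hUc).resolve_left ?_ s hsU hs
  rintro ⟨c, hc⟩
  obtain ⟨y, hy, hne⟩ : ∃ y ∈ U, y ≠ z := by
    have := (infinite_of_mem_nhds z (hU.mem_nhds (hsU hz))).sdiff (Set.finite_singleton z)
    obtain ⟨y, hy⟩ := this.nonempty
    exact ⟨y, hy.1, hy.2⟩
  exact hne (hinj hy (hsU hz) (by rw [hc y hy, hc z (hsU hz)]))

/-- A square root s of z - a is injective and never takes both a value and its negative on U. Its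
image contains a disc around s z₀, hence misses the opposite disc, and inversion in the centre of
the latter maps U into the unit disc. -/
lemma exists_isDiscEmbedding (hU : IsOpen U) (hUsc : IsSimplyConnected U) (hne : U ≠ Set.univ) :
    ∃ f, IsDiscEmbedding U f ∧ ∀ z ∈ U, deriv f z ≠ 0 := by
  obtain ⟨a, ha⟩ := (Set.ne_univ_iff_exists_notMem U).1 hne
  have hUc := hUsc.isPathConnected.isConnected.isPreconnected
  obtain ⟨s, hsc, hs⟩ := Complex.exists_continuousOn_pow_eq hUsc hU (g := fun z => z - a)
    (by fun_prop) (by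
      rintro ⟨z, hz, h⟩
      exact ha (by rwa [← sub_eq_zero.1 h])) two_ne_zero
  have hs0 : ∀ z ∈ U, s z ≠ 0 := fun z hz h => ha (by
    have := hs z
    rw [h, zero_pow two_ne_zero] at this
    rwa [← sub_eq_zero.1 this.symm])
  have hinj : Function.Injective s := fun x y h => by
    have h1 := hs x
    rw [h, hs y] at h1
    exact (sub_left_injective h1).symm
  have hsd : ∀ z ∈ U, HasDerivAt s (1 / (2 * s z)) z := fun z hz =>
    hasDerivAt_of_sq (hsc.continuousAt (hU.mem_nhds hz)) hs (hs0 z hz)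
      ((hasDerivAt_id z).sub_const a)
  have hsdiff : DifferentiableOn ℂ s U := fun z hz =>
    (hsd z hz).differentiableAt.differentiableWithinAt
  obtain ⟨z₀, hz₀⟩ := hUsc.nonempty
  have hopen := isOpen_image_of_injOn hU hUc hsdiff hinj.injOn hU subset_rfl
  obtain ⟨ε, hε, hb⟩ := Metric.isOpen_iff.1 hopen (s z₀) ⟨z₀, hz₀, rfl⟩
  have hfar : ∀ z ∈ U, ε ≤ ‖s z + s z₀‖ := by
    intro z hz
    by_contra! hlt
    obtain ⟨y, hy, hyz⟩ := hb (show -s z ∈ ball (s z₀) ε by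
      rw [mem_ball, dist_eq_norm, ← norm_neg]; simpa [add_comm] using hlt)
    have h1 : y = z := by
      have h2 := hs y
      rw [hyz, neg_sq, hs z] at h2
      exact (sub_left_injective h2).symm
    rw [h1] at hyz
    exact hs0 z hz (by linear_combination hyz / 2)
  have hne : ∀ z ∈ U, s z + s z₀ ≠ 0 := fun z hz => norm_pos_iff.1 (hε.trans_le (hfar z hz))
  have hF : ∀ z ∈ U, HasDerivAt (fun z => (ε / 2 : ℂ) / (s z + s z₀))
      (-((ε / 2 : ℂ) * (1 / (2 * s z))) / (s z + s z₀) ^ 2) z := by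
    intro z hz
    refine ((hasDerivAt_const z (ε / 2 : ℂ)).div ((hsd z hz).add_const (s z₀))
      (hne z hz)).congr_deriv ?_
    rw [zero_mul, zero_sub]
  have hεc : (ε : ℂ) ≠ 0 := by exact_mod_cast hε.ne'
  refine ⟨fun z => (ε / 2 : ℂ) / (s z + s z₀), ⟨fun z hz =>
    (hF z hz).differentiableAt.differentiableWithinAt, fun z hz => ?_, fun x hx y hy h => ?_⟩,
    fun z hz => ?_⟩
  · rw [mem_ball_zero_iff, norm_div, div_lt_one (norm_pos_iff.2 (hne z hz))]
    refine lt_of_lt_of_le ?_ (hfar z hz)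
    simp [abs_of_pos hε, hε]
  · have h1 : s x + s z₀ = s y + s z₀ := by
      have h2 := hne x hx
      have h3 := hne y hy
      rw [div_eq_div_iff h2 h3] at h
      exact (mul_left_cancel₀ (div_ne_zero hεc two_ne_zero) h).symm
    exact hinj (add_right_cancel h1)
  · rw [(hF z hz).deriv]
    have h1 := hne z hz
    have h2 := hs0 z hz
    simp [h1, h2, hεc]

/-- Koebe's square root trick. -/
lemma IsDiscEmbedding.exists_larger_deriv (hU : IsOpen U) (hUsc : IsSimplyConnected U)
    (hf : IsDiscEmbedding U f) {z₀ : ℂ} (hz₀ : z₀ ∈ U) (h0 : deriv f z₀ ≠ 0) (hw : ‖w‖ < 1)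
    (hwf : w ∉ f '' U) : ∃ F, IsDiscEmbedding U F ∧ ‖deriv f z₀‖ < ‖deriv F z₀‖ := by
  have hfn : ∀ z ∈ U, ‖f z‖ < 1 := fun z hz => mem_ball_zero_iff.1 (hf.mapsTo hz)
  let g : ℂ → ℂ := fun z => discAut w (f z)
  have hfd : ∀ z ∈ U, HasDerivAt f (deriv f z) z := fun z hz =>
    (hf.differentiableOn.differentiableAt (hU.mem_nhds hz)).hasDerivAt
  have hgd : ∀ z ∈ U, HasDerivAt g ((1 - ‖w‖ ^ 2) / (1 - conj w * f z) ^ 2 * deriv f z) z :=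
    fun z hz => (hasDerivAt_discAut hw (hfn z hz)).comp z (hfd z hz)
  have hg1 : ∀ z ∈ U, ‖g z‖ < 1 := fun z hz => norm_discAut_lt_one hw (hfn z hz)
  have hg0 : ∀ z ∈ U, g z ≠ 0 := fun z hz h =>
    hwf ⟨z, hz, (discAut_eq_zero hw (hfn z hz)).1 h⟩
  obtain ⟨s, hsc, hs⟩ := Complex.exists_continuousOn_pow_eq hUsc hU (g := g)
    (fun z hz => (hgd z hz).continuousAt.continuousWithinAt)
    (by rintro ⟨z, hz, h⟩; exact hg0 z hz h) two_ne_zero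
  have hs0 : ∀ z ∈ U, s z ≠ 0 := fun z hz h => hg0 z hz (by rw [← hs, h]; simp)
  have hs1 : ∀ z ∈ U, ‖s z‖ < 1 := fun z hz => by
    have := hg1 z hz
    rw [← hs, norm_pow] at this
    nlinarith [norm_nonneg (s z)]
  have hsd : ∀ z ∈ U, HasDerivAt s _ z := fun z hz =>
    hasDerivAt_of_sq (hsc.continuousAt (hU.mem_nhds hz)) hs (hs0 z hz) (hgd z hz)
  have hFd : ∀ z ∈ U, HasDerivAt (fun z => discAut (s z₀) (s z)) _ z := fun z hz =>
    (hasDerivAt_discAut (hs1 z₀ hz₀) (hs1 z hz)).comp z (hsd z hz)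
  refine ⟨_, ⟨fun z hz => (hFd z hz).differentiableAt.differentiableWithinAt, fun z hz => ?_,
    fun x hx y hy h => ?_⟩, ?_⟩
  · exact mem_ball_zero_iff.2 (norm_discAut_lt_one (hs1 z₀ hz₀) (hs1 z hz))
  · have h1 := discAut_injOn (hs1 z₀ hz₀) (mem_ball_zero_iff.2 (hs1 x hx))
      (mem_ball_zero_iff.2 (hs1 y hy)) h
    have h2 : g x = g y := by rw [← hs, ← hs, h1]
    exact hf.injOn hx hy (discAut_injOn hw (hf.mapsTo hx) (hf.mapsTo hy) h2)
  · rw [(hFd z₀ hz₀).deriv]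
    have hσ := hs1 z₀ hz₀
    have hσ0 := norm_pos_iff.2 (hs0 z₀ hz₀)
    have hf1 := hfn z₀ hz₀
    have key := one_sub_norm_discAut_sq hw hf1
    have hgs : ‖discAut w (f z₀)‖ = ‖s z₀‖ ^ 2 := by rw [← norm_pow, hs]
    rw [hgs] at key
    have hN : 0 < ‖1 - conj w * f z₀‖ :=
      norm_pos_iff.2 (one_sub_conj_mul_ne_zero hw hf1)
    have e1 : (1 - (‖w‖ : ℂ) ^ 2) = ((1 - ‖w‖ ^ 2 : ℝ) : ℂ) := by push_cast; rfl
    have e2 : (1 - (‖s z₀‖ : ℂ) ^ 2) = ((1 - ‖s z₀‖ ^ 2 : ℝ) : ℂ) := by push_cast; rfl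
    have e3 : 1 - conj (s z₀) * s z₀ = ((1 - ‖s z₀‖ ^ 2 : ℝ) : ℂ) := by
      rw [Complex.conj_mul']; push_cast; rfl
    have hw2 : 0 ≤ 1 - ‖w‖ ^ 2 := by nlinarith [norm_nonneg w]
    have hs2 : 0 < 1 - ‖s z₀‖ ^ 2 := by nlinarith
    rw [e3, e2, e1]
    simp only [norm_mul, norm_div, norm_pow, Complex.norm_real, Real.norm_eq_abs,
      abs_of_nonneg hw2, abs_of_pos hs2, Complex.norm_ofNat]
    set σ := ‖s z₀‖
    set N := ‖1 - conj w * f z₀‖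
    have hD : 0 < ‖deriv f z₀‖ := norm_pos_iff.2 h0
    -- By `key`, (1 - σ⁴) N² = (1 - |w|²)(1 - |f z₀|²) ≤ 1 - |w|². No normalisation f z₀ = 0 is
    -- needed.
    have hge : (1 - (σ ^ 2) ^ 2) ≤ (1 - ‖w‖ ^ 2) / N ^ 2 := by
      rw [le_div_iff₀ (by positivity), key]
      nlinarith [norm_nonneg (f z₀), mul_nonneg hw2 (sq_nonneg ‖f z₀‖)]
    -- The difference of the two sides is (1 - σ²)(1 - σ)².
    have hlt : 2 * σ * (1 - σ ^ 2) < 1 - (σ ^ 2) ^ 2 := by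
      nlinarith [mul_pos hs2 (sq_pos_of_pos (sub_pos.2 hσ))]
    have h3 : 1 < (1 - ‖w‖ ^ 2) / N ^ 2 / (2 * σ * (1 - σ ^ 2)) := by
      rw [one_lt_div (by positivity)]
      exact hlt.trans_le hge
    calc ‖deriv f z₀‖ < (1 - ‖w‖ ^ 2) / N ^ 2 / (2 * σ * (1 - σ ^ 2)) * ‖deriv f z₀‖ :=
          lt_mul_of_one_lt_left hD h3
      _ = _ := by field_simp

end riemann_mapping

/-! ### Normal families, Hurwitz's theorem and the Riemann map -/

section riemann_mapping_limit

open Metric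

variable {U : Set ℂ} {f : ℂ → ℂ}

/-- The Schwarz lemma gives a Lipschitz constant independent of f, hence equicontinuity of the whole
family. -/
lemma IsDiscEmbedding.dist_le (hf : IsDiscEmbedding U f) {x y : ℂ} {R : ℝ} (hR : ball x R ⊆ U)
    (hy : y ∈ ball x R) : dist (f y) (f x) ≤ 2 / R * dist y x := by
  have hx : x ∈ ball x R := mem_ball_self (dist_nonneg.trans_lt hy)
  refine Complex.dist_le_div_mul_dist_of_mapsTo_ball (hf.differentiableOn.mono hR)
    (fun z hz => ?_) hy
  have h1 := mem_ball_zero_iff.1 (hf.mapsTo (hR hz))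
  have h2 := mem_ball_zero_iff.1 (hf.mapsTo (hR hx))
  rw [mem_closedBall, dist_eq_norm]
  exact (norm_sub_le _ _).trans (by linarith)

/-- Along an ultrafilter every sequence in the compact disc converges, so no diagonal subsequence is
needed. The common Lipschitz bound makes the pointwise limit locally uniform. -/
lemma exists_tendstoLocallyUniformlyOn (hU : IsOpen U) {F : ℕ → ℂ → ℂ}
    (hF : ∀ n, IsDiscEmbedding U (F n)) :
    ∃ g, TendstoLocallyUniformlyOn F g (hyperfilter ℕ : Filter ℕ) U := by
  have hlim : ∀ z, ∃ x, z ∈ U → Tendsto (fun n => F n z) (hyperfilter ℕ) (𝓝 x) := by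
    intro z
    by_cases hz : z ∈ U
    · obtain ⟨x, -, hx⟩ := (isCompact_closedBall (0 : ℂ) 1).ultrafilter_le_nhds
        ((hyperfilter ℕ).map (fun n => F n z)) (by
          rw [Ultrafilter.coe_map, le_principal_iff, mem_map]
          exact univ_mem' fun n => ball_subset_closedBall ((hF n).mapsTo hz))
      exact ⟨x, fun _ => hx⟩
    · exact ⟨0, fun h => absurd h hz⟩
  choose g hg using hlim
  refine ⟨g, Metric.tendstoLocallyUniformlyOn_iff.2 fun ε hε x hx => ?_⟩
  obtain ⟨R, hR, hb⟩ := Metric.isOpen_iff.1 hU x hx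
  have hgl : ∀ y ∈ ball x R, dist (g y) (g x) ≤ 2 / R * dist y x := fun y hy =>
    le_of_tendsto ((hg y (hb hy)).dist (hg x hx))
      (Eventually.of_forall fun n => (hF n).dist_le hb hy)
  have hδ : 0 < min R (ε * R / 6) := lt_min hR (by positivity)
  refine ⟨_, mem_nhdsWithin_of_mem_nhds (ball_mem_nhds x hδ), ?_⟩
  filter_upwards [(hg x hx).eventually (ball_mem_nhds (g x) (show 0 < ε / 3 by positivity))]
    with n hn y hy
  have hyR : y ∈ ball x R := ball_subset_ball (min_le_left _ _) hy
  have h1 := hgl y hyR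
  have h2 := (hF n).dist_le hb hyR
  have h3 : 2 / R * dist y x < ε / 3 := by
    have h4 : dist y x < ε * R / 6 := (mem_ball.1 hy).trans_le (min_le_right _ _)
    calc 2 / R * dist y x < 2 / R * (ε * R / 6) := by gcongr
      _ = ε / 3 := by field_simp; norm_num
  have h5 := dist_triangle4 (g y) (g x) (F n x) (F n y)
  rw [dist_comm (g x), dist_comm (F n x) (F n y)] at h5
  linarith

/-- Hurwitz: a nonconstant locally uniform limit of injective holomorphic maps is injective. -/
lemma injOn_of_tendstoLocallyUniformlyOn {ι : Type*} {l : Filter ι} [l.NeBot] (hU : IsOpen U)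
    (hUc : IsPreconnected U) {F : ι → ℂ → ℂ} {g : ℂ → ℂ}
    (hF : ∀ n, DifferentiableOn ℂ (F n) U) (hinj : ∀ n, Set.InjOn (F n) U)
    (hg : TendstoLocallyUniformlyOn F g l U) {z₀ : ℂ} (hz₀ : z₀ ∈ U) (h0 : deriv g z₀ ≠ 0) :
    Set.InjOn g U := by
  intro a ha b hb hab
  by_contra hne
  have hgd := hg.differentiableOn (Eventually.of_forall hF) hU
  have hga := hgd.analyticOnNhd hU
  have hnc : ¬ ∀ᶠ z in 𝓝 a, g z = g a := by
    intro h
    have h1 := hga.eqOn_of_preconnected_of_eventuallyEq analyticOnNhd_const hUc ha h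
    refine h0 ?_
    have h2 : g =ᶠ[𝓝 z₀] fun _ => g a := h1.eventuallyEq_of_mem (hU.mem_nhds hz₀)
    rw [h2.deriv_eq, deriv_const]
  have h1 := ((hga a ha).eventually_eq_or_eventually_ne analyticAt_const).resolve_left hnc
  have h2 : ∀ᶠ z in 𝓝 a, z ∈ U ∧ z ≠ b ∧ (z ∈ ({a} : Set ℂ)ᶜ → g z ≠ g a) :=
    (hU.eventually_mem ha).and ((eventually_ne_nhds hne).and (eventually_nhdsWithin_iff.1 h1))
  obtain ⟨ρ, hρ, hball⟩ := Metric.nhds_basis_closedBall.mem_iff.1 h2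
  have hsub : closedBall a ρ ⊆ U := fun z hz => (hball hz).1
  have hsph : sphere a ρ ⊆ U := sphere_subset_closedBall.trans hsub
  obtain ⟨x, hx, hmin⟩ := (isCompact_sphere a ρ).exists_isMinOn
    (NormedSpace.sphere_nonempty.2 hρ.le)
    (f := fun z => ‖g z - g a‖) ((hgd.continuousOn.mono hsph).sub continuousOn_const).norm
  set δ := ‖g x - g a‖ with hδ
  have hδ0 : 0 < δ := norm_sub_pos_iff.2
    ((hball (sphere_subset_closedBall hx)).2.2 (ne_of_mem_sphere hx hρ.ne'))
  have hunif : TendstoUniformlyOn F g l (closedBall a ρ) :=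
    (tendstoLocallyUniformlyOn_iff_forall_isCompact hU).1 hg _ hsub (isCompact_closedBall a ρ)
  have hb' := hg.tendsto_at hb
  obtain ⟨n, hn, hnb⟩ := ((Metric.tendstoUniformlyOn_iff.1 hunif (δ / 16) (by positivity)).and
    (hb'.eventually (ball_mem_nhds (g b) (show 0 < δ / 16 by positivity)))).exists
  have hna := hn a (mem_closedBall_self hρ.le)
  have hlow : ∀ z ∈ sphere a ρ, δ / 2 ≤ ‖F n z - F n a‖ := by
    intro z hz
    have k1 : δ ≤ ‖g z - g a‖ := hmin hz
    have k2 := hn z (sphere_subset_closedBall hz)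
    rw [← dist_eq_norm] at k1 ⊢
    have k3 := dist_triangle4 (g z) (F n z) (F n a) (g a)
    rw [dist_comm (F n a) (g a)] at k3
    linarith
  have hfreq : ∃ᶠ z in 𝓝 a, F n z ≠ F n a := by
    rw [← not_eventually]
    intro h
    have h3 : ∀ᶠ z in 𝓝[≠] a, False := by
      filter_upwards [nhdsWithin_le_nhds h, nhdsWithin_le_nhds (hU.mem_nhds ha),
        self_mem_nhdsWithin] with z k1 k2 k3
      exact k3 (hinj n k2 ha k1)
    exact h3.exists.choose_spec
  -- As F n stays δ/2 away from F n a on the circle, its image of the closed disc contains the ball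
  -- of radius δ/4 around F n a. Since g a = g b, the value F n b lies there, although the disc
  -- avoids b.
  have himage := DiffContOnCl.ball_subset_image_closedBall (f := F n) (z₀ := a) (r := ρ)
    (((hF n).mono hsub).diffContOnCl_ball subset_rfl) hρ hlow hfreq
  obtain ⟨z, hz, hzb⟩ := himage (show F n b ∈ ball (F n a) (δ / 2 / 2) by
    rw [mem_ball]
    have k3 := dist_triangle (F n b) (g b) (F n a)
    rw [← hab] at k3 hnb
    linarith)
  exact (hball hz).2.1 (hinj n (hsub hz) hb hzb)

/-- The Riemann mapping theorem. -/
theorem exists_isDiscEmbedding_surjOn (hU : IsOpen U) (hUsc : IsSimplyConnected U)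
    (hne : U ≠ Set.univ) : ∃ f, IsDiscEmbedding U f ∧ f '' U = ball 0 1 := by
  have hUc := hUsc.isPathConnected.isConnected.isPreconnected
  obtain ⟨z₀, hz₀⟩ := hUsc.nonempty
  obtain ⟨f₀, hf₀, hf₀d⟩ := exists_isDiscEmbedding hU hUsc hne
  obtain ⟨R, hR, hRU⟩ := Metric.isOpen_iff.1 hU z₀ hz₀
  -- The Riemann map is a maximiser of |f'(z₀)| over all disc embeddings. If it omitted a value of
  -- the disc, Koebe's trick would enlarge the derivative.
  let S : Set ℝ := {t | ∃ f, IsDiscEmbedding U f ∧ ‖deriv f z₀‖ = t}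
  have hS : S.Nonempty := ⟨_, f₀, hf₀, rfl⟩
  have hSb : BddAbove S := by
    refine ⟨2 / R, ?_⟩
    rintro _ ⟨f, hf, rfl⟩
    refine Complex.norm_deriv_le_div_of_mapsTo_ball (hf.differentiableOn.mono hRU)
      (fun z hz => ?_) hR
    have h1 := mem_ball_zero_iff.1 (hf.mapsTo (hRU hz))
    have h2 := mem_ball_zero_iff.1 (hf.mapsTo hz₀)
    rw [mem_closedBall, dist_eq_norm]
    exact (norm_sub_le _ _).trans (by linarith)
  obtain ⟨u, -, hu, huS⟩ := exists_seq_tendsto_sSup hS hSb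
  choose F hF hFu using huS
  obtain ⟨g, hg⟩ := exists_tendstoLocallyUniformlyOn hU hF
  have hgd := hg.differentiableOn (Eventually.of_forall fun n => (hF n).differentiableOn) hU
  have hder : ‖deriv g z₀‖ = sSup S := by
    have h1 := (hg.deriv (Eventually.of_forall fun n => (hF n).differentiableOn) hU).tendsto_at
      hz₀
    have h2 : Tendsto u (hyperfilter ℕ) (𝓝 (sSup S)) :=
      hu.mono_left (by rw [← Nat.cofinite_eq_atTop]; exact hyperfilter_le_cofinite)
    refine tendsto_nhds_unique h1.norm ?_
    simpa only [Function.comp_apply, hFu] using h2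
  have hpos : deriv g z₀ ≠ 0 := by
    rw [← norm_pos_iff, hder]
    exact (norm_pos_iff.2 (hf₀d z₀ hz₀)).trans_le (le_csSup hSb ⟨f₀, hf₀, rfl⟩)
  have hginj := injOn_of_tendstoLocallyUniformlyOn hU hUc
    (fun n => (hF n).differentiableOn) (fun n => (hF n).injOn) hg hz₀ hpos
  have hcl : Set.MapsTo g U (closedBall 0 1) := fun z hz =>
    isClosed_closedBall.mem_of_tendsto (hg.tendsto_at hz)
      (Eventually.of_forall fun n => ball_subset_closedBall ((hF n).mapsTo hz))
  have hopen := isOpen_image_of_injOn hU hUc hgd hginj hU subset_rfl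
  -- The limit a priori maps into the closed disc, but its image is open.
  have hmaps : Set.MapsTo g U (ball 0 1) := by
    intro z hz
    rw [← interior_closedBall (0 : ℂ) one_ne_zero]
    exact interior_maximal hcl.image_subset hopen ⟨z, hz, rfl⟩
  have hgE : IsDiscEmbedding U g := ⟨hgd, hmaps, hginj⟩
  refine ⟨g, hgE, hmaps.image_subset.antisymm fun w hw => ?_⟩
  by_contra hwg
  obtain ⟨G, hG, hlt⟩ := hgE.exists_larger_deriv hU hUsc hz₀ hpos (mem_ball_zero_iff.1 hw) hwg
  rw [hder] at hlt
  exact absurd (le_csSup hSb ⟨G, hG, rfl⟩) (not_le.2 hlt)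

/-- A simply connected plane domain is homeomorphic to a convex one. -/
theorem exists_convex_model (hU : IsOpen U) (hUsc : IsSimplyConnected U) :
    ∃ (D : Set ℂ) (h k : ℂ → ℂ), IsOpen D ∧ Convex ℝ D ∧ ContinuousOn h U ∧ ContinuousOn k D ∧
      Set.MapsTo h U D ∧ Set.MapsTo k D U ∧ (∀ z ∈ U, k (h z) = z) ∧ ∀ w ∈ D, h (k w) = w := by
  by_cases hne : U = Set.univ
  · subst hne
    exact ⟨Set.univ, id, id, isOpen_univ, convex_univ, continuousOn_id, continuousOn_id,
      Set.mapsTo_id _, Set.mapsTo_id _, fun _ _ => rfl, fun _ _ => rfl⟩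
  obtain ⟨f, hf, hfU⟩ := exists_isDiscEmbedding_surjOn hU hUsc hne
  have hUc := hUsc.isPathConnected.isConnected.isPreconnected
  have hsurj : Set.SurjOn f U (ball 0 1) := hfU.ge
  have hmaps : Set.MapsTo (Function.invFunOn f U) (ball 0 1) U := hsurj.mapsTo_invFunOn
  have hright : ∀ w ∈ ball (0 : ℂ) 1, f (Function.invFunOn f U w) = w :=
    hsurj.rightInvOn_invFunOn
  have hleft : ∀ z ∈ U, Function.invFunOn f U (f z) = z := hf.injOn.leftInvOn_invFunOn
  refine ⟨ball 0 1, f, Function.invFunOn f U, isOpen_ball, convex_ball 0 1,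
    hf.differentiableOn.continuousOn, ?_, hf.mapsTo, hmaps, hleft, hright⟩
  refine fun w hw => ContinuousAt.continuousWithinAt fun t ht => ?_
  obtain ⟨s, hst, hs, hws⟩ := _root_.mem_nhds_iff.1 (inter_mem ht (hU.mem_nhds (hmaps hw)))
  have hfs := isOpen_image_of_injOn hU hUc hf.differentiableOn hf.injOn hs
    (hst.trans Set.inter_subset_right)
  rw [mem_map]
  filter_upwards [hfs.mem_nhds ⟨_, hws, hright w hw⟩]
  rintro _ ⟨z, hz, rfl⟩
  rw [Set.mem_preimage, hleft z (hst hz).2]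
  exact (hst hz).1

end riemann_mapping_limit

/-! ### From the convex model back to U -/

section holonomy

variable {φ k k' : ℂ → ℂ} {A B U : Set ℂ} {x y b : ℂ} {f g f₀ : ℂ → OnePoint ℂ}

/-- Only the paths move to the convex model; germs stay at points of U, with centres read through k.
Hence φ need not be transformed, and continuity of the Riemann map and its inverse suffices. -/
lemma Transport.map {m : ℂ → ℂ} (hm : ContinuousOn m A) (hmaps : Set.MapsTo m A B)
    (hk : ∀ z ∈ A, k' (m z) = k z) (H : Transport k A x f y g) :
    Transport k' B (m x) f (m y) g := by
  have hx := H.left_mem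
  have hy := H.right_mem
  obtain ⟨p, hp, F, hF, h0, h1⟩ := H
  refine ⟨p.map' (hm.mono (Set.range_subset_iff.2 hp)), fun t => hmaps (hp t), F, ?_, ?_, ?_⟩
  · have : (fun t => k' (p.map' (hm.mono (Set.range_subset_iff.2 hp)) t)) = fun t => k (p t) :=
      funext fun t => hk _ (hp t)
    rw [this]
    exact hF
  · rwa [hk x hx]
  · rwa [hk y hy]

lemma hol_map {m : ℂ → ℂ} (hm : ContinuousOn m A) (hmaps : Set.MapsTo m A B)
    (hk : ∀ z ∈ A, k' (m z) = k z) : hol k A x f ⊆ hol k' B (m x) f :=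
  fun _ hγ => ⟨hγ.1, hγ.2.map hm hmaps hk⟩

lemma holonomyGroup_eq_hol : holonomyGroup φ U b f₀ = hol id (U \ poles φ U) b f₀ := by
  ext γ
  constructor
  · rintro ⟨hγ, p, hp, F, ⟨h1, h2⟩, h3⟩
    exact ⟨hγ, p, hp, F, ⟨h1, h2⟩, h3⟩
  · rintro ⟨hγ, p, hp, F, ⟨h1, h2⟩, h3⟩
    exact ⟨hγ, p, hp, F, ⟨h1, h2⟩, h3⟩

lemma exists_primitive_of_notMem_poles (hφ : MeromorphicOn φ U) (hb : b ∈ U \ poles φ U) :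
    ∃ f, IsSchwarzianPrimitiveAt φ f b :=
  exists_primitive_of_order_nonneg (hφ b hb.1) (not_lt.1 fun h => hb.2 ⟨hb.1, h⟩)

lemma isAdmissible_id (hφ : MeromorphicOn φ U) : IsAdmissible φ id (U \ poles φ U) :=
  ⟨continuousOn_id, fun _ hz => exists_primitive_of_notMem_poles hφ hz⟩

lemma hasParabolicMonodromy {D : Set ℂ} {h : ℂ → ℂ} {c : ℂ} {d : ℕ} {q : ℂ → ℂ} (hD : IsOpen D)
    (hk : ContinuousOn k D) (hhk : ∀ w ∈ D, h (k w) = w) (hc : h c ∈ D) (hkc : k (h c) = c)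
    (hd : 1 ≤ d) (hφ : HasExpansion φ c d q) : HasParabolicMonodromy φ k (h c) := by
  obtain ⟨e, -, -, ε, hε, he, hprim, -, -⟩ := exists_density hd hφ
  have hmem : k ⁻¹' Metric.ball c ε ∈ 𝓝 (h c) :=
    (hk.continuousAt (hD.mem_nhds hc)).preimage_mem_nhds (by
      rw [hkc]; exact Metric.ball_mem_nhds c hε)
  have hmaps : Set.MapsTo k ((D ∩ k ⁻¹' Metric.ball c ε) \ {h c}) (Metric.ball c ε \ {c}) :=
    fun w hw => ⟨hw.1.2, fun heq => hw.2 (by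
      rw [Set.mem_singleton_iff] at heq ⊢
      rw [← heq, hhk w hw.1.1])⟩
  refine ⟨D ∩ k ⁻¹' Metric.ball c ε, inter_mem (hD.mem_nhds hc) hmem, fun y hy g hg γ hγ => ?_⟩
  exact hol_of_density he hprim (hmaps hy) hg
    (hol_map (hk.mono fun w hw => hw.1.1) hmaps (fun _ _ => rfl) hγ)

/-- The holonomy group is generated by finitely many parabolic transformations. -/
theorem exists_hol_generators (hU : IsOpen U) (hUsc : IsSimplyConnected U)
    (hφ : MeromorphicOn φ U) (hfin : (poles φ U).Finite) {d : ℂ → ℕ} {a : ℂ → ℕ → ℂ}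
    (hd : ∀ c ∈ poles φ U, 2 ≤ d c) (hloc : ∀ c ∈ poles φ U, HasLocalForm φ c (d c) (a c))
    (hb : b ∈ U \ poles φ U) (hf₀ : IsSchwarzianPrimitiveAt φ f₀ b) :
    ∃ S : Set (Equiv.Perm (OnePoint ℂ)), S.Finite ∧ (∀ γ ∈ S, IsParabolicMoebius γ) ∧
      hol id (U \ poles φ U) b f₀ = (Subgroup.closure S : Set _) := by
  obtain ⟨D, h, k, hD, hDc, hh, hk, hhm, hkm, hkh, hhk⟩ := exists_convex_model hU hUsc
  set P := poles φ U with hP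
  have hPU : P ⊆ U := fun z hz => hz.1
  have hmaps : Set.MapsTo h (U \ P) (D \ h '' P) := fun z hz => ⟨hhm hz.1, by
    rintro ⟨c, hc, hcz⟩
    refine hz.2 ?_
    rwa [← hkh z hz.1, ← hcz, hkh c (hPU hc)]⟩
  have hmaps' : Set.MapsTo k (D \ h '' P) (U \ P) := fun w hw =>
    ⟨hkm hw.1, fun hkw => hw.2 ⟨k w, hkw, hhk w hw.1⟩⟩
  have hA : IsAdmissible φ k (D \ h '' P) := ⟨hk.mono Set.sdiff_subset, fun w hw =>
    exists_primitive_of_notMem_poles hφ (hmaps' hw)⟩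
  obtain ⟨S, hSf, hSp, hS⟩ := exists_generators (hfin.image h) _ hD hDc rfl hA
    (by
      rintro _ ⟨⟨c, hc, rfl⟩, hcD⟩
      obtain ⟨q, hq, -⟩ := (hloc c hc).exists_expansion
      exact hasParabolicMonodromy hD hk hhk hcD (hkh c (hPU hc))
        (one_le_two.trans (hd c hc)) hq)
    (hmaps hb) (f := f₀) (by rwa [hkh b hb.1])
  refine ⟨S, hSf, hSp, ?_⟩
  rw [← hS]
  refine (hol_map (hh.mono Set.sdiff_subset) hmaps fun z hz => hkh z hz.1).antisymm ?_
  have := hol_map (k' := id) (f := f₀) (x := h b) (hk.mono Set.sdiff_subset) hmaps'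
    (fun _ _ => rfl)
  rwa [hkh b hb.1] at this

/-- A global primitive, composed with one Möbius transformation, is a constant family continuing f₀
along every loop. -/
lemma hol_subset_of_primitive (hf : IsSchwarzianPrimitiveOn φ f U) (hA : A ⊆ U)
    (hb : b ∈ A) (hf₀ : IsSchwarzianPrimitiveAt φ f₀ b) : hol id A b f₀ ⊆ {1} := by
  rintro γ ⟨hγ, p, hp, F, hF, h0, h1⟩
  obtain ⟨β, hβ, hβf⟩ := (hf b (hA hb)).exists_moebius hf₀
  have hconst : IsContinuation (fun t => id (p t)) (fun _ z => β (f z)) :=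
    isContinuation_const fun t => (hf _ (hA (hp t))).1.moebius hβ
  have u := hF.unique p.continuous hconst (x₀ := 0) (by
    simp only [Path.source]; exact h0.trans hβf) 1
  simp only [Path.target] at u
  refine moebius_unique hf₀.1 hf₀.2.1 hγ (one_mem _) ?_
  filter_upwards [h1, u, hβf] with z k1 k2 k3
  rw [← k1, k2, ← k3]; rfl

lemma isPathConnected_diff_poles (hU : IsOpen U) (hUsc : IsSimplyConnected U)
    (hfin : (poles φ U).Finite) : IsPathConnected (U \ poles φ U) :=
  isPathConnected_diff_finite hU hUsc.isPathConnected.isConnected.isPreconnected hUsc.nonempty hfin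

/-- The germ is carried to a point near c. Triviality of holonomy passes to small loops around c, so
the residue vanishes, and reduction of order gives the solution that forces the determinant to
vanish. -/
lemma det_eq_zero_of_hol_subset (hU : IsOpen U) (hUsc : IsSimplyConnected U)
    (hφ : MeromorphicOn φ U) (hfin : (poles φ U).Finite) {c : ℂ} (hc : c ∈ poles φ U) {d : ℕ}
    {a : ℕ → ℂ} (hd : 1 ≤ d) (hloc : HasLocalForm φ c d a) (hb : b ∈ U \ poles φ U)
    (hf₀ : IsSchwarzianPrimitiveAt φ f₀ b) (hhol : hol id (U \ poles φ U) b f₀ ⊆ {1}) :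
    (coeffMatrix d a).det = 0 := by
  obtain ⟨q, hq, hqa⟩ := hloc.exists_expansion
  obtain ⟨e, M, r, ε, hε, he, hprim, hM, hr⟩ := exists_density hd hq
  -- The disc is shrunk until c is its only pole.
  have hnear : U \ (poles φ U \ {c}) ∈ 𝓝 c :=
    (hU.sdiff (hfin.sdiff).isClosed).mem_nhds ⟨hc.1, fun h => h.2 rfl⟩
  obtain ⟨δ, hδ, hδU⟩ := Metric.mem_nhds_iff.1 hnear
  set ρ := min ε δ with hρ
  have hρ0 : 0 < ρ := lt_min hε hδ
  have hsub : Metric.ball c ρ \ {c} ⊆ Metric.ball c ε \ {c} :=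
    Set.sdiff_subset_sdiff_left (Metric.ball_subset_ball (min_le_left _ _))
  have hsubU : Metric.ball c ρ \ {c} ⊆ U \ poles φ U := fun z hz =>
    have h1 := hδU (Metric.ball_subset_ball (min_le_right ε δ) hz.1)
    ⟨h1.1, fun h => h1.2 ⟨h, hz.2⟩⟩
  obtain ⟨x, hx⟩ := nonempty_diff_finite Metric.isOpen_ball ⟨c, Metric.mem_ball_self hρ0⟩
    (Set.finite_singleton c)
  have hA := isAdmissible_id hφ
  obtain ⟨g, hg, hgp⟩ := exists_transport hA
    ((isPathConnected_diff_poles hU hUsc hfin).joinedIn b hb x (hsubU hx)) hf₀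
  rw [hol_eq_of_transport hA hf₀ hg] at hhol
  have hr0 := residue_eq_zero hρ0 (fun z hz => he z (hsub hz)) (fun z hz => hprim z (hsub hz))
    (fun z hz => hM z (hsub hz)) hx hgp ((hol_mono hsubU).trans hhol)
  obtain ⟨w, hw, hw0, hop⟩ := hr hr0
  exact det_coeffMatrix_eq_zero_of_solution hd hq.1 hqa hw hw0 hop

lemma exists_isSchwarzianPrimitiveOn (hU : IsOpen U) (hUsc : IsSimplyConnected U)
    (hloc : ∀ z ∈ U, ∃ f, IsSchwarzianPrimitiveAt φ f z) :
    ∃ f, IsSchwarzianPrimitiveOn φ f U := by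
  have := hUsc.simplyConnectedSpace
  have := hU.locallyPathConnectedSpace
  obtain ⟨z₀, hz₀⟩ := hUsc.nonempty
  obtain ⟨f₀, hf₀⟩ := hloc z₀ hz₀
  obtain ⟨F, hF, hFp, -⟩ := exists_continuation (φ := φ) (X := U) continuous_subtype_val
    (fun z => hloc z z.2) ⟨z₀, hz₀⟩ hf₀
  classical
  -- The diagonal values F z z glue the germs: near z, compatibility identifies them with the single
  -- germ at z.
  refine ⟨fun z => if hz : z ∈ U then F ⟨z, hz⟩ z else ∞, fun z hz => ?_⟩
  refine (hFp ⟨z, hz⟩).congr ?_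
  have h1 := hF.compatible ⟨z, hz⟩
  rw [nhds_subtype_eq_comap, eventually_comap] at h1
  filter_upwards [h1, hU.mem_nhds hz] with w hw hwU
  rw [dif_pos hwU]
  exact (hw ⟨w, hwU⟩ rfl).self_of_nhds.symm

lemma exists_primitive_of_det (hφ : MeromorphicOn φ U) {d : ℂ → ℕ} {a : ℂ → ℕ → ℂ}
    (hd : ∀ c ∈ poles φ U, 2 ≤ d c) (hloc : ∀ c ∈ poles φ U, HasLocalForm φ c (d c) (a c))
    (hdet : ∀ c ∈ poles φ U, (coeffMatrix (d c) (a c)).det = 0) {z : ℂ} (hz : z ∈ U) :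
    ∃ f, IsSchwarzianPrimitiveAt φ f z := by
  by_cases hzp : z ∈ poles φ U
  · obtain ⟨q, hq, hqa⟩ := (hloc z hzp).exists_expansion
    exact exists_primitive_of_det_eq_zero (one_le_two.trans (hd z hzp)) hq hqa (hdet z hzp)
  · exact exists_primitive_of_notMem_poles hφ ⟨hz, hzp⟩

lemma isSchwarzianPrimitiveOn_iff_exists_moebius (hU : IsOpen U) (hUc : IsPreconnected U)
    (hne : U.Nonempty) (hf : IsSchwarzianPrimitiveOn φ f U) :
    IsSchwarzianPrimitiveOn φ g U ↔ ∃ γ ∈ moebiusGroup, ∀ z ∈ U, g z = γ (f z) := by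
  constructor
  · intro hg
    obtain ⟨z₀, hz₀⟩ := hne
    obtain ⟨γ, hγ, h⟩ := (hf z₀ hz₀).exists_moebius (hg z₀ hz₀)
    exact ⟨γ, hγ, fun z hz => (eventuallyEq_of_isPreconnected hUc (fun z hz => (hg z hz).1)
      (fun z hz => (hf z hz).1.moebius hγ) hz₀ h hz).self_of_nhds⟩
  · rintro ⟨γ, hγ, h⟩ z hz
    refine ((hf z hz).moebius hγ).congr ?_
    filter_upwards [hU.mem_nhds hz] with w hw
    exact (h w hw).symm

end holonomy

end SchwarzianPrimitive

end

theorem corollary3p2 (U : Set ℂ) (hUopen : IsOpen U) (hUsc : SimplyConnectedSpace U)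
    (φ : ℂ → ℂ) (hφ : MeromorphicOn φ U)
    (hfin : (SchwarzianPrimitive.poles φ U).Finite)
    (d : ℂ → ℕ) (a : ℂ → ℕ → ℂ)
    (hd : ∀ c ∈ SchwarzianPrimitive.poles φ U, 2 ≤ d c)
    (hloc : ∀ c ∈ SchwarzianPrimitive.poles φ U,
      SchwarzianPrimitive.HasLocalForm φ c (d c) (a c)) :
    -- the data from which the holonomy group is computed exist at every base point
    (∀ b ∈ U \ SchwarzianPrimitive.poles φ U,
      ∃ f₀ : ℂ → OnePoint ℂ, SchwarzianPrimitive.IsSchwarzianPrimitiveAt φ f₀ b) ∧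
    -- the holonomy group is generated by finitely many parabolic transformations,
    -- and it is trivial if and only if a Schwarzian primitive exists
    (∀ b ∈ U \ SchwarzianPrimitive.poles φ U, ∀ f₀ : ℂ → OnePoint ℂ,
      SchwarzianPrimitive.IsSchwarzianPrimitiveAt φ f₀ b →
        (∃ S : Set (Equiv.Perm (OnePoint ℂ)), S.Finite ∧
          (∀ γ ∈ S, SchwarzianPrimitive.IsParabolicMoebius γ) ∧
          SchwarzianPrimitive.holonomyGroup φ U b f₀ = (Subgroup.closure S : Set _)) ∧
        ((∃ f : ℂ → OnePoint ℂ, SchwarzianPrimitive.IsSchwarzianPrimitiveOn φ f U) ↔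
          SchwarzianPrimitive.holonomyGroup φ U b f₀ = {1})) ∧
    -- a Schwarzian primitive exists if and only if the determinant vanishes at every pole
    ((∃ f : ℂ → OnePoint ℂ, SchwarzianPrimitive.IsSchwarzianPrimitiveOn φ f U) ↔
      ∀ c ∈ SchwarzianPrimitive.poles φ U,
        (SchwarzianPrimitive.coeffMatrix (d c) (a c)).det = 0) ∧
    -- uniqueness up to post-composition with Möbius transformations
    (∀ f g : ℂ → OnePoint ℂ, SchwarzianPrimitive.IsSchwarzianPrimitiveOn φ f U →
      (SchwarzianPrimitive.IsSchwarzianPrimitiveOn φ g U ↔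
        ∃ γ ∈ SchwarzianPrimitive.moebiusGroup, ∀ z ∈ U, g z = γ (f z))) := by
  open SchwarzianPrimitive in
  have hUs : IsSimplyConnected U := hUsc
  have hdet : ∀ b ∈ U \ poles φ U, ∀ f₀, IsSchwarzianPrimitiveAt φ f₀ b →
      hol id (U \ poles φ U) b f₀ ⊆ {1} → ∀ c ∈ poles φ U, (coeffMatrix (d c) (a c)).det = 0 :=
    fun b hb f₀ hf₀ hhol c hc => det_eq_zero_of_hol_subset hUopen hUs hφ hfin hc
      (one_le_two.trans (hd c hc)) (hloc c hc) hb hf₀ hhol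
  have hprim : (∀ c ∈ poles φ U, (coeffMatrix (d c) (a c)).det = 0) →
      ∃ f, IsSchwarzianPrimitiveOn φ f U := fun h =>
    exists_isSchwarzianPrimitiveOn hUopen hUs fun _ hz => exists_primitive_of_det hφ hd hloc h hz
  refine ⟨fun b hb => exists_primitive_of_notMem_poles hφ hb, fun b hb f₀ hf₀ => ⟨?_, ?_, ?_⟩,
    ⟨?_, hprim⟩, fun f g hf => isSchwarzianPrimitiveOn_iff_exists_moebius hUopen
      hUs.isPathConnected.isConnected.isPreconnected hUs.nonempty hf⟩
  · rw [holonomyGroup_eq_hol]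
    exact exists_hol_generators hUopen hUs hφ hfin hd hloc hb hf₀
  · rintro ⟨f, hf⟩
    rw [holonomyGroup_eq_hol]
    refine (hol_subset_of_primitive hf Set.sdiff_subset hb hf₀).antisymm ?_
    rw [Set.singleton_subset_iff]
    exact (holSubgroup (isAdmissible_id hφ) hb hf₀).one_mem
  · intro h
    rw [holonomyGroup_eq_hol] at h
    exact hprim (hdet b hb f₀ hf₀ h.le)
  · rintro ⟨f, hf⟩
    -- Any base point serves, with the global primitive as its own initial germ.
    obtain ⟨b, hb⟩ := nonempty_diff_finite hUopen hUs.nonempty hfin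
    exact hdet b hb f (hf b hb.1) (hol_subset_of_primitive hf Set.sdiff_subset hb (hf b hb.1))
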